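/- Let $V$ be a finite connected graph with a vertex $v$ (loops and multiple edges allowed), and let $\phi:V\to V$ be a map sending vertices to vertices and each edge $e\cong[0,1]$ to a combinatorial path $\phi(e)$: that is, $e$ is subdivided into finitely many intervals, each mapped linearly onto an edge. Assume: * $\phi$ is $\pi_1$-injective; * $\phi$ is a train track map: for every edge $e$ and $n\ge 0$ the path $\phi^n(e)$ is immersed; * every edge is expanding: $\phi^k(e)\ne e$ for all edges $e$ and all $k>0$; * the transition matrix $\mathfrak M$, whose $(e,f)$-entry is the number of times $\phi(e)$ traverses $f$ in either direction, is irreducible; * $G=\pi_1(X,v)$ is word-hyperbolic, where $X=V\times[0,1]/(x,1)\sim(\phi(x),0)$ is the mapping torus. Let $F\le G$ be the image of $\pi_1(V,v)$. Let $\widetilde X$ be the universal cover of $X$, and let $\widetilde\phi$ be the forward flow on the preimage of $V=V\times\{0\}$ in $\widetilde X$, which carries a point $x$ to the end of the lift starting at $x$ of the segment $\{\bar x\}\times[0,1]$, where $\bar x$ is the image of $x$ in $V$; this lift is the midsegment of $x$. Let $\widetilde V_n$ ($n\in\mathbb Z$) be the part of the preimage of $V$ of height $n$, where the height is normalised by giving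 the base vertex of $\widetilde X$ height $0$ and is raised by $1$ by $\widetilde\phi$. A forward path is a finite concatenation of consecutive midsegments, starting at a point $x$ of the preimage of $V$ and ending at $\widetilde\phi^M(x)$ for some $M\ge0$. Two points of $\widetilde X$ are equivalent if they lie on forward paths that intersect; the equivalence classes are the leaves, and $\mathcal L_x$ denotes the leaf of $x$. Then $\mathfrak M$ has an eigenvalue $\varpi>1$ with an eigenvector $c$, $\sum_f\mathfrak M_{ef}c_f=\varpi c_e$, all of whose entries are positive. For any such $\varpi$ and $c$, let $\mathsf d_n:\widetilde V_n\times\widetilde V_n\to[0,\infty]$ be the path metric in which each lift of an edge $e$ has length $\varpi^{-n}c_e$ (and distance $\infty$ between different components). For $x,y\in\widetilde V_k$ the limit $$\mathsf d_\infty(\mathcal L_x,\mathcal L_y)=\lim_{n\to\infty}\mathsf d_{k+n}\big(\widetilde\phi^n(x),\widetilde\phi^n(y)\big)$$ exists, is finite, and depends only on the two leaves; it induces a metric on the quotient $\mathcal Y$ of the set of leaves obtained by identifying leaves with $\mathsf d_\infty=0$. Let $\rho:\widetilde X\to\mathcal Y$ send a point to the class of its leaf. Then: 1. $\rho$ is continuous.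 2. $(\mathcal Y,\mathsf d_\infty)$ is a $0$-hyperbolic geodesic metric space, i.e. an $\mathbb R$-tree. 3. $\mathcal Y$ admits a $G$-action by homeomorphisms with respect to which $\rho$ is $G$-equivariant. 4. The restriction of this action to $F$ is an action by isometries. 5. The stabilizer in $F$ of $\rho(\tilde x)$ is trivial whenever $\tilde x\in\widetilde X$ is a lift of a periodic point of $V$, i.e. of a point $x\in V$ with $\phi^n(x)=x$ for some $n\ge1$. -/

import Mathlib

open CategoryTheory Filter Topology

noncomputable section

universe u w

/-! ## Metric notions -/

/-- Gromov's four-point condition with constant `δ` for a distance function `d`. -/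
def FourPoint {α : Type*} (d : α → α → ℝ) (δ : ℝ) : Prop :=
  ∀ x y z t : α, d x y + d z t ≤ max (d x z + d y t) (d x t + d y z) + 2 * δ

/-- A geodesic metric space. -/
def IsGeodesicSpace (Y : Type*) [MetricSpace Y] : Prop :=
  ∀ x y : Y, ∃ γ : ℝ → Y, γ 0 = x ∧ γ (dist x y) = y ∧
    ∀ s ∈ Set.Icc 0 (dist x y), ∀ t ∈ Set.Icc 0 (dist x y), dist (γ s) (γ t) = |s - t|

/-- An `ℝ`-tree: a `0`-hyperbolic geodesic metric space. -/
def IsRTree (Y : Type*) [MetricSpace Y] : Prop :=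
  IsGeodesicSpace Y ∧ FourPoint (fun x y : Y => dist x y) 0

/-- The word length of `g` with respect to `S` (only used when `S` generates). -/
def wordLength {G : Type*} [Group G] (S : Set G) (g : G) : ℕ :=
  sInf {n | ∃ l : List G, l.length = n ∧ (∀ a ∈ l, a ∈ S ∨ a⁻¹ ∈ S) ∧ l.prod = g}

/-- A word-hyperbolic group: finitely generated, with a Gromov hyperbolic word metric. -/
def IsWordHyperbolic (G : Type*) [Group G] : Prop :=
  ∃ S : Set G, S.Finite ∧ Subgroup.closure S = ⊤ ∧
    ∃ δ : ℝ, FourPoint (fun g h : G => (wordLength S (g⁻¹ * h) : ℝ)) δ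

/-! ## Geometric realisation of a graph and its path metric -/

/-- A graph with vertex set `Ve`, edge set `Ed` (each edge with a chosen orientation),
and initial and terminal vertices `ι e`, `τ e`. Loops and multiple edges are allowed. -/
structure Gph (Ve Ed : Type*) where
  ι : Ed → Ve
  τ : Ed → Ve

namespace Gph

variable {Ve Ed : Type*}

/-- The points of the realisation: the vertices, and the interior points of the edges, an open
edge being a copy of `(0,1)`. -/
def Pt (_ : Gph Ve Ed) : Type _ := Ve ⊕ (Ed × Set.Ioo (0 : ℝ) 1)

/-- The point with parameter `s ∈ [0,1]` on the closed edge `e`. -/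
def onEdge (Γ : Gph Ve Ed) (e : Ed) (s : ℝ) : Γ.Pt :=
  if h : 0 < s ∧ s < 1 then Sum.inr (e, ⟨s, h⟩)
  else if s ≤ 0 then Sum.inl (Γ.ι e) else Sum.inl (Γ.τ e)

/-- The topology of the CW complex: a set is open iff its preimage in every closed edge is. -/
instance (Γ : Gph Ve Ed) : TopologicalSpace Γ.Pt :=
  ⨆ e : Ed, TopologicalSpace.coinduced (fun s : unitInterval => Γ.onEdge e s) inferInstance

/-- Given a list of oriented edges with positive widths, cut `[0, total width]` into consecutive
intervals of these widths, and map each of them linearly onto the corresponding edge, following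
its orientation. This returns the image of `s` (and `p₀` for the empty list). -/
def locate (Γ : Gph Ve Ed) (p₀ : Γ.Pt) : List ((Ed × Bool) × ℝ) → ℝ → Γ.Pt
  | [], _ => p₀
  | ((e, b), r) :: l, s =>
      if s ≤ r then Γ.onEdge e (if b then s / r else 1 - s / r) else locate Γ p₀ l (s - r)

/-- `Γ.Chain c x y r`: there is a path from `x` to `y` of length `r`, travelling in finitely many
moves, each inside one closed edge; the subinterval `[a,b]` of `e` has length `(b - a) * c e`. -/
inductive Chain (Γ : Gph Ve Ed) (c : Ed → ℝ) : Γ.Pt → Γ.Pt → ℝ → Prop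
  | refl (x : Γ.Pt) : Chain Γ c x x 0
  | move {x : Γ.Pt} {r : ℝ} (e : Ed) (s t : ℝ) (hs : s ∈ Set.Icc (0 : ℝ) 1)
      (ht : t ∈ Set.Icc (0 : ℝ) 1) (h : Chain Γ c x (Γ.onEdge e s) r) :
      Chain Γ c x (Γ.onEdge e t) (r + c e * |s - t|)

/-- The path metric with edge weights `c`; it is `∞` between different components. -/
def pathDist (Γ : Gph Ve Ed) (c : Ed → ℝ) (x y : Γ.Pt) : ENNReal :=
  ⨅ (r : ℝ) (_ : Γ.Chain c x y r), ENNReal.ofReal r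

end Gph

/-! ## Graph maps -/

/-- Edge paths in a graph `V` (a quiver: the arrows are the edges, with a chosen orientation); the
edges may be traversed in both directions. -/
inductive EdgePath {V : Type u} [Quiver.{w} V] (a : V) : V → Type (max u w)
  | nil : EdgePath a a
  | fwd {b c : V} (p : EdgePath a b) (e : b ⟶ c) : EdgePath a c
  | bwd {b c : V} (p : EdgePath a b) (e : c ⟶ b) : EdgePath a c

/-- The oriented edges traversed by an edge path; `true` means "along the chosen orientation". -/
def edgeList {V : Type u} [Quiver.{w} V] {a : V} :
    ∀ {b : V}, EdgePath a b → List (Quiver.Total V × Bool)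
  | _, .nil => []
  | _, .fwd p e => edgeList p ++ [(⟨_, _, e⟩, true)]
  | _, .bwd p e => edgeList p ++ [(⟨_, _, e⟩, false)]

/-- A vertex of a graph, as an object of its fundamental groupoid. -/
def vtx {V : Type u} [Quiver.{w} V] (a : V) : Quiver.FreeGroupoid V :=
  (Quiver.FreeGroupoid.of V).obj a

/-- The homotopy class of a single edge. -/
def edgeClass {V : Type u} [Quiver.{w} V] {a b : V} (e : a ⟶ b) : vtx a ⟶ vtx b :=
  (Quiver.FreeGroupoid.of V).map e

/-- The homotopy class, relative to the endpoints, of an edge path. -/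
def pathClass {V : Type u} [Quiver.{w} V] {a : V} : ∀ {b : V}, EdgePath a b → (vtx a ⟶ vtx b)
  | _, .nil => 𝟙 (vtx a)
  | _, .fwd p e => pathClass p ≫ edgeClass e
  | _, .bwd p e => pathClass p ≫ Groupoid.inv (edgeClass e)

/-- A map of the graph `V` that sends vertices to vertices and each edge `e` to a combinatorial
path `edge e`: the edge `[0,1]` is subdivided into consecutive intervals, of lengths `width e`, which are mapped linearly onto the
successive edges of the path. -/
structure GraphMap (V : Type u) [Quiver.{w} V] where
  obj : V → V
  edge : ∀ {a b : V}, (a ⟶ b) → EdgePath (obj a) (obj b)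
  width : ∀ {a b : V}, (a ⟶ b) → List ℝ
  width_length : ∀ {a b : V} (e : a ⟶ b), (width e).length = (edgeList (edge e)).length
  width_pos : ∀ {a b : V} (e : a ⟶ b), ∀ r ∈ width e, 0 < r
  width_sum : ∀ {a b : V} (e : a ⟶ b), (width e).sum = 1

/-- The graph `V`, to be realised. -/
def baseGraph (V : Type u) [Quiver.{w} V] : Gph V (Quiver.Total V) where
  ι e := e.left
  τ e := e.right

namespace GraphMap

variable {V : Type u} [Quiver.{w} V] (φ : GraphMap V)

/-- The map of the realisation of `V` to itself. -/
def onPt : (baseGraph V).Pt → (baseGraph V).Pt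
  | Sum.inl a => Sum.inl (φ.obj a)
  | Sum.inr (e, s) =>
      (baseGraph V).locate (Sum.inl (φ.obj e.left))
        ((edgeList (φ.edge e.hom)).zip (φ.width e.hom)) s

/-- A point of `V` is periodic if some positive iterate of `φ` fixes it. -/
def IsPeriodicPoint (x : (baseGraph V).Pt) : Prop := ∃ n : ℕ, 1 ≤ n ∧ φ.onPt^[n] x = x

/-- The map induced by `φ` on the fundamental groupoid of `V`. -/
def functor : Quiver.FreeGroupoid V ⥤ Quiver.FreeGroupoid V :=
  Quiver.FreeGroupoid.lift
    { obj := fun a => vtx (φ.obj a)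
      map := fun e => pathClass (φ.edge e) }

/-- `φ` is `π₁`-injective. -/
def IsPiOneInjective (v : V) : Prop :=
  Function.Injective (φ.functor.mapVertexGroup (vtx v))

/-- The path `φ(e)` for an oriented edge `e`. -/
def onOriented (x : Quiver.Total V × Bool) : List (Quiver.Total V × Bool) :=
  if x.2 then edgeList (φ.edge x.1.hom) else FreeGroup.invRev (edgeList (φ.edge x.1.hom))

/-- The (untightened) path `φⁿ(e)`, as a list of oriented edges. -/
def iterEdge (n : ℕ) (e : Quiver.Total V) : List (Quiver.Total V × Bool) :=
  (fun l : List (Quiver.Total V × Bool) => l.flatMap φ.onOriented)^[n] [(e, true)]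

/-- Train track map: all paths `φⁿ(e)` are immersed, i.e. nontrivial and without backtracking. -/
def IsTrainTrack : Prop :=
  ∀ (e : Quiver.Total V) (n : ℕ), φ.iterEdge n e ≠ [] ∧ FreeGroup.IsReduced (φ.iterEdge n e)

/-- Every edge is expanding: `φᵏ(e) ≠ e` for `k > 0`. -/
def HasExpandingEdges : Prop :=
  ∀ (e : Quiver.Total V) (k : ℕ), 0 < k → φ.iterEdge k e ≠ [(e, true)]

open Classical in
/-- The transition matrix: the `(e, f)`-entry counts how often `φ(e)` traverses `f`, in either
direction. -/
def transition : Matrix (Quiver.Total V) (Quiver.Total V) ℝ :=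
  fun e f => (((edgeList (φ.edge e.hom)).map Prod.fst).count f : ℝ)

/-- `ϖ` is an eigenvalue of the transition matrix with an eigenvector `c` all of whose entries are
positive: `∑ f, 𝔐 e f * c f = ϖ * c e`. -/
def IsPerron [Fintype (Quiver.Total V)] (ϖ : ℝ) (c : Quiver.Total V → ℝ) : Prop :=
  (∀ e, 0 < c e) ∧ φ.transition.mulVec c = ϖ • c

/-! ## The mapping torus `X`, its fundamental groupoid, and the groups `G` and `F` -/

/-- The oriented 1-cells of the mapping torus: the (vertical) edges of `V`, and a horizontal edge
`t_a` from `a` to `φ(a)` for every vertex `a`. -/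
inductive XEdge : V → V → Type (max u w)
  | vert {a b : V} (e : a ⟶ b) : XEdge a b
  | hor (a : V) : XEdge a (φ.obj a)

/-- The vertices of the mapping torus `X`. -/
structure Skel (_ψ : GraphMap V) where
  pt : V

instance : Quiver φ.Skel := ⟨fun a b => φ.XEdge a.pt b.pt⟩

/-- The vertex `a` of `V`, as an object of the fundamental groupoid of the 1-skeleton of `X`. -/
def vtx₁ (a : V) : Quiver.FreeGroupoid φ.Skel := vtx (⟨a⟩ : φ.Skel)

/-- The class of a vertical edge, in the fundamental groupoid of the 1-skeleton of `X`. -/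
def vert₁ {a b : V} (e : a ⟶ b) : φ.vtx₁ a ⟶ φ.vtx₁ b :=
  edgeClass (V := φ.Skel) (a := ⟨a⟩) (b := ⟨b⟩) (XEdge.vert e)

/-- The class of the horizontal edge `t_a`, in the fundamental groupoid of the 1-skeleton of
`X`. -/
def hor₁ (a : V) : φ.vtx₁ a ⟶ φ.vtx₁ (φ.obj a) :=
  edgeClass (V := φ.Skel) (a := ⟨a⟩) (b := ⟨φ.obj a⟩) (XEdge.hor a)

/-- The class of an edge path of `V`, in the fundamental groupoid of the 1-skeleton of `X`. -/
def vertPath₁ {a : V} : ∀ {b : V}, EdgePath a b → (φ.vtx₁ a ⟶ φ.vtx₁ b)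
  | _, .nil => 𝟙 (φ.vtx₁ a)
  | _, .fwd p e => vertPath₁ p ≫ φ.vert₁ e
  | _, .bwd p e => vertPath₁ p ≫ Groupoid.inv (φ.vert₁ e)

/-- Each edge `e : a ⟶ b` of `V` gives a 2-cell of `X`, by which `t_a φ(e)` is homotopic to
`e t_b`. -/
inductive TwoCell : HomRel (Quiver.FreeGroupoid (φ.Skel))
  | cell {a b : V} (e : a ⟶ b) :
      TwoCell (φ.hor₁ a ≫ φ.vertPath₁ (φ.edge e)) (φ.vert₁ e ≫ φ.hor₁ b)

/-- The fundamental groupoid of the mapping torus `X` on its vertices: homotopy classes of edge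
paths of the 2-complex `X`. -/
abbrev PiX : Type u := CategoryTheory.Quotient φ.TwoCell

/-- A vertex of `X`, as an object of the fundamental groupoid. -/
def base (a : V) : φ.PiX := ⟨φ.vtx₁ a⟩

/-- The class of the vertical edge `e`. -/
def vert {a b : V} (e : a ⟶ b) : φ.base a ⟶ φ.base b :=
  (Quotient.functor φ.TwoCell).map (φ.vert₁ e)

/-- The class of the horizontal edge `t_a`. -/
def hor (a : V) : φ.base a ⟶ φ.base (φ.obj a) :=
  (Quotient.functor φ.TwoCell).map (φ.hor₁ a)

/-- The class in `X` of an edge path of `V`. -/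
def inclPath {a b : V} (p : EdgePath a b) : φ.base a ⟶ φ.base b :=
  (Quotient.functor φ.TwoCell).map (φ.vertPath₁ p)

/-- The map of fundamental groupoids induced by the inclusion of `V` in `X`. -/
def inclFunctor : Quiver.FreeGroupoid V ⥤ φ.PiX :=
  Quiver.FreeGroupoid.lift { obj := φ.base, map := φ.vert }

/-- `G = π₁(X, v)`, with `g * h = g ≫ h`. -/
abbrev G (v : V) := φ.base v ⟶ φ.base v

/-- `F`: the image of `π₁(V, v)` in `G`. -/
def F (v : V) : Subgroup (φ.G v) := (φ.inclFunctor.mapVertexGroup (vtx v)).range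

/-- The height of an edge of the 1-skeleton of `X`: vertical edges have height `0` and horizontal
edges have height `1`. -/
def XEdge.height {φ : GraphMap V} {a b : V} : φ.XEdge a b → Multiplicative ℤ
  | .vert _ => 1
  | .hor _ => Multiplicative.ofAdd 1

/-- The signed number of horizontal edges of an edge path of the 1-skeleton of `X`. -/
def heightAux : Quiver.FreeGroupoid φ.Skel ⥤ SingleObj (Multiplicative ℤ) :=
  Quiver.FreeGroupoid.lift
    { obj := fun _ => SingleObj.star _
      map := fun e => XEdge.height e }

theorem lift_edgeClass {W : Type*} [Quiver W] {D : Type*} [Groupoid D] (ψ : W ⥤q D) {a b : W}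
    (e : a ⟶ b) : (Quiver.FreeGroupoid.lift ψ).map (edgeClass e) = ψ.map e :=
  Category.id_comp _

theorem heightAux_vert₁ {a b : V} (e : a ⟶ b) : φ.heightAux.map (φ.vert₁ e) = 𝟙 _ :=
  lift_edgeClass (W := φ.Skel) (D := SingleObj (Multiplicative ℤ)) _ _

theorem heightAux_vertPath₁ {a b : V} (p : EdgePath a b) :
    φ.heightAux.map (φ.vertPath₁ p) = 𝟙 _ := by
  induction p with
  | nil => exact φ.heightAux.map_id _
  | fwd p e ih =>
    rw [vertPath₁, CategoryTheory.Functor.map_comp, ih, heightAux_vert₁]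
    exact Category.id_comp _
  | bwd p e ih =>
    have h : φ.heightAux.map (Groupoid.inv (φ.vert₁ e)) = 𝟙 _ := by
      rw [Groupoid.inv_eq_inv, CategoryTheory.Functor.map_inv]
      apply IsIso.inv_eq_of_hom_inv_id
      rw [heightAux_vert₁]
      exact Category.id_comp _
    rw [vertPath₁, CategoryTheory.Functor.map_comp, ih, h]
    exact Category.id_comp _

/-- The height of paths in `X`, as a functor. On the universal cover it gives the height `q` of a
vertex relative to the base vertex. -/
def heightFunctor : φ.PiX ⥤ SingleObj (Multiplicative ℤ) :=
  CategoryTheory.Quotient.lift _ φ.heightAux <| by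
    rintro _ _ _ _ ⟨e⟩
    rw [CategoryTheory.Functor.map_comp, CategoryTheory.Functor.map_comp, heightAux_vertPath₁,
      heightAux_vert₁]
    exact (Category.comp_id _).trans (Category.id_comp _).symm

/-- The height of a homotopy class of paths in `X`. -/
def height {a b : V} (γ : φ.base a ⟶ φ.base b) : ℤ :=
  Multiplicative.toAdd (show Multiplicative ℤ from φ.heightFunctor.map γ)

/-! ## The preimage of `V` in the universal cover `X̃` -/

/-- The preimage of `V` in the universal cover of `X`. Its vertices over `a` are the homotopy
classes of paths in `X` from `v` to `a`; its edges over `e` are given by the initial vertex of the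
lift of `e`. -/
def coverGraph (v : V) :
    Gph (Σ a : V, (φ.base v ⟶ φ.base a))
      (Σ e : Quiver.Total V, (φ.base v ⟶ φ.base e.left)) where
  ι e := ⟨e.1.left, e.2⟩
  τ e := ⟨e.1.right, e.2 ≫ φ.vert e.1.hom⟩

/-- The points of the preimage of `V` in `X̃`. -/
abbrev CoverPt (v : V) : Type _ := (φ.coverGraph v).Pt

/-- The oriented edges of the lift, starting at the vertex `γ`, of an edge path in `V`. -/
def liftList {v a : V} (γ : φ.base v ⟶ φ.base a) :
    ∀ {b : V}, EdgePath a b → List ((Σ e : Quiver.Total V, (φ.base v ⟶ φ.base e.left)) × Bool)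
  | _, .nil => []
  | _, .fwd p e => liftList γ p ++ [(⟨⟨_, _, e⟩, γ ≫ φ.inclPath p⟩, true)]
  | _, .bwd p e =>
      liftList γ p ++ [(⟨⟨_, _, e⟩, γ ≫ φ.inclPath p ≫ Groupoid.inv (φ.vert e)⟩, false)]

/-- The forward flow `φ̃` on the preimage of `V`: a vertex is moved along the horizontal edge
starting there, and an edge `ẽ` over `e` is mapped, as `φ` maps `e`, onto the lift of the path
`φ(e)` that starts at the image of the initial vertex of `ẽ`. -/
def flow {v : V} : φ.CoverPt v → φ.CoverPt v
  | Sum.inl ⟨a, γ⟩ => Sum.inl ⟨φ.obj a, γ ≫ φ.hor a⟩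
  | Sum.inr (⟨e, γ⟩, s) =>
      (φ.coverGraph v).locate (Sum.inl ⟨φ.obj e.left, γ ≫ φ.hor e.left⟩)
        ((φ.liftList (γ ≫ φ.hor e.left) (φ.edge e.hom)).zip (φ.width e.hom)) s

/-- The height of a point of the preimage of `V`; the points of height `n` are those lying over
the vertex `n` of the line. -/
def ptHeight {v : V} : φ.CoverPt v → ℤ
  | Sum.inl x => φ.height x.2
  | Sum.inr (e, _) => φ.height e.2

/-- The covering projection to `V`. -/
def proj {v : V} : φ.CoverPt v → (baseGraph V).Pt
  | Sum.inl x => Sum.inl x.1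
  | Sum.inr (e, s) => Sum.inr (e.1, s)

/-- Deck transformations on the preimage of `V`. -/
def actPt {v : V} (g : φ.G v) : φ.CoverPt v → φ.CoverPt v
  | Sum.inl x => Sum.inl ⟨x.1, g ≫ x.2⟩
  | Sum.inr (e, s) => Sum.inr (⟨e.1, g ≫ e.2⟩, s)

theorem one_actPt {v : V} (x : φ.CoverPt v) : φ.actPt 1 x = x := by
  rcases x with ⟨a, γ⟩ | ⟨⟨e, γ⟩, s⟩
  · exact congrArg (fun γ' => (Sum.inl ⟨a, γ'⟩ : φ.CoverPt v)) (Category.id_comp γ)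
  · exact congrArg (fun γ' => (Sum.inr (⟨e, γ'⟩, s) : φ.CoverPt v)) (Category.id_comp γ)

theorem mul_actPt {v : V} (g h : φ.G v) (x : φ.CoverPt v) :
    φ.actPt (g * h) x = φ.actPt g (φ.actPt h x) := by
  rcases x with ⟨a, γ⟩ | ⟨⟨e, γ⟩, s⟩
  · exact congrArg (fun γ' => (Sum.inl ⟨a, γ'⟩ : φ.CoverPt v)) (Category.assoc g h γ)
  · exact congrArg (fun γ' => (Sum.inr (⟨e, γ'⟩, s) : φ.CoverPt v)) (Category.assoc g h γ)

/-! ## The universal cover `X̃` -/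

/-- The universal cover `X̃` of the mapping torus: each point is uniquely of the form `(x, s)` with
`x` in the preimage of `V` and `0 ≤ s < 1`, the segment `{x} × [0,1]` joining `x` to `φ̃(x)`. -/
def XTilde (v : V) : Type _ := φ.CoverPt v × Set.Ico (0 : ℝ) 1

/-- A point of the preimage of `V`, as a point of `X̃`. -/
def ofPt {v : V} (x : φ.CoverPt v) : φ.XTilde v := (x, ⟨0, le_rfl, one_pos⟩)

/-- The quotient map onto `X̃` from the product of the preimage of `V` with `[0,1]`; it identifies
`(x, 1)` with `(φ̃(x), 0)`. -/
def mkX {v : V} (x : φ.CoverPt v × unitInterval) : φ.XTilde v :=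
  if h : (x.2 : ℝ) < 1 then (x.1, ⟨x.2, x.2.2.1, h⟩) else φ.ofPt (φ.flow x.1)

/-- The quotient topology. -/
instance (v : V) : TopologicalSpace (φ.XTilde v) :=
  TopologicalSpace.coinduced φ.mkX inferInstance

/-- `G` acts on `X̃` by deck transformations. -/
instance (v : V) : MulAction (φ.G v) (φ.XTilde v) where
  smul g x := (φ.actPt g x.1, x.2)
  one_smul x := Prod.ext (φ.one_actPt x.1) rfl
  mul_smul g h x := Prod.ext (φ.mul_actPt g h x.1) rfl

/-! ## Leaves and the forward space `𝒴` -/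

/-- The midsegment from `x` to `φ̃(x)`. -/
def midsegment {v : V} (x : φ.CoverPt v) : Set (φ.XTilde v) :=
  Set.range fun s : unitInterval => φ.mkX (x, s)

/-- The forward path of length `M` starting at `x`. -/
def forwardPath {v : V} (x : φ.CoverPt v) (M : ℕ) : Set (φ.XTilde v) :=
  {φ.ofPt x} ∪ ⋃ i ∈ Set.Iio M, φ.midsegment (φ.flow^[i] x)

/-- Two points are equivalent if they lie on forward paths that intersect. -/
def LeafRel {v : V} (x y : φ.XTilde v) : Prop :=
  ∃ (a b : φ.CoverPt v) (M N : ℕ), x ∈ φ.forwardPath a M ∧ y ∈ φ.forwardPath b N ∧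
    (φ.forwardPath a M ∩ φ.forwardPath b N).Nonempty

/-- The set `𝒴₀` of leaves of `X̃`. -/
def Leaf (v : V) : Type _ := Quot (φ.LeafRel (v := v))

/-- The leaf through a point of `X̃`. -/
def leaf {v : V} (x : φ.XTilde v) : φ.Leaf v := Quot.mk _ x

/-- The scaled path metric `d_n` on the points of height `n`: an edge over `e` has length
`ϖ⁻ⁿ * c e`. -/
def scaledDist {v : V} (ϖ : ℝ) (c : Quiver.Total V → ℝ) (n : ℤ) (x y : φ.CoverPt v) : ENNReal :=
  ENNReal.ofReal (ϖ ^ (-n)) * (φ.coverGraph v).pathDist (fun e => c e.1) x y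

/-- `d_n(φ̃ⁿ(x), φ̃ⁿ(y))`, where `x, y` have height `k`, so that their images have height
`k + n`. -/
def flowDist {v : V} (ϖ : ℝ) (c : Quiver.Total V → ℝ) (k : ℤ) (x y : φ.CoverPt v) (n : ℕ) :
    ENNReal :=
  φ.scaledDist ϖ c (k + n) (φ.flow^[n] x) (φ.flow^[n] y)

/-- `d_∞(ℒ, ℒ') = 0`: there are points `x ∈ ℒ` and `y ∈ ℒ'` of the same height such that the scaled
distance of their forward images tends to `0`. -/
def LeafDistZero (v : V) (ϖ : ℝ) (c : Quiver.Total V → ℝ) (l l' : φ.Leaf v) : Prop :=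
  ∃ (k : ℤ) (x y : φ.CoverPt v), φ.ptHeight x = k ∧ φ.ptHeight y = k ∧
    φ.leaf (φ.ofPt x) = l ∧ φ.leaf (φ.ofPt y) = l' ∧
    Tendsto (φ.flowDist ϖ c k x y) atTop (𝓝 0)

/-- The quotient `𝒴` of the set of leaves by `d_∞ = 0`. -/
def ForwardSpace (v : V) (ϖ : ℝ) (c : Quiver.Total V → ℝ) : Type _ :=
  Quot (φ.LeafDistZero v ϖ c)

/-- The map `ρ : X̃ → 𝒴`. -/
def rho {v : V} (ϖ : ℝ) (c : Quiver.Total V → ℝ) (x : φ.XTilde v) : φ.ForwardSpace v ϖ c :=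
  Quot.mk _ (φ.leaf x)

end GraphMap

/-! The eigenvector `c` assigns lengths to the edges for which `φ` multiplies the length of every
edge path by `ϖ` before tightening. Legal paths, whose iterated images are all reduced, are
therefore stretched by exactly `ϖ ^ n`, and arbitrary paths by at most `ϖ ^ n`. So the rescaled
distance of two forward images is non-increasing in the height `N` up to an error `B * ϖ ^ (-N)`,
and it converges. The limit is finite because points of equal height flow into one component of the
preimage of `V`: every path in `X` is homotopic to one going forward, then vertically, then backward
(`exists_normal_form`).

Since `φ` is `π₁`-injective, `π₁(V)` embeds in an ascending HNN extension to which the fundamental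
groupoid of `X` maps, hence in `π₁(X)` (`IsPiOneInjective.pathClass_eq_of_inclPath_eq`). Thus the
components of the preimage of `V` are trees, and the distance of two vertices is the weighted length
of a reduced word in the edges. Such lengths satisfy the four-point condition with constant `0`
(`fourPoint_nrm`), which passes to the limit. Edges map to paths in `𝒴`, so `𝒴` is connected, and a
connected `0`-hyperbolic space is geodesic (`FourPoint.isGeodesicSpace`). A deck transformation `g`
shifts heights and so acts as a homothety of ratio `ϖ ^ (-height g)`; on `F` the height vanishes.

For the stabilizers, let `f ∈ F` fix the image of a lift `x` of a periodic point. Far enough along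
the flow, `f` is represented by a loop `w₀`; along the period, the later images of `x` lie over one
point of `V`, and `f` is represented there by further loops `w n`. Bounded cancellation
(`exists_growth`) shows that a long legal subpath forces growth at the full rate `ϖ`, hence positive
limit distance; as the limit distance of `x` and its translate is `0`, legal subpaths of the `w n`
are bounded. Each `w n` is a tightened product of a number of legal paths not depending on `n`, so
its length is bounded and two of the loops coincide. Comparing their lifts produces an element of
nonzero height commuting with `f`. In a hyperbolic group this is impossible for `f` of infinite
order (`IsWordHyperbolic.not_commute`), and `F` is torsion-free.

The eigenvector comes from the variational argument of Collatz and Wielandt. That `ϖ > 1` follows by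
iterating a shortest edge: otherwise its images would stay single edges, and some edge would be
periodic. -/

/-! ## Geodesics in connected `0`-hyperbolic spaces -/

/-- In a connected `0`-hyperbolic space, any two points are joined by points at every intermediate
distance. -/
theorem FourPoint.exists_between {Y : Type*} [MetricSpace Y] [PreconnectedSpace Y]
    (h : FourPoint (fun x y : Y => dist x y) 0) (x y : Y) {t : ℝ} (ht : t ∈ Set.Icc 0 (dist x y)) :
    ∃ p : Y, dist x p = t ∧ dist p y = dist x y - t := by
  by_contra hne
  push Not at hne
  let g : Y → ℝ := fun z => dist x z - dist z y
  have hg : Continuous g := by fun_prop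
  let U : Set Y := {z | g z ≤ 2 * t - dist x y}
  have hclosed : IsClosed U := isClosed_le hg continuous_const
  have hopen : IsOpen U := by
    rw [Metric.isOpen_iff]
    intro z hz
    rcases lt_or_eq_of_le (show g z ≤ 2 * t - dist x y from hz) with hlt | heq
    · obtain ⟨ε, hε, hsub⟩ := Metric.isOpen_iff.1 (isOpen_lt hg continuous_const) z hlt
      exact ⟨ε, hε, fun w hw => (show g w < 2 * t - dist x y from hsub hw).le⟩
    · have heq' : dist x z - dist z y = 2 * t - dist x y := heq
      -- At a point `z` of equality the ball of radius `dist x z - t` lies in `U`: there `dist x w >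
      -- t`, which excludes the first alternative of the four-point inequality, and the second one
      -- says `g w ≤ g z`. The radius is positive because `dist x z = t` would make `z` the point
      -- that is assumed missing.
      have hpos : 0 < dist x z - t := by
        have h1 := dist_triangle x z y
        rcases (show 0 ≤ dist x z - t by linarith).lt_or_eq with h2 | h2
        · exact h2
        · exact absurd (by linarith) (hne z (by linarith))
      refine ⟨_, hpos, fun w hw => ?_⟩
      rw [Metric.mem_ball] at hw
      have h1 := h x w y z
      have h2 := dist_triangle x w z
      have h3 := dist_triangle w z y
      have h4 := dist_triangle x z w
      have h5 := dist_triangle z w y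
      have h7 := dist_comm z w
      have h8 := dist_comm y z
      have h9 := dist_comm w y
      simp only [mul_zero, add_zero] at h1
      change dist x w - dist w y ≤ 2 * t - dist x y
      rcases le_max_iff.1 h1 with h6 | h6 <;> linarith
  have huniv := (isClopen_iff.1 ⟨hclosed, hopen⟩).resolve_left (by
    refine Set.Nonempty.ne_empty ⟨x, ?_⟩
    change dist x x - dist x y ≤ 2 * t - dist x y
    rw [dist_self]; linarith [ht.1])
  have hy : y ∈ U := huniv ▸ Set.mem_univ y
  have hy' : dist x y - dist y y ≤ 2 * t - dist x y := hy
  rw [dist_self] at hy'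
  have : t = dist x y := le_antisymm ht.2 (by linarith)
  exact hne y this.symm (by rw [dist_self]; linarith)

/-- Any choice of intermediate points works: the four-point inequality for `p s`, `p t`, `x`, `y`
bounds `dist (p s) (p t)` by `|s - t|`, and the triangle inequality gives the converse. -/
theorem FourPoint.isGeodesicSpace {Y : Type*} [MetricSpace Y] [PreconnectedSpace Y]
    (h : FourPoint (fun x y : Y => dist x y) 0) : IsGeodesicSpace Y := by
  intro x y
  have hex : ∀ t, ∃ p : Y, t ∈ Set.Icc 0 (dist x y) → dist x p = t ∧ dist p y = dist x y - t := by
    intro t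
    by_cases ht : t ∈ Set.Icc 0 (dist x y)
    · exact (h.exists_between x y ht).imp fun p hp _ => hp
    · exact ⟨x, fun h => absurd h ht⟩
  choose p hp2 using hex
  have hp := fun t ht => (hp2 t ht).1
  have hp' := fun t ht => (hp2 t ht).2
  have h0 : (0 : ℝ) ∈ Set.Icc 0 (dist x y) := ⟨le_rfl, dist_nonneg⟩
  have h1 : dist x y ∈ Set.Icc 0 (dist x y) := ⟨dist_nonneg, le_rfl⟩
  refine ⟨p, (dist_eq_zero.1 (hp 0 h0)).symm,
    dist_eq_zero.1 ((hp' _ h1).trans (sub_self _)), fun s hs t ht => ?_⟩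
  have h4 := h (p s) (p t) x y
  simp only [mul_zero, add_zero] at h4
  rw [dist_comm (p s) x, dist_comm (p t) x, hp s hs, hp t ht, hp' s hs, hp' t ht] at h4
  have h5 := dist_triangle x (p s) (p t)
  have h6 := dist_triangle x (p t) (p s)
  rw [dist_comm (p t) (p s)] at h6
  rw [hp s hs, hp t ht] at h5 h6
  refine le_antisymm ?_ (abs_sub_le_iff.2 ⟨by linarith, by linarith⟩)
  rcases le_max_iff.1 h4 with h7 | h7
  · linarith [neg_le_abs (s - t), le_abs_self (s - t)]
  · linarith [neg_le_abs (s - t), le_abs_self (s - t)]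

/-! ## Word length and commuting elements of hyperbolic groups -/

section WordLength

variable {G : Type*} [Group G] {S : Set G}

theorem exists_list_length_eq_wordLength (hS : Subgroup.closure S = ⊤) (g : G) :
    ∃ l : List G, l.length = wordLength S g ∧ (∀ a ∈ l, a ∈ S ∨ a⁻¹ ∈ S) ∧ l.prod = g := by
  have hg : g ∈ Submonoid.closure (S ∪ S⁻¹) := by
    rw [← Subgroup.closure_toSubmonoid, hS]
    trivial
  obtain ⟨l, hl, hg⟩ := Submonoid.exists_list_of_mem_closure hg
  exact Nat.sInf_mem (s := {n | ∃ l : List G, l.length = n ∧ (∀ a ∈ l, a ∈ S ∨ a⁻¹ ∈ S) ∧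
    l.prod = g}) ⟨_, l, rfl, by simpa using hl, hg⟩

theorem wordLength_prod_le {l : List G} (hl : ∀ a ∈ l, a ∈ S ∨ a⁻¹ ∈ S) :
    wordLength S l.prod ≤ l.length :=
  Nat.sInf_le ⟨l, rfl, hl, rfl⟩

theorem wordLength_inv (hS : Subgroup.closure S = ⊤) (g : G) :
    wordLength S g⁻¹ = wordLength S g := by
  have key : ∀ g : G, wordLength S g⁻¹ ≤ wordLength S g := by
    intro g
    obtain ⟨l, hl, hlS, rfl⟩ := exists_list_length_eq_wordLength hS g
    rw [← hl, List.prod_inv_reverse]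
    refine (wordLength_prod_le ?_).trans (by simp)
    intro a ha
    simp only [List.mem_reverse, List.mem_map] at ha
    obtain ⟨b, hb, rfl⟩ := ha
    simpa using (hlS b hb).symm
  exact le_antisymm (key g) (by simpa using key g⁻¹)

theorem abs_toAdd_le_wordLength (hS : Subgroup.closure S = ⊤) (hfin : S.Finite)
    (χ : G →* Multiplicative ℤ) :
    ∃ K : ℕ, ∀ g, |(χ g).toAdd| ≤ K * wordLength S g := by
  obtain ⟨K, hK⟩ := (hfin.image fun g => (χ g).toAdd.natAbs).bddAbove
  refine ⟨K, fun g => ?_⟩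
  obtain ⟨l, hl, hlS, rfl⟩ := exists_list_length_eq_wordLength hS g
  rw [← hl]
  clear hl
  induction l with
  | nil => simp
  | cons a l ih =>
    have ha : |(χ a).toAdd| ≤ K := by
      rw [Int.abs_eq_natAbs]
      rcases hlS a (by simp) with h | h
      · exact_mod_cast hK ⟨a, h, rfl⟩
      · have := hK ⟨_, h, rfl⟩
        simp only [map_inv, toAdd_inv, Int.natAbs_neg] at this
        exact_mod_cast this
    have := ih fun b hb => hlS b (by simp [hb])
    rw [List.prod_cons, map_mul, toAdd_mul, List.length_cons]
    push_cast
    linarith [abs_add_le (χ a).toAdd (χ l.prod).toAdd]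

theorem finite_wordLength_le (hS : Subgroup.closure S = ⊤) (hfin : S.Finite) (R : ℕ) :
    {g | wordLength S g ≤ R}.Finite := by
  have hT : (S ∪ S⁻¹).Finite := hfin.union hfin.inv
  have : Finite ↥(S ∪ S⁻¹) := hT
  refine ((List.finite_length_le ↥(S ∪ S⁻¹) R).image
    fun l => (l.map Subtype.val).prod).subset ?_
  intro g hg
  obtain ⟨l, hl, hlS, rfl⟩ := exists_list_length_eq_wordLength hS g
  have hl' : ∀ a ∈ l, a ∈ S ∪ S⁻¹ := fun a ha => by simpa using hlS a ha
  refine ⟨l.attachWith _ hl', ?_, by simp⟩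
  simpa [hl] using hg

/-- In a word-hyperbolic group with a homomorphism to `ℤ`, no element of infinite order in the
kernel commutes with an element outside of the kernel. -/
theorem IsWordHyperbolic.not_commute (hG : IsWordHyperbolic G) (χ : G →* Multiplicative ℤ)
    {f g : G} (hf : ∀ n : ℕ, f ^ n = 1 → n = 0) (hχf : χ f = 1) (hχg : χ g ≠ 1) :
    ¬ Commute f g := by
  intro hfg
  obtain ⟨S, hfin, hS, δ, hδ⟩ := hG
  set N : G → ℝ := fun g => (wordLength S g : ℝ) with hN
  have hinv : ∀ g, N g⁻¹ = N g := fun g => by simp only [hN, wordLength_inv hS]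
  obtain ⟨K, hK⟩ := abs_toAdd_le_wordLength hS hfin χ
  -- If squaring in `⟨g⟩` never added more than `4δ`, the length of `g ^ 2 ^ i` would be at most
  -- linear in `i`; but `χ` is Lipschitz and nonzero on `g`, which forces exponential growth.
  obtain ⟨v, hv, hvg⟩ : ∃ v ∈ Subgroup.zpowers g, N v + 4 * δ < N (v * v) := by
    by_contra hcon
    push Not at hcon
    have hle : ∀ i : ℕ, N (g ^ 2 ^ i) ≤ N g + 4 * δ * i := by
      intro i
      induction i with
      | zero => simp
      | succ i ih =>
        have := hcon (g ^ 2 ^ i) ⟨((2 ^ i : ℕ) : ℤ), zpow_natCast g _⟩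
        rw [← pow_add, ← mul_two, ← pow_succ] at this
        push_cast
        linarith
    have hge : ∀ i : ℕ, (2 : ℝ) ^ i ≤ K * (N g + 4 * δ * i) := by
      intro i
      have h1 := hK (g ^ 2 ^ i)
      have h2 : (1 : ℤ) ≤ |(χ g).toAdd| := Int.one_le_abs (by simpa using hχg)
      rw [map_pow, toAdd_pow, nsmul_eq_mul, abs_mul] at h1
      have h3 : ((2 ^ i : ℕ) : ℤ) ≤ K * wordLength S (g ^ 2 ^ i) := by
        refine le_trans ?_ h1
        rw [Nat.abs_cast]
        nlinarith [Int.natCast_nonneg (2 ^ i)]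
      have h4 : (2 : ℝ) ^ i ≤ K * (wordLength S (g ^ 2 ^ i) : ℝ) := by exact_mod_cast h3
      exact h4.trans (mul_le_mul_of_nonneg_left (hle i) (Nat.cast_nonneg K))
    have t0 := tendsto_pow_const_div_const_pow_of_one_lt 0 (one_lt_two (α := ℝ))
    have t1 := tendsto_pow_const_div_const_pow_of_one_lt 1 (one_lt_two (α := ℝ))
    have t2 := (t0.const_mul (K * N g)).add (t1.const_mul (K * (4 * δ)))
    simp only [mul_zero, add_zero] at t2
    obtain ⟨i, hi⟩ := (t2.eventually (gt_mem_nhds one_pos)).exists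
    have hp : (0 : ℝ) < 2 ^ i := by positivity
    have := hge i
    rw [pow_zero, pow_one, mul_one_div, mul_div_assoc', ← add_div, div_lt_one hp] at hi
    linarith
  -- A shortest element is chosen in each coset `f ^ j ⟨g⟩`; these turn out to have bounded length.
  have hmin : ∀ j : ℕ, ∃ n : ℤ, ∀ m : ℤ, N (f ^ j * g ^ n) ≤ N (f ^ j * g ^ m) := by
    intro j
    let F : ℤ → ℕ := fun m => wordLength S (f ^ j * g ^ m)
    exact ⟨Function.argmin F, fun m => Nat.cast_le.2 (Function.argmin_le F m)⟩
  choose n hn using hmin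
  obtain ⟨k, rfl⟩ := hv
  have hbound : ∀ j : ℕ, N (f ^ j * g ^ n j) ≤ max (N (g ^ k)) (N (g ^ k * g ^ k)) := by
    intro j
    by_contra hlt
    push Not at hlt
    obtain ⟨h1, h2⟩ := max_lt_iff.1 hlt
    set a := f ^ j * g ^ n j with ha
    have hag : ∀ m : ℤ, Commute a (g ^ m) := fun m =>
      (((hfg.pow_left j).zpow_right m)).mul_left ((Commute.refl g).zpow_zpow _ _)
    have hmin : ∀ m : ℤ, N a ≤ N (a * g ^ m) := fun m => by
      rw [ha, mul_assoc, ← zpow_add]; exact hn j _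
    -- Since `a` and `g` commute, `1, a, a g ^ m, g ^ m` is a parallelogram, whose diagonals are as
    -- long as `a g ^ m` and `a g ^ (-m)`. Their sum is at most `2 N a + 2δ`, and minimality of `a`
    -- bounds the second one from below by `N a`.
    have key : ∀ m : ℤ, N (g ^ m) < N a → N (a * g ^ m) ≤ N a + 2 * δ := by
      intro m hm
      have h4 := hδ 1 (a * g ^ m) a (g ^ m)
      have e1 : (a * g ^ m)⁻¹ * g ^ m = a⁻¹ := by rw [(hag m).eq]; group
      have e2 : (a * g ^ m)⁻¹ * a = (g ^ m)⁻¹ := by group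
      have e3 : a⁻¹ * g ^ m = (a * g ^ (-m))⁻¹ := by
        rw [(hag (-m)).eq]; group
      simp only [inv_one, one_mul] at h4
      rw [e1, e2, e3] at h4
      change N _ + N _ ≤ max (N _ + N _) (N _ + N _) + _ at h4
      simp only [hinv] at h4
      have := hmin (-m)
      rcases le_max_iff.1 (sub_le_iff_le_add.2 h4) with h5 | h5 <;> linarith
    have h3 := key k h1
    have h3' := key (k + k) (by rw [zpow_add]; exact h2)
    rw [zpow_add] at h3'
    have h3'' := hmin (k + k)
    rw [zpow_add] at h3''
    -- With `v = g ^ k`, the points `1, a v, a, a v ^ 2` now give `N (v * v) ≤ N v + 4δ`, against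
    -- the choice of `v`.
    have h4 := hδ 1 (a * g ^ k) a (a * (g ^ k * g ^ k))
    have e1 : a⁻¹ * (a * (g ^ k * g ^ k)) = g ^ k * g ^ k := by group
    have e2 : (a * g ^ k)⁻¹ * (a * (g ^ k * g ^ k)) = g ^ k := by group
    have e3 : (a * g ^ k)⁻¹ * a = (g ^ k)⁻¹ := by group
    simp only [inv_one, one_mul] at h4
    rw [e1, e2, e3] at h4
    change N _ + N _ ≤ max (N _ + N _) (N _ + N _) + _ at h4
    simp only [hinv] at h4
    have := hmin k
    change N (g ^ k) + 4 * δ < N (g ^ k * g ^ k) at hvg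
    rcases le_max_iff.1 (sub_le_iff_le_add.2 h4) with h5 | h5 <;> linarith
  obtain ⟨R, hR⟩ := exists_nat_ge (max (N (g ^ k)) (N (g ^ k * g ^ k)))
  -- The chosen elements are distinct: `χ` kills `f` and so recovers `n j`, after which the infinite
  -- order of `f` recovers `j`. A ball has no room for infinitely many.
  refine Set.infinite_of_injective_forall_mem (f := fun j : ℕ => f ^ j * g ^ n j)
    (s := {g | wordLength S g ≤ R}) ?_ (fun j => ?_) (finite_wordLength_le hS hfin R)
  · intro i j hij
    have hχ := congrArg χ hij
    simp only [map_mul, map_pow, map_zpow, hχf, one_pow, one_mul] at hχ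
    have hnij : n i = n j := by
      have := congrArg Multiplicative.toAdd hχ
      simp only [toAdd_zpow, smul_eq_mul] at this
      exact mul_right_cancel₀ (by simpa using hχg) this
    simp only [hnij] at hij
    have hpow : f ^ i = f ^ j := mul_right_cancel hij
    rcases le_total i j with h | h
    · have := hf (j - i) (by rw [pow_sub _ h, hpow, mul_inv_cancel]); omega
    · have := hf (i - j) (by rw [pow_sub _ h, hpow, mul_inv_cancel]); omega
  · exact Nat.cast_le.1 ((hbound j).trans hR)

end WordLength

/-! ## The Perron–Frobenius eigenvector -/

/-- Collatz–Wielandt: the largest `r` admitting a probability vector `x` with `r x ≤ A x` is an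
eigenvalue. The sum `P` of enough powers of `A` has positive entries and commutes with `A`; it
serves to improve a non-eigenvector and to see that `x` is positive. -/
theorem Matrix.IsIrreducible.exists_pos_eigenvector {n : Type*} [Fintype n] [Nonempty n]
    {A : Matrix n n ℝ} (hA : A.IsIrreducible) :
    ∃ (r : ℝ) (c : n → ℝ), (∀ i, 0 < c i) ∧ A.mulVec c = r • c := by
  classical
  choose k _ hk using (Matrix.isIrreducible_iff_exists_pow_pos hA.nonneg).1 hA
  obtain ⟨K, hK⟩ : ∃ K, ∀ i j, k i j < K := by
    obtain ⟨K, hK⟩ := (Set.finite_range fun p : n × n => k p.1 p.2).bddAbove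
    exact ⟨K + 1, fun i j => Nat.lt_succ_of_le (hK ⟨(i, j), rfl⟩)⟩
  let P : Matrix n n ℝ := ∑ m ∈ Finset.range K, A ^ m
  have hP : ∀ i j, 0 < P i j := by
    intro i j
    simp only [P, Matrix.sum_apply]
    exact Finset.sum_pos' (fun m _ => Matrix.pow_apply_nonneg hA.nonneg m i j)
      ⟨k i j, Finset.mem_range.2 (hK i j), hk i j⟩
  have hPA : P * A = A * P := by
    simp only [P, Finset.sum_mul, Finset.mul_sum, ← pow_succ, ← pow_succ']
  have hPpos : ∀ y : n → ℝ, 0 ≤ y → y ≠ 0 → ∀ i, 0 < P.mulVec y i := by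
    intro y hy hne i
    obtain ⟨j, hj⟩ := Function.ne_iff.1 hne
    exact Finset.sum_pos' (fun m _ => mul_nonneg (hP i m).le (hy m))
      ⟨j, Finset.mem_univ j, mul_pos (hP i j) (lt_of_le_of_ne (hy j) (Ne.symm hj))⟩
  let B : ℝ := ∑ i, ∑ j, A i j
  -- Summing `r x ≤ A x` over the coordinates gives `r ≤ B`, so bounding `r` by `B` loses nothing
  -- and makes `T` compact.
  let T : Set (ℝ × (n → ℝ)) := (Set.Icc 0 B ×ˢ stdSimplex ℝ n) ∩ {p | p.1 • p.2 ≤ A.mulVec p.2}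
  have hT : IsCompact T :=
    (isCompact_Icc.prod (isCompact_stdSimplex ℝ n)).inter_right
      (isClosed_le (by fun_prop) (by fun_prop))
  have hmem : ∀ (r : ℝ) (x : n → ℝ), 0 ≤ r → x ∈ stdSimplex ℝ n → r • x ≤ A.mulVec x →
      (r, x) ∈ T := by
    intro r x hr hx hle
    refine ⟨⟨⟨hr, ?_⟩, hx⟩, hle⟩
    calc r = ∑ i, r * x i := by rw [← Finset.mul_sum, hx.2, mul_one]
      _ ≤ ∑ i, A.mulVec x i := Finset.sum_le_sum fun i _ => hle i
      _ ≤ B := by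
        refine Finset.sum_le_sum fun i _ => Finset.sum_le_sum fun j _ => ?_
        exact mul_le_of_le_one_right (hA.nonneg i j)
          ((Finset.single_le_sum (fun m _ => hx.1 m) (Finset.mem_univ j)).trans_eq hx.2)
  have hTne : T.Nonempty := by
    obtain ⟨i⟩ := ‹Nonempty n›
    refine ⟨_, hmem 0 (Pi.single i 1) le_rfl (single_mem_stdSimplex ℝ i) ?_⟩
    rw [zero_smul]
    exact fun j => Finset.sum_nonneg fun m _ =>
      mul_nonneg (hA.nonneg j m) ((single_mem_stdSimplex ℝ i).1 m)
  obtain ⟨⟨r, x⟩, hrx, hmax⟩ := hT.exists_isMaxOn hTne continuous_fst.continuousOn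
  obtain ⟨⟨⟨hr, -⟩, hx⟩, hle⟩ := hrx
  change 0 ≤ r at hr
  change x ∈ stdSimplex ℝ n at hx
  change r • x ≤ A.mulVec x at hle
  have hxne : x ≠ 0 := by
    rintro rfl
    simpa using hx.2
  have heig : A.mulVec x = r • x := by
    by_contra hne
    have hz := hPpos x hx.1 hxne
    have hy := hPpos (A.mulVec x - r • x) (sub_nonneg.2 hle) (sub_ne_zero.2 hne)
    -- A nonzero slack `A x - r x` becomes positive in every coordinate after applying `P`. The
    -- vector `z`, normalised, then admits the larger value `r + ε`.
    set z := P.mulVec x with hzdef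
    have hyz : P.mulVec (A.mulVec x - r • x) = A.mulVec z - r • z := by
      rw [Matrix.mulVec_sub, Matrix.mulVec_smul, Matrix.mulVec_mulVec, hPA,
        ← Matrix.mulVec_mulVec]
    rw [hyz] at hy
    obtain ⟨i₀, hi₀⟩ := Finite.exists_min fun i => (A.mulVec z - r • z) i / z i
    set ε := (A.mulVec z - r • z) i₀ / z i₀ with hε
    have hεpos : 0 < ε := div_pos (hy i₀) (hz i₀)
    have hsum : 0 < ∑ i, z i := Finset.sum_pos (fun i _ => hz i) Finset.univ_nonempty
    have hzle : (r + ε) • z ≤ A.mulVec z := by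
      intro i
      have := hi₀ i
      rw [le_div_iff₀ (hz i)] at this
      simp only [Pi.sub_apply, Pi.smul_apply, smul_eq_mul] at this ⊢
      linarith
    have := hmax (hmem (r + ε) ((∑ i, z i)⁻¹ • z) (by positivity)
      ⟨fun i => by have := hz i; simp only [Pi.smul_apply, smul_eq_mul]; positivity, by
        simp only [Pi.smul_apply, smul_eq_mul, ← Finset.mul_sum]
        exact inv_mul_cancel₀ hsum.ne'⟩ (by
        rw [Matrix.mulVec_smul, smul_comm]
        exact smul_le_smul_of_nonneg_left hzle (inv_nonneg.2 hsum.le)))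
    change r + ε ≤ r at this
    linarith
  refine ⟨r, x, fun i => ?_, heig⟩
  have hpow : ∀ m : ℕ, (A ^ m).mulVec x = r ^ m • x := by
    intro m
    induction m with
    | zero => simp
    | succ m ih =>
      rw [pow_succ, ← Matrix.mulVec_mulVec, heig, Matrix.mulVec_smul, ih, smul_smul, pow_succ,
        mul_comm]
  have hPx : P.mulVec x = (∑ m ∈ Finset.range K, r ^ m) • x := by
    simp only [P, Matrix.sum_mulVec, hpow, Finset.sum_smul]
  have := hPpos x hx.1 hxne i
  rw [hPx] at this
  refine lt_of_le_of_ne (hx.1 i) fun h0 => ?_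
  simp [← h0] at this

/-! ## Weighted lengths in free groups -/

namespace FreeGroup

variable {E : Type*}

theorem IsReduced.invRev {l : List (E × Bool)} (h : IsReduced l) :
    IsReduced (FreeGroup.invRev l) := by
  rw [isReduced_iff_not_step] at h ⊢
  intro l' hl'
  rw [← invRev_invRev (L₁ := l'), Red.step_invRev_iff] at hl'
  exact h _ hl'

/-- The weighted length of a word. -/
def wt (c : E → ℝ) (l : List (E × Bool)) : ℝ := (l.map fun x => c x.1).sum

section Weight

variable (c : E → ℝ)

@[simp] theorem wt_nil : wt c [] = 0 := rfl

@[simp] theorem wt_cons (x : E × Bool) (l : List (E × Bool)) : wt c (x :: l) = c x.1 + wt c l := by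
  simp [wt]

@[simp] theorem wt_append (l l' : List (E × Bool)) : wt c (l ++ l') = wt c l + wt c l' := by
  simp [wt]

@[simp] theorem wt_invRev (l : List (E × Bool)) : wt c (invRev l) = wt c l := by
  induction l with
  | nil => rfl
  | cons a l ih => rw [invRev_cons, wt_append, ih]; simp [invRev, add_comm]

variable {c} (hc : ∀ e, 0 < c e)
include hc

theorem wt_nonneg (l : List (E × Bool)) : 0 ≤ wt c l :=
  List.sum_nonneg (by simp only [List.mem_map]; rintro _ ⟨x, -, rfl⟩; exact (hc _).le)

theorem wt_eq_zero {l : List (E × Bool)} : wt c l = 0 ↔ l = [] := by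
  refine ⟨fun h => ?_, fun h => h ▸ rfl⟩
  cases l with
  | nil => rfl
  | cons a l =>
    rw [wt_cons] at h
    linarith [hc a.1, wt_nonneg hc l]

theorem wt_le_of_sublist {l l' : List (E × Bool)} (h : l.Sublist l') : wt c l ≤ wt c l' := by
  induction h with
  | slnil => exact le_rfl
  | cons a _ ih => rw [wt_cons]; linarith [hc a.1]
  | cons_cons a _ ih => rw [wt_cons, wt_cons]; linarith

end Weight

/-! ### Cancellation in products of reduced words, and the length function on the free group -/

variable [DecidableEq E] (c : E → ℝ)

/-- The weighted length of an element of a free group. -/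
def nrm (g : FreeGroup E) : ℝ := wt c g.toWord

@[simp] theorem nrm_one : nrm c 1 = 0 := by simp [nrm]

@[simp] theorem nrm_inv (g : FreeGroup E) : nrm c g⁻¹ = nrm c g := by
  rw [nrm, toWord_inv, wt_invRev, nrm]

variable {c}

theorem nrm_mk_of_isReduced {l : List (E × Bool)} (h : IsReduced l) : nrm c (mk l) = wt c l := by
  rw [nrm, toWord_mk, h.reduce_eq]

/-- Two words have a longest common prefix. -/
theorem exists_common_prefix (l l' : List (E × Bool)) : ∃ p u v, l = p ++ u ∧ l' = p ++ v ∧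
    ∀ a ∈ u.head?, ∀ b ∈ v.head?, a ≠ b := by
  induction l generalizing l' with
  | nil => exact ⟨[], [], l', rfl, rfl, by simp⟩
  | cons a l ih =>
    cases l' with
    | nil => exact ⟨[], a :: l, [], rfl, rfl, by simp⟩
    | cons b l' =>
      by_cases hab : a = b
      · obtain ⟨p, u, v, rfl, rfl, h⟩ := ih l'
        exact ⟨a :: p, u, v, rfl, by rw [hab]; rfl, h⟩
      · exact ⟨[], a :: l, b :: l', rfl, rfl, by simpa using hab⟩

omit [DecidableEq E] in
theorem isReduced_invRev_append {u v : List (E × Bool)} (hu : IsReduced u) (hv : IsReduced v)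
    (h : ∀ a ∈ u.head?, ∀ b ∈ v.head?, a ≠ b) : IsReduced (invRev u ++ v) := by
  rw [IsReduced, List.isChain_append]
  refine ⟨hu.invRev, hv, fun x hx y hy => ?_⟩
  rw [invRev, List.getLast?_reverse, List.head?_map] at hx
  obtain ⟨a, ha, rfl⟩ := Option.map_eq_some_iff.1 hx
  rintro h1
  have h2 := h a ha y hy
  have h3 : a.2 ≠ y.2 := fun h3 => h2 (Prod.ext h1 h3)
  change (!a.2) = y.2
  rwa [Bool.not_eq_eq_eq_not, Bool.eq_not]

/-- The cancellation in the product of two reduced words. -/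
theorem exists_cancel {l l' : List (E × Bool)} (hl : IsReduced l) (hl' : IsReduced l') :
    ∃ l₁ x l₂, l = l₁ ++ x ∧ l' = invRev x ++ l₂ ∧ IsReduced (l₁ ++ l₂) := by
  obtain ⟨p, u, v, h1, h2, h3⟩ := exists_common_prefix (invRev l) l'
  refine ⟨invRev u, invRev p, v, ?_, by rw [invRev_invRev, h2], ?_⟩
  · rw [← invRev_append, ← h1, invRev_invRev]
  · have hu : IsReduced u := hl.invRev.infix ⟨p, [], by rw [h1]; simp⟩
    have hv : IsReduced v := hl'.infix ⟨p, [], by rw [h2]; simp⟩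
    exact isReduced_invRev_append hu hv h3

omit [DecidableEq E] in
theorem mk_cancel (l₁ x l₂ : List (E × Bool)) :
    mk (l₁ ++ x) * mk (invRev x ++ l₂) = mk (l₁ ++ l₂) := by
  simp only [← mul_mk, ← inv_mk]
  group

omit [DecidableEq E] in
/-- If two ends of a reduced word cancel only partially, a middle part of it survives. -/
theorem exists_middle {lA l lB A₁ x l₁ l₂ z B₁ : List (E × Bool)} (hc : ∀ e, 0 < c e)
    (hA : lA = A₁ ++ x) (hl₁ : l = invRev x ++ l₁) (hr₁ : IsReduced (A₁ ++ l₁))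
    (hl₂ : l = l₂ ++ z) (hB : lB = invRev z ++ B₁) (hr₂ : IsReduced (l₂ ++ B₁))
    (hwt : wt c x + wt c z < wt c l) :
    ∃ m, l = invRev x ++ m ++ z ∧ IsReduced (A₁ ++ m ++ B₁) ∧
      mk (lA ++ l ++ lB) = mk (A₁ ++ m ++ B₁) := by
  have h := hl₁.symm.trans hl₂
  -- Either the two cancelled ends of `l` leave a middle part `m`, or they overlap, which the
  -- weights forbid. The strict inequality also makes `m` nonempty, as needed to glue the reduced
  -- words `A₁ ++ m` and `m ++ B₁` along it.
  rcases List.append_eq_append_iff.1 h with ⟨m, h1, h2⟩ | ⟨m, h1, h2⟩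
  · have hm : m ≠ [] := by
      rintro rfl
      rw [hl₁, h2] at hwt
      simp at hwt
    refine ⟨m, by rw [hl₂, h1], ?_, ?_⟩
    · refine IsReduced.append_overlap (hr₁.infix ⟨[], z, ?_⟩) (hr₂.infix ⟨invRev x, [], ?_⟩) hm
      · simp [h2]
      · simp [h1]
    · rw [hA, hB, hl₁, h2]
      simp only [← mul_mk, ← inv_mk]
      group
  · exfalso
    have h3 : wt c l = wt c l₂ + wt c z := by rw [hl₂, wt_append]
    have h4 : wt c x = wt c l₂ + wt c m := by rw [← wt_invRev c x, h1, wt_append]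
    linarith [wt_nonneg hc m]

omit [DecidableEq E] in
/-- A prefix of a reduction of a word equals a prefix of the word. -/
theorem Red.exists_prefix {l l' : List (E × Bool)} (h : Red l l') :
    ∀ p, p <+: l' → ∃ p', p' <+: l ∧ (mk p' : FreeGroup E) = mk p := by
  induction h with
  | refl => exact fun p hp => ⟨p, hp, rfl⟩
  | @tail l₂ l₃ _ hs ih =>
    intro p hp
    obtain ⟨q, hq, hqp⟩ : ∃ q, q <+: l₂ ∧ (mk q : FreeGroup E) = mk p := by
      cases hs with
      | @not L₁ L₂ a b =>
        obtain ⟨s, hs⟩ := hp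
        -- A prefix ending inside `L₁` is unchanged; in a longer one the cancelled pair is
        -- reinserted.
        rcases List.append_eq_append_iff.1 hs with ⟨t, rfl, -⟩ | ⟨t, rfl, rfl⟩
        · exact ⟨p, (List.prefix_append p t).trans (List.prefix_append _ _), rfl⟩
        · exact ⟨L₁ ++ (a, b) :: (a, !b) :: t, ⟨s, by simp⟩, Quot.sound Red.Step.not⟩
    obtain ⟨q', hq', h⟩ := ih q hq
    exact ⟨q', hq', h.trans hqp⟩

variable (hc : ∀ e, 0 < c e)
include hc

theorem nrm_nonneg (g : FreeGroup E) : 0 ≤ nrm c g := wt_nonneg hc _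

theorem nrm_mk_le (l : List (E × Bool)) : nrm c (mk l) ≤ wt c l := by
  rw [nrm, toWord_mk]
  exact wt_le_of_sublist hc (Red.sublist reduce.red)

theorem nrm_mul_le (g h : FreeGroup E) : nrm c (g * h) ≤ nrm c g + nrm c h := by
  conv_lhs => rw [← mk_toWord (x := g), ← mk_toWord (x := h), mul_mk]
  exact (nrm_mk_le hc _).trans_eq (wt_append _ _ _)

/-- A common prefix cancels in `g⁻¹ * h`, so its weight is a lower bound for the Gromov product of
`g` and `h` at `1`. -/
theorem nrm_inv_mul_le_of_prefix {p : List (E × Bool)} {g h : FreeGroup E} (hg : p <+: g.toWord)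
    (hh : p <+: h.toWord) : nrm c (g⁻¹ * h) ≤ nrm c g + nrm c h - 2 * wt c p := by
  obtain ⟨u, hu⟩ := hg
  obtain ⟨v, hv⟩ := hh
  have : g⁻¹ * h = mk (invRev u ++ v) := by
    rw [← mk_toWord (x := g), ← mk_toWord (x := h), ← hu, ← hv]
    simp only [← mul_mk, ← inv_mk]
    group
  rw [this, nrm, nrm, nrm, ← hu, ← hv]
  refine (nrm_mk_le hc _).trans ?_
  simp only [wt_append, wt_invRev]
  linarith

-- Beyond the longest common prefix nothing cancels, so the weight of that prefix is the Gromov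
-- product.
omit hc in
theorem exists_prefix_nrm_inv_mul (g h : FreeGroup E) : ∃ p, p <+: g.toWord ∧ p <+: h.toWord ∧
    nrm c (g⁻¹ * h) = nrm c g + nrm c h - 2 * wt c p := by
  obtain ⟨p, u, v, hu, hv, huv⟩ := exists_common_prefix g.toWord h.toWord
  refine ⟨p, ⟨u, hu.symm⟩, ⟨v, hv.symm⟩, ?_⟩
  have : g⁻¹ * h = mk (invRev u ++ v) := by
    rw [← mk_toWord (x := g), ← mk_toWord (x := h), hu, hv]
    simp only [← mul_mk, ← inv_mk]
    group
  rw [this, nrm_mk_of_isReduced, nrm, nrm, hu, hv]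
  · simp only [wt_append, wt_invRev]
    ring
  · exact isReduced_invRev_append (isReduced_toWord.infix ⟨p, [], by rw [hu]; simp⟩)
      (isReduced_toWord.infix ⟨p, [], by rw [hv]; simp⟩) huv

/-- The ultrametric inequality for Gromov products: the prefixes that `h` shares with `g` and with
`k` are nested, so the shorter is shared by all three words. -/
theorem nrm_inv_mul_le_max (g h k : FreeGroup E) :
    nrm c (g⁻¹ * k) ≤ max (nrm c k - nrm c h + nrm c (g⁻¹ * h))
      (nrm c g - nrm c h + nrm c (h⁻¹ * k)) := by
  obtain ⟨p, hp1, hp2, hp⟩ := exists_prefix_nrm_inv_mul (c := c) g h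
  obtain ⟨q, hq1, hq2, hq⟩ := exists_prefix_nrm_inv_mul (c := c) h k
  rcases List.prefix_or_prefix_of_prefix hp2 hq1 with hpq | hqp
  · refine le_max_of_le_left ?_
    have := nrm_inv_mul_le_of_prefix hc hp1 (hpq.trans hq2)
    linarith
  · refine le_max_of_le_right ?_
    have := nrm_inv_mul_le_of_prefix hc (hqp.trans hp1) hq2
    linarith

/-- A free group with a weighted word metric is `0`-hyperbolic. -/
theorem fourPoint_nrm : FourPoint (fun g h : FreeGroup E => nrm c (g⁻¹ * h)) 0 := by
  intro x y z t
  -- Left translation by `t⁻¹` moves `t` to the base point `1`.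
  have h := nrm_inv_mul_le_max hc (t⁻¹ * x) (t⁻¹ * z) (t⁻¹ * y)
  have e : ∀ a b : FreeGroup E, (t⁻¹ * a)⁻¹ * (t⁻¹ * b) = a⁻¹ * b := fun a b => by group
  have e' : ∀ a b : FreeGroup E, nrm c (a⁻¹ * b) = nrm c (b⁻¹ * a) := fun a b => by
    rw [← nrm_inv]; congr 1; group
  simp only [e] at h
  simp only [mul_zero, add_zero]
  rw [e' z t, e' y t, e' x t, e' y z]
  rcases le_max_iff.1 h with h | h
  · exact le_max_of_le_left (by linarith)
  · exact le_max_of_le_right (by linarith)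

omit [DecidableEq E] in
theorem finite_wt_le [Finite E] (R : ℝ) : {l : List (E × Bool) | wt c l ≤ R}.Finite := by
  rcases isEmpty_or_nonempty E with hE | hE
  · exact Set.toFinite _
  obtain ⟨e₀, he₀⟩ := Finite.exists_min c
  refine (List.finite_length_le (E × Bool) ⌊R / c e₀⌋₊).subset fun l hl => ?_
  have h : ∀ l : List (E × Bool), l.length * c e₀ ≤ wt c l := by
    intro l
    induction l with
    | nil => simp
    | cons a l ih =>
      rw [List.length_cons, wt_cons]
      push_cast
      linarith [he₀ a.1]
  exact Nat.le_floor ((le_div_iff₀ (hc e₀)).2 ((h l).trans hl))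

end FreeGroup

/-! ## Substitutions, legal words and bounded cancellation -/

namespace FreeGroup

variable {E : Type*} (σ : E → List (E × Bool))

/-- The image of an oriented letter under the substitution `σ`. -/
def substLetter (x : E × Bool) : List (E × Bool) := if x.2 then σ x.1 else invRev (σ x.1)

/-- The image of a word under the substitution `σ`, without reduction. -/
def subst (l : List (E × Bool)) : List (E × Bool) := l.flatMap (substLetter σ)

/-- The endomorphism of the free group given by the substitution `σ`. -/
def substHom : FreeGroup E →* FreeGroup E := lift fun e => mk (σ e)

@[simp] theorem subst_nil : subst σ [] = [] := rfl

@[simp] theorem subst_append (l l' : List (E × Bool)) :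
    subst σ (l ++ l') = subst σ l ++ subst σ l' := List.flatMap_append

theorem subst_cons (x : E × Bool) (l : List (E × Bool)) :
    subst σ (x :: l) = substLetter σ x ++ subst σ l := rfl

@[simp] theorem subst_invRev (l : List (E × Bool)) : subst σ (invRev l) = invRev (subst σ l) := by
  induction l with
  | nil => rfl
  | cons a l ih =>
    rw [invRev_cons, subst_append, ih, subst_cons, invRev_append]
    congr 1
    rcases a with ⟨e, _ | _⟩ <;> simp [invRev, subst, substLetter, List.map_reverse, Function.comp_def]

@[simp] theorem substHom_mk (l : List (E × Bool)) : substHom σ (mk l) = mk (subst σ l) := by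
  induction l with
  | nil => exact _root_.map_one _
  | cons a l ih =>
    have h : substHom σ (mk [a]) = mk (substLetter σ a) := by
      rcases a with ⟨e, _ | _⟩ <;> simp [substHom, substLetter]
    rw [← List.singleton_append, ← mul_mk, _root_.map_mul, h, ih, subst_append, ← mul_mk]
    simp [subst]

theorem substHom_iterate_mk (n : ℕ) (l : List (E × Bool)) :
    (substHom σ)^[n] (mk l) = mk ((subst σ)^[n] l) := by
  induction n with
  | zero => rfl
  | succ n ih => rw [Function.iterate_succ_apply', ih, substHom_mk, Function.iterate_succ_apply']

theorem subst_infix {l l' : List (E × Bool)} (h : l <:+: l') : subst σ l <:+: subst σ l' := by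
  obtain ⟨s, t, rfl⟩ := h
  exact ⟨subst σ s, subst σ t, by simp⟩

theorem iterate_subst_infix {l l' : List (E × Bool)} (h : l <:+: l') (n : ℕ) :
    (subst σ)^[n] l <:+: (subst σ)^[n] l' := by
  induction n with
  | zero => exact h
  | succ n ih => rw [Function.iterate_succ_apply', Function.iterate_succ_apply']
                 exact subst_infix σ ih

theorem iterate_subst_append (n : ℕ) (l l' : List (E × Bool)) :
    (subst σ)^[n] (l ++ l') = (subst σ)^[n] l ++ (subst σ)^[n] l' := by
  induction n generalizing l l' with
  | zero => rfl
  | succ n ih => simp only [Function.iterate_succ_apply, subst_append, ih]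

theorem iterate_subst_invRev (n : ℕ) (l : List (E × Bool)) :
    (subst σ)^[n] (invRev l) = invRev ((subst σ)^[n] l) := by
  induction n generalizing l with
  | zero => rfl
  | succ n ih => simp only [Function.iterate_succ_apply, subst_invRev, ih]

/-- A prefix of the image of a word is the image of a prefix, up to a part of the image of a
letter. -/
theorem exists_prefix_of_prefix_subst {l p : List (E × Bool)} (h : p <+: subst σ l) :
    ∃ l₁ s, l₁ <+: l ∧ p = subst σ l₁ ++ s ∧ (s = [] ∨ ∃ x, s <+: substLetter σ x) := by
  induction l generalizing p with
  | nil => exact ⟨[], [], List.nil_prefix, by simpa using h, Or.inl rfl⟩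
  | cons a l ih =>
    rw [subst_cons] at h
    obtain ⟨t, ht⟩ := h
    rcases List.append_eq_append_iff.1 ht with ⟨r, h1, -⟩ | ⟨r, rfl, h2⟩
    · exact ⟨[], p, List.nil_prefix, rfl, Or.inr ⟨a, r, h1.symm⟩⟩
    · obtain ⟨l₁, s, hl₁, rfl, hs⟩ := ih ⟨t, h2.symm⟩
      exact ⟨a :: l₁, s, List.cons_prefix_cons.2 ⟨rfl, hl₁⟩, by simp [subst_cons], hs⟩

/-- A word is legal if all its iterated images are reduced. -/
def Legal (l : List (E × Bool)) : Prop := ∀ n, IsReduced ((subst σ)^[n] l)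

variable {σ}

theorem Legal.isReduced {l : List (E × Bool)} (h : Legal σ l) : IsReduced l := h 0

theorem Legal.subst {l : List (E × Bool)} (h : Legal σ l) : Legal σ (subst σ l) := fun n => by
  rw [← Function.iterate_succ_apply]; exact h (n + 1)

theorem Legal.iterate {l : List (E × Bool)} (h : Legal σ l) (n : ℕ) :
    Legal σ ((FreeGroup.subst σ)^[n] l) := fun m => by
  rw [← Function.iterate_add_apply]; exact h _

theorem Legal.infix {l l' : List (E × Bool)} (h : Legal σ l') (hl : l <:+: l') : Legal σ l :=
  fun n => (h n).infix (iterate_subst_infix σ hl n)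

theorem Legal.invRev {l : List (E × Bool)} (h : Legal σ l) : Legal σ (invRev l) := fun n => by
  rw [iterate_subst_invRev]; exact (h n).invRev

theorem legal_nil : Legal σ [] := fun n => by
  have : (FreeGroup.subst σ)^[n] [] = [] := Function.iterate_fixed rfl n
  rw [this]; exact IsReduced.nil

variable {c : E → ℝ} {r : ℝ}

theorem wt_substLetter (hσ : ∀ e, wt c (σ e) = r * c e) (x : E × Bool) :
    wt c (substLetter σ x) = r * c x.1 := by
  rcases x with ⟨e, _ | _⟩ <;> simp [substLetter, hσ]

theorem wt_subst (hσ : ∀ e, wt c (σ e) = r * c e) (l : List (E × Bool)) :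
    wt c (subst σ l) = r * wt c l := by
  induction l with
  | nil => simp
  | cons a l ih => rw [subst_cons, wt_append, wt_cons, wt_substLetter hσ, ih, mul_add]

theorem wt_iterate_subst (hσ : ∀ e, wt c (σ e) = r * c e) (n : ℕ) (l : List (E × Bool)) :
    wt c ((subst σ)^[n] l) = r ^ n * wt c l := by
  induction n with
  | zero => simp
  | succ n ih => rw [Function.iterate_succ_apply', wt_subst hσ, ih]; ring

variable [DecidableEq E]

theorem nrm_substHom_le (hc : ∀ e, 0 < c e) (hσ : ∀ e, wt c (σ e) = r * c e) (g : FreeGroup E) :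
    nrm c (substHom σ g) ≤ r * nrm c g := by
  conv_lhs => rw [← mk_toWord (x := g), substHom_mk]
  exact (nrm_mk_le hc _).trans_eq (wt_subst hσ _)

/-- The reduced form of a product of legal words is a concatenation of as many legal words. -/
theorem exists_legal_pieces (Q : List (List (E × Bool))) (hQ : ∀ l ∈ Q, Legal σ l) :
    ∃ Q' : List (List (E × Bool)), Q'.length = Q.length ∧ (∀ l ∈ Q', Legal σ l) ∧
      (mk Q.flatten).toWord = Q'.flatten := by
  -- Cutting off an initial part does not change the number of pieces, if those lost entirely are
  -- replaced by empty words.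
  have hsuff : ∀ (Q : List (List (E × Bool))) (s : List (E × Bool)), (∀ l ∈ Q, Legal σ l) →
      s <:+ Q.flatten → ∃ Q' : List (List (E × Bool)), Q'.length = Q.length ∧
        (∀ l ∈ Q', Legal σ l) ∧ s = Q'.flatten := by
    intro Q
    induction Q with
    | nil => exact fun s _ hs => ⟨[], rfl, by simp, by simpa using hs⟩
    | cons a Q ih =>
      rintro s hQ ⟨t, ht⟩
      rw [List.flatten_cons] at ht
      rcases List.append_eq_append_iff.1 ht with ⟨q, h1, h2⟩ | ⟨q, h1, h2⟩
      · refine ⟨q :: Q, rfl, fun l hl => ?_, h2⟩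
        rcases List.mem_cons.1 hl with rfl | hl
        · exact (hQ a (by simp)).infix ⟨t, [], by simp [h1]⟩
        · exact hQ l (by simp [hl])
      · obtain ⟨Q', hlen, hQ', rfl⟩ := ih s (fun l hl => hQ l (by simp [hl])) ⟨q, h2.symm⟩
        exact ⟨[] :: Q', by simp [hlen], by simpa using ⟨legal_nil, hQ'⟩, by simp⟩
  induction Q with
  | nil => exact ⟨[], rfl, by simp, by simp [← one_eq_mk]⟩
  | cons a Q ih =>
    obtain ⟨Q', hlen, hQ', hw⟩ := ih fun l hl => hQ l (by simp [hl])
    have ha : Legal σ a := hQ a (by simp)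
    -- Cancellation takes a suffix off the first piece and a prefix off the reduced remainder, so no
    -- new pieces arise.
    obtain ⟨l₁, x, l₂, h1, h2, h3⟩ := exists_cancel ha.isReduced
      (isReduced_toWord (x := mk Q.flatten))
    have hmk : mk (a :: Q).flatten = mk (l₁ ++ l₂) := by
      rw [List.flatten_cons, ← mul_mk, ← mk_toWord (x := mk Q.flatten), h2, h1, mk_cancel]
    obtain ⟨Q'', hlen'', hQ'', hw''⟩ := hsuff Q' l₂ hQ' ⟨invRev x, by rw [← h2, hw]⟩
    refine ⟨l₁ :: Q'', by simp [hlen'', hlen], fun l hl => ?_, ?_⟩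
    · rcases List.mem_cons.1 hl with rfl | hl
      · exact ha.infix ⟨[], x, by simp [h1]⟩
      · exact hQ'' l hl
    · rw [hmk, toWord_mk, h3.reduce_eq, List.flatten_cons, hw'']

/-- A product of boundedly many legal words is short if the legal subwords of its reduced form
are. -/
theorem nrm_le_of_legal_pieces (Q : List (List (E × Bool))) (hQ : ∀ l ∈ Q, Legal σ l)
    {K : ℝ} (hK : ∀ l, l <:+: (mk Q.flatten).toWord → Legal σ l → wt c l ≤ K) :
    nrm c (mk Q.flatten) ≤ Q.length * K := by
  obtain ⟨Q', hlen, hQ', hw⟩ := exists_legal_pieces Q hQ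
  rw [nrm, hw]
  have hK' : ∀ l ∈ Q', wt c l ≤ K := fun l hl =>
    hK l (hw ▸ List.infix_of_mem_flatten hl) (hQ' l hl)
  rw [← hlen]
  clear hw hlen hQ'
  induction Q' with
  | nil => simp
  | cons a Q' ih =>
    rw [List.flatten_cons, wt_append, List.length_cons]
    push_cast
    linarith [hK' a (by simp), ih fun l hl => hK' l (by simp [hl])]

/-- Bounded cancellation: in the image of a reduced word `α ++ l` with `l` legal, the amount of
cancellation between the images of `α` and `l` is bounded. The words are taken from a family `P`
on which the substitution is proper. -/
theorem exists_bound_cancel [Finite E] (hc : ∀ e, 0 < c e) (hr : 0 ≤ r)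
    (hσ : ∀ e, wt c (σ e) = r * c e)
    {P : Set (List (E × Bool))} (hP : ∀ l ∈ P, ∀ l', l' <:+: l → l' ∈ P)
    (hprop : ∀ R, ∃ B, ∀ l ∈ P, IsReduced l → nrm c (substHom σ (mk l)) ≤ R → wt c l ≤ B) :
    ∃ B, 0 ≤ B ∧ ∀ α l, α ++ l ∈ P → IsReduced (α ++ l) → ∀ A₁ x l₁,
      (mk (subst σ α)).toWord = A₁ ++ x → subst σ l = invRev x ++ l₁ → wt c x ≤ B := by
  obtain ⟨C, hC⟩ := (Set.finite_range c).bddAbove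
  -- The image of a single letter weighs at most `r * |C|`. This is the error in replacing a prefix
  -- of an image by the image of a prefix.
  obtain ⟨B, hB⟩ := hprop (r * |C|)
  have hC' : ∀ e, c e ≤ |C| := fun e => (hC ⟨e, rfl⟩).trans (le_abs_self C)
  have hs : ∀ s, (s = [] ∨ ∃ x, s <+: substLetter σ x) → wt c s ≤ r * |C| := by
    rintro s (rfl | ⟨x, hx⟩)
    · rw [wt_nil]; positivity
    · exact (wt_le_of_sublist hc hx.sublist).trans_eq (wt_substLetter hσ x) |>.trans
        (mul_le_mul_of_nonneg_left (hC' _) hr)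
  refine ⟨r * |B| + r * |C|, by positivity, fun α l hα hred A₁ x l₁ hA hl => ?_⟩
  obtain ⟨p, s, hp, hps, hs'⟩ := exists_prefix_of_prefix_subst σ (l := l) (p := invRev x)
    ⟨l₁, hl.symm⟩
  have hpre : subst σ p <+: (mk (subst σ (invRev α))).toWord := by
    rw [subst_invRev, ← inv_mk, toWord_inv, hA, invRev_append, hps]
    exact ⟨s ++ invRev A₁, by simp⟩
  rw [toWord_mk] at hpre
  -- The cancelled part is a prefix both of the image of `l` and of the tightened image of `α⁻¹`. Up
  -- to pieces of images of letters it is the image of a prefix `p` of `l`, and as a group element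
  -- also that of a prefix `q` of `α⁻¹`. Hence the subword `q⁻¹ p` of `α ++ l` has the short image
  -- `t`, and properness bounds its weight.
  obtain ⟨q', hq', hmk⟩ := Red.exists_prefix reduce.red _ hpre
  obtain ⟨q, t, hq, rfl, ht⟩ := exists_prefix_of_prefix_subst σ hq'
  have hinf : invRev q ++ p <:+: α ++ l := by
    obtain ⟨q₁, hq₁⟩ := hq
    obtain ⟨p₁, hp₁⟩ := hp
    refine ⟨invRev q₁, p₁, ?_⟩
    have : α = invRev q₁ ++ invRev q := by rw [← invRev_append, hq₁, invRev_invRev]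
    rw [this, ← hp₁]
    simp
  have hle := hB _ (hP _ hα _ hinf) (hred.infix hinf) (by
    rw [← mul_mk, ← inv_mk, _root_.map_mul, _root_.map_inv, substHom_mk, substHom_mk, ← hmk, ← mul_mk]
    rw [inv_mul_cancel_left]
    exact (nrm_mk_le hc t).trans (hs t ht))
  rw [wt_append, wt_invRev] at hle
  rw [← wt_invRev, hps, wt_append, wt_subst hσ]
  have h1 := hs s hs'
  have h2 := wt_nonneg hc q
  have h3 : wt c p ≤ |B| := by linarith [le_abs_self B]
  linarith [mul_le_mul_of_nonneg_left h3 hr]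

/-- A long legal subword of a reduced word makes the iterated images of the word grow at the rate
`r`. -/
theorem exists_growth [Finite E] (hc : ∀ e, 0 < c e) (hr : 1 < r)
    (hσ : ∀ e, wt c (σ e) = r * c e)
    {P : Set (List (E × Bool))} (hP : ∀ l ∈ P, ∀ l', l' <:+: l → l' ∈ P)
    (hinv : ∀ l ∈ P, invRev l ∈ P) (hsubst : ∀ l ∈ P, (mk (subst σ l)).toWord ∈ P)
    (hprop : ∀ R, ∃ B, ∀ l ∈ P, IsReduced l → nrm c (substHom σ (mk l)) ≤ R → wt c l ≤ B) :
    ∃ K, ∀ w ∈ P, IsReduced w → ∀ l, l <:+: w → Legal σ l → ∀ n,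
      r ^ n * (wt c l - K) ≤ nrm c ((substHom σ)^[n] (mk w)) := by
  obtain ⟨B, hB0, hB⟩ := exists_bound_cancel hc (by linarith) hσ hP hprop
  have hr' : 0 < r - 1 := by linarith
  -- One application stretches the legal subword by `r`, and tightening then removes at most `B` at
  -- either end, by bounded cancellation applied to the word and to its inverse. If nothing need
  -- survive, the empty word does.
  have step : ∀ w ∈ P, IsReduced w → ∀ l, l <:+: w → Legal σ l →
      ∃ l', l' <:+: (mk (subst σ w)).toWord ∧ Legal σ l' ∧ r * wt c l - 2 * B ≤ wt c l' := by
    rintro w hw hred l ⟨α, β, rfl⟩ hl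
    by_cases hsmall : r * wt c l - 2 * B ≤ 0
    · exact ⟨[], ⟨[], _, rfl⟩, legal_nil, by simpa using hsmall⟩
    obtain ⟨A₁, x, l₁, hA, hl₁, hr₁⟩ := exists_cancel
      (isReduced_toWord (x := mk (subst σ α))) hl.subst.isReduced
    obtain ⟨l₂, z, B₁, hl₂, hβ, hr₂⟩ := exists_cancel hl.subst.isReduced
      (isReduced_toWord (x := mk (subst σ β)))
    have hx : wt c x ≤ B := hB α l (hP _ hw _ ⟨[], β, by simp⟩) (hred.infix ⟨[], β, by simp⟩)
      _ _ _ hA hl₁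
    have hz : wt c z ≤ B := by
      refine hB (invRev β) (invRev l) ?_ ?_ (invRev B₁) z (invRev l₂) ?_ ?_
      · rw [← invRev_append]
        exact hinv _ (hP _ hw _ ⟨α, [], by simp⟩)
      · rw [← invRev_append]
        exact (hred.infix ⟨α, [], by simp⟩).invRev
      · rw [subst_invRev, ← inv_mk, toWord_inv, hβ, invRev_append, invRev_invRev]
      · rw [subst_invRev, hl₂, invRev_append]
    obtain ⟨m, hm, hmred, hmk⟩ := exists_middle hc hA hl₁ hr₁ hl₂ hβ hr₂ (by
      rw [wt_subst hσ]; linarith)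
    refine ⟨m, ⟨A₁, B₁, ?_⟩, hl.subst.infix ⟨invRev x, z, hm.symm⟩, ?_⟩
    · have : mk (subst σ (α ++ l ++ β)) = mk (A₁ ++ m ++ B₁) := by
        rw [← hmk]
        simp only [subst_append, ← mul_mk, mk_toWord]
      rw [this, toWord_mk, hmred.reduce_eq]
    · have := congrArg (wt c) hm
      rw [wt_subst hσ, wt_append, wt_append, wt_invRev] at this
      linarith
  -- The constant is the fixed point of `λ ↦ r λ - 2 B`; the excess of the weight over it is
  -- multiplied by at least `r` in each step.
  refine ⟨2 * B / (r - 1), fun w hw hred l hlw hl n => ?_⟩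
  suffices h : ∃ w' ∈ P, IsReduced w' ∧ (substHom σ)^[n] (mk w) = mk w' ∧
      ∃ l', l' <:+: w' ∧ Legal σ l' ∧ r ^ n * (wt c l - 2 * B / (r - 1)) ≤
        wt c l' - 2 * B / (r - 1) by
    obtain ⟨w', -, hred', hmk, l', hl', -, hle⟩ := h
    rw [hmk, nrm_mk_of_isReduced hred']
    have : 0 ≤ 2 * B / (r - 1) := by positivity
    linarith [wt_le_of_sublist hc hl'.sublist]
  induction n with
  | zero => exact ⟨w, hw, hred, rfl, l, hlw, hl, by simp⟩
  | succ n ih =>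
    obtain ⟨w', hw', hred', hmk, l', hlw', hl', hle⟩ := ih
    obtain ⟨l'', h1, h2, h3⟩ := step w' hw' hred' l' hlw' hl'
    refine ⟨_, hsubst w' hw', isReduced_toWord, ?_, l'', h1, h2, ?_⟩
    · rw [Function.iterate_succ_apply', hmk, substHom_mk, mk_toWord]
    · have h4 := mul_le_mul_of_nonneg_left hle (by linarith : 0 ≤ r)
      have h5 : r * (2 * B / (r - 1)) = 2 * B + 2 * B / (r - 1) := by
        field_simp
        ring
      rw [pow_succ]
      linarith

end FreeGroup

/-! ## Edge paths and the fundamental groupoid of a graph -/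

namespace EdgePath

variable {V : Type u} [Quiver.{w} V]

/-- Concatenation of edge paths. -/
def comp {a b : V} (p : EdgePath a b) : ∀ {c : V}, EdgePath b c → EdgePath a c
  | _, .nil => p
  | _, .fwd q e => .fwd (comp p q) e
  | _, .bwd q e => .bwd (comp p q) e

/-- The reversed edge path. -/
def symm {a : V} : ∀ {b : V}, EdgePath a b → EdgePath b a
  | _, .nil => .nil
  | _, .fwd p e => (bwd nil e).comp (symm p)
  | _, .bwd p e => (fwd nil e).comp (symm p)

@[simp] theorem edgeList_nil (a : V) : edgeList (nil : EdgePath a a) = [] := rfl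

@[simp] theorem edgeList_fwd {a b c : V} (p : EdgePath a b) (e : b ⟶ c) :
    edgeList (p.fwd e) = edgeList p ++ [(⟨_, _, e⟩, true)] := rfl

@[simp] theorem edgeList_bwd {a b c : V} (p : EdgePath a b) (e : c ⟶ b) :
    edgeList (p.bwd e) = edgeList p ++ [(⟨_, _, e⟩, false)] := rfl

@[simp] theorem edgeList_comp {a b c : V} (p : EdgePath a b) (q : EdgePath b c) :
    edgeList (p.comp q) = edgeList p ++ edgeList q := by
  induction q with
  | nil => simp [comp]
  | fwd q e ih => simp [comp, ih]
  | bwd q e ih => simp [comp, ih]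

@[simp] theorem edgeList_symm {a b : V} (p : EdgePath a b) :
    edgeList p.symm = FreeGroup.invRev (edgeList p) := by
  induction p with
  | nil => rfl
  | fwd q e ih => simp [symm, ih, FreeGroup.invRev]
  | bwd q e ih => simp [symm, ih, FreeGroup.invRev]

@[simp] theorem pathClass_comp {a b c : V} (p : EdgePath a b) (q : EdgePath b c) :
    pathClass (p.comp q) = pathClass p ≫ pathClass q := by
  induction q with
  | nil => exact (Category.comp_id _).symm
  | fwd q e ih => exact (congrArg (· ≫ edgeClass e) ih).trans (Category.assoc _ _ _)
  | bwd q e ih =>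
    exact (congrArg (· ≫ Groupoid.inv (edgeClass e)) ih).trans (Category.assoc _ _ _)

theorem pathClass_nil_fwd {a b : V} (e : a ⟶ b) :
    pathClass (nil.fwd e : EdgePath a b) = edgeClass e := Category.id_comp _

theorem pathClass_nil_bwd {a b : V} (e : b ⟶ a) :
    pathClass (nil.bwd e : EdgePath a b) = Groupoid.inv (edgeClass e) := Category.id_comp _

@[simp] theorem pathClass_symm {a b : V} (p : EdgePath a b) :
    pathClass p.symm = inv (pathClass p) := by
  induction p with
  | nil => exact (IsIso.inv_id).symm
  | fwd q e ih =>
    rw [symm, pathClass_comp, ih, pathClass_nil_bwd, pathClass, IsIso.inv_comp,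
      Groupoid.inv_eq_inv]
  | bwd q e ih =>
    rw [symm, pathClass_comp, ih, pathClass_nil_fwd, pathClass, IsIso.inv_comp,
      Groupoid.inv_eq_inv, IsIso.inv_inv]

/-- An edge path can be cut wherever its list of oriented edges is. -/
theorem exists_split {a b : V} (p : EdgePath a b) (l₁ l₂ : List (Quiver.Total V × Bool))
    (h : edgeList p = l₁ ++ l₂) : ∃ (c : V) (p₁ : EdgePath a c) (p₂ : EdgePath c b),
      edgeList p₁ = l₁ ∧ edgeList p₂ = l₂ ∧ p = p₁.comp p₂ := by
  induction p generalizing l₂ with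
  | nil =>
    obtain ⟨rfl, rfl⟩ := List.append_eq_nil_iff.1 h.symm
    exact ⟨a, nil, nil, rfl, rfl, rfl⟩
  | fwd q e ih =>
    rcases List.eq_nil_or_concat l₂ with rfl | ⟨l₂, x, rfl⟩
    · exact ⟨_, q.fwd e, nil, by simpa using h, rfl, rfl⟩
    · rw [edgeList_fwd, List.concat_eq_append, ← List.append_assoc] at h
      obtain ⟨h1, h2⟩ := List.append_inj' h rfl
      obtain ⟨c, p₁, p₂, e₁, e₂, rfl⟩ := ih l₂ h1
      exact ⟨c, p₁, p₂.fwd e, e₁, by rw [edgeList_fwd, e₂, h2, List.concat_eq_append], rfl⟩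
  | bwd q e ih =>
    rcases List.eq_nil_or_concat l₂ with rfl | ⟨l₂, x, rfl⟩
    · exact ⟨_, q.bwd e, nil, by simpa using h, rfl, rfl⟩
    · rw [edgeList_bwd, List.concat_eq_append, ← List.append_assoc] at h
      obtain ⟨h1, h2⟩ := List.append_inj' h rfl
      obtain ⟨c, p₁, p₂, e₁, e₂, rfl⟩ := ih l₂ h1
      exact ⟨c, p₁, p₂.bwd e, e₁, by rw [edgeList_bwd, e₂, h2, List.concat_eq_append], rfl⟩

theorem edgeList_eq_nil {a b : V} (p : EdgePath a b) (h : edgeList p = []) :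
    ∃ hab : a = b, p = hab ▸ nil := by
  cases p with
  | nil => exact ⟨rfl, rfl⟩
  | fwd p e => simp at h
  | bwd p e => simp at h

/-- A backtracking edge path of length two is null-homotopic. -/
theorem pathClass_of_backtrack {a b : V} (p : EdgePath a b) {x : Quiver.Total V} {s : Bool}
    (h : edgeList p = [(x, s), (x, !s)]) : ∃ hab : a = b, pathClass p = hab ▸ 𝟙 (vtx a) := by
  cases p with
  | nil => simp at h
  | fwd p e =>
    cases p with
    | nil => simp at h
    | fwd q f =>
      exfalso
      obtain ⟨h1, h2⟩ := List.append_inj' (t₁ := [_]) (t₂ := [(x, !s)])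
        (s₁ := edgeList (q.fwd f)) (s₂ := [(x, s)]) h rfl
      obtain ⟨-, h1⟩ := List.append_inj' (s₁ := edgeList q) (s₂ := []) (t₁ := [_]) h1 rfl
      simp only [List.cons.injEq, Prod.mk.injEq, and_true] at h1 h2
      simp [← h1.2] at h2
    | bwd q f =>
      obtain ⟨h4, h2⟩ := List.append_inj' (t₁ := [_]) (t₂ := [(x, !s)])
        (s₁ := edgeList (q.bwd f)) (s₂ := [(x, s)]) h rfl
      obtain ⟨h0, h1⟩ := List.append_inj' (s₁ := edgeList q) (s₂ := []) (t₁ := [_]) h4 rfl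
      simp only [List.cons.injEq, Prod.mk.injEq, and_true] at h1 h2
      cases q with
      | fwd q e' => simp at h0
      | bwd q e' => simp at h0
      | nil =>
        have h3 := h1.1.trans h2.1.symm
        rw [Quiver.Total.mk.injEq] at h3
        obtain ⟨-, rfl, h3⟩ := h3
        obtain rfl := eq_of_heq h3
        refine ⟨rfl, ?_⟩
        simp only [pathClass, Category.id_comp]
        exact Groupoid.inv_comp _
  | bwd p e =>
    cases p with
    | nil => simp at h
    | bwd q f =>
      exfalso
      obtain ⟨h1, h2⟩ := List.append_inj' (t₁ := [_]) (t₂ := [(x, !s)])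
        (s₁ := edgeList (q.bwd f)) (s₂ := [(x, s)]) h rfl
      obtain ⟨-, h1⟩ := List.append_inj' (s₁ := edgeList q) (s₂ := []) (t₁ := [_]) h1 rfl
      simp only [List.cons.injEq, Prod.mk.injEq, and_true] at h1 h2
      simp [← h1.2] at h2
    | fwd q f =>
      obtain ⟨h4, h2⟩ := List.append_inj' (t₁ := [_]) (t₂ := [(x, !s)])
        (s₁ := edgeList (q.fwd f)) (s₂ := [(x, s)]) h rfl
      obtain ⟨h0, h1⟩ := List.append_inj' (s₁ := edgeList q) (s₂ := []) (t₁ := [_]) h4 rfl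
      simp only [List.cons.injEq, Prod.mk.injEq, and_true] at h1 h2
      cases q with
      | fwd q e' => simp at h0
      | bwd q e' => simp at h0
      | nil =>
        have h3 := h1.1.trans h2.1.symm
        rw [Quiver.Total.mk.injEq] at h3
        obtain ⟨rfl, -, h3⟩ := h3
        obtain rfl := eq_of_heq h3
        refine ⟨rfl, ?_⟩
        simp only [pathClass, Category.id_comp]
        exact Groupoid.comp_inv _

/-- Each elementary reduction deletes a backtracking pair, which is a null-homotopic closed subpath;
the remaining parts still fit together. -/
theorem exists_of_red {a b : V} (p : EdgePath a b) {l : List (Quiver.Total V × Bool)}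
    (h : FreeGroup.Red (edgeList p) l) :
    ∃ p' : EdgePath a b, edgeList p' = l ∧ pathClass p' = pathClass p := by
  induction h with
  | refl => exact ⟨p, rfl, rfl⟩
  | tail _ hs ih =>
    obtain ⟨p', hp', hcl⟩ := ih
    cases hs with
    | @not L₁ L₂ x s =>
      obtain ⟨c, p₁, q, e₁, eq, rfl⟩ := p'.exists_split _ _ hp'
      obtain ⟨d, q₁, p₂, e₂, e₃, rfl⟩ := q.exists_split [(x, s), (x, !s)] L₂ eq
      obtain ⟨rfl, hq⟩ := q₁.pathClass_of_backtrack e₂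
      refine ⟨p₁.comp p₂, by rw [edgeList_comp, e₁, e₃], ?_⟩
      rw [← hcl, pathClass_comp, pathClass_comp, pathClass_comp, hq]
      exact congrArg (pathClass p₁ ≫ ·) (Category.id_comp (pathClass p₂)).symm

/-! ### Words of edge paths as a complete homotopy invariant -/

/-- The element of the free group on the edges given by an edge path. -/
def word {a b : V} (p : EdgePath a b) : FreeGroup (Quiver.Total V) := FreeGroup.mk (edgeList p)

@[simp] theorem word_nil (a : V) : word (nil : EdgePath a a) = 1 := rfl

@[simp] theorem word_comp {a b c : V} (p : EdgePath a b) (q : EdgePath b c) :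
    word (p.comp q) = word p * word q := by
  rw [word, edgeList_comp, ← FreeGroup.mul_mk]; rfl

@[simp] theorem word_symm {a b : V} (p : EdgePath a b) : word p.symm = (word p)⁻¹ := by
  rw [word, edgeList_symm, ← FreeGroup.inv_mk]; rfl

-- For fixed endpoints, homotopy can be tested in the free group on all the edges, without a maximal
-- tree: if the words agree, `p` followed by the reverse of `q` reduces to the empty path.
open Classical in
theorem pathClass_eq_of_word_eq {a b : V} {p q : EdgePath a b} (h : word p = word q) :
    pathClass p = pathClass q := by
  have h1 : word (p.comp q.symm) = 1 := by rw [word_comp, word_symm, h, mul_inv_cancel]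
  have h2 : FreeGroup.reduce (edgeList (p.comp q.symm)) = [] := by
    rw [← FreeGroup.toWord_mk]
    exact FreeGroup.toWord_eq_nil_iff.2 h1
  obtain ⟨r, hr, hrc⟩ := exists_of_red (p.comp q.symm) FreeGroup.reduce.red
  rw [h2] at hr
  obtain ⟨_, rfl⟩ := edgeList_eq_nil r hr
  rw [pathClass_comp, pathClass_symm] at hrc
  exact ((IsIso.comp_inv_eq (pathClass q)).1 hrc.symm).trans (Category.id_comp _)

/-- The words of edge paths, as a functor on the fundamental groupoid. -/
def wordFunctor (V : Type u) [Quiver.{w} V] :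
    Quiver.FreeGroupoid V ⥤ SingleObj (FreeGroup (Quiver.Total V))ᵐᵒᵖ :=
  Quiver.FreeGroupoid.lift
    { obj := fun _ => SingleObj.star _
      map := fun {a b} e => MulOpposite.op (FreeGroup.of (⟨a, b, e⟩ : Quiver.Total V)) }

/-- The opposite group occurs because composition in `SingleObj` is multiplication in reverse order.
-/
theorem wordFunctor_pathClass {a b : V} (p : EdgePath a b) :
    (wordFunctor V).map (pathClass p) = MulOpposite.op (word p) := by
  induction p with
  | nil => exact (wordFunctor V).map_id _
  | fwd p e ih =>
    rw [pathClass, Functor.map_comp, ih]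
    exact congrArg (· * MulOpposite.op (word p))
      (GraphMap.lift_edgeClass (D := SingleObj (FreeGroup (Quiver.Total V))ᵐᵒᵖ) _ e)
  | bwd p e ih =>
    rw [pathClass, Functor.map_comp, ih, Groupoid.inv_eq_inv, Functor.map_inv]
    rw [← Groupoid.inv_eq_inv]
    exact congrArg (fun x : (FreeGroup (Quiver.Total V))ᵐᵒᵖ => x⁻¹ * MulOpposite.op (word p))
      (GraphMap.lift_edgeClass (D := SingleObj (FreeGroup (Quiver.Total V))ᵐᵒᵖ) _ e)

theorem word_eq_of_pathClass_eq {a b : V} {p q : EdgePath a b} (h : pathClass p = pathClass q) :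
    word p = word q := by
  apply MulOpposite.op_injective
  rw [← wordFunctor_pathClass, ← wordFunctor_pathClass, h]

/-- Every morphism of the fundamental groupoid is the class of an edge path. -/
theorem exists_pathClass_eq {a b : V} (f : vtx a ⟶ vtx b) : ∃ p, pathClass p = f := by
  obtain ⟨f⟩ := f
  suffices h : ∀ (c : V) (f : Quiver.Path (V := Quiver.Symmetrify V) a c),
      ∃ p : EdgePath a c, pathClass p = Quot.mk _ f from h b f
  intro c f
  induction f with
  | nil => exact ⟨nil, rfl⟩
  | cons q e ih =>
    obtain ⟨p, hp⟩ := ih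
    rcases e with e | e
    · refine ⟨p.fwd e, ?_⟩
      rw [pathClass, hp]
      rfl
    · refine ⟨p.bwd e, ?_⟩
      rw [pathClass, hp]
      rfl

open Classical in
/-- Every edge path is homotopic to a reduced one. -/
theorem exists_isReduced {a b : V} (p : EdgePath a b) :
    ∃ p' : EdgePath a b, edgeList p' = (word p).toWord ∧ pathClass p' = pathClass p :=
  exists_of_red p FreeGroup.reduce.red

end EdgePath

/-! ## The action of a graph map on edge paths -/

namespace GraphMap

open EdgePath FreeGroup

variable {V : Type u} [Quiver.{w} V] (φ : GraphMap V)

/-- The substitution on the edges given by a graph map. -/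
def letters (e : Quiver.Total V) : List (Quiver.Total V × Bool) := edgeList (φ.edge e.hom)

/-- The image of an edge path, without reduction. -/
def mapPath {a : V} : ∀ {b : V}, EdgePath a b → EdgePath (φ.obj a) (φ.obj b)
  | _, .nil => .nil
  | _, .fwd p e => (mapPath p).comp (φ.edge e)
  | _, .bwd p e => (mapPath p).comp (φ.edge e).symm

theorem edgeList_mapPath {a b : V} (p : EdgePath a b) :
    edgeList (φ.mapPath p) = subst φ.letters (edgeList p) := by
  induction p with
  | nil => rfl
  | fwd p e ih => simp [mapPath, ih, subst, substLetter, letters]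
  | bwd p e ih => simp [mapPath, ih, subst, substLetter, letters]

theorem word_mapPath {a b : V} (p : EdgePath a b) :
    word (φ.mapPath p) = substHom φ.letters (word p) := by
  rw [word, edgeList_mapPath, word, substHom_mk]

/-- The map induced by a graph map on homotopy classes of paths. -/
def mapClass {a b : V} (f : vtx a ⟶ vtx b) : vtx (φ.obj a) ⟶ vtx (φ.obj b) := φ.functor.map f

@[simp] theorem mapClass_comp {a b c : V} (f : vtx a ⟶ vtx b) (g : vtx b ⟶ vtx c) :
    φ.mapClass (f ≫ g) = φ.mapClass f ≫ φ.mapClass g := φ.functor.map_comp f g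

@[simp] theorem mapClass_id (a : V) : φ.mapClass (𝟙 (vtx a)) = 𝟙 (vtx (φ.obj a)) :=
  φ.functor.map_id _

@[simp] theorem mapClass_inv {a b : V} (f : vtx a ⟶ vtx b) :
    φ.mapClass (inv f) = inv (φ.mapClass f) := φ.functor.map_inv f

theorem mapClass_edgeClass {a b : V} (e : a ⟶ b) :
    φ.mapClass (edgeClass e) = pathClass (φ.edge e) := lift_edgeClass _ e

/-- The image of an edge path under an iterate, without reduction. -/
def mapPathIter : ∀ (n : ℕ) {a b : V}, EdgePath a b → EdgePath (φ.obj^[n] a) (φ.obj^[n] b)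
  | 0, _, _, p => p
  | n + 1, _, _, p => mapPathIter n (φ.mapPath p)

theorem edgeList_mapPathIter (n : ℕ) {a b : V} (p : EdgePath a b) :
    edgeList (φ.mapPathIter n p) = (subst φ.letters)^[n] (edgeList p) := by
  induction n generalizing a b with
  | zero => rfl
  | succ n ih =>
    change edgeList (φ.mapPathIter n (φ.mapPath p)) = _
    rw [ih, edgeList_mapPath, Function.iterate_succ_apply]

theorem word_mapPathIter (n : ℕ) {a b : V} (p : EdgePath a b) :
    word (φ.mapPathIter n p) = (substHom φ.letters)^[n] (word p) := by
  rw [word, edgeList_mapPathIter, word, substHom_iterate_mk]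

theorem iterEdge_eq (n : ℕ) (e : Quiver.Total V) :
    φ.iterEdge n e = (subst φ.letters)^[n] [(e, true)] := rfl

variable {φ}

theorem IsTrainTrack.legal_singleton (h : φ.IsTrainTrack) (x : Quiver.Total V × Bool) :
    Legal φ.letters [x] := by
  have hp : ∀ e, Legal φ.letters [(e, true)] := fun e n => (h e n).2
  rcases x with ⟨e, _ | _⟩
  · exact (hp e).invRev
  · exact hp e

end GraphMap

/-! ## The fundamental groupoid of the mapping torus -/

namespace GraphMap

open EdgePath FreeGroup

variable {V : Type u} [Quiver.{w} V] (φ : GraphMap V)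

@[simp] theorem inclPath_nil (a : V) : φ.inclPath (nil : EdgePath a a) = 𝟙 (φ.base a) :=
  (Quotient.functor φ.TwoCell).map_id _

theorem inclPath_fwd {a b c : V} (p : EdgePath a b) (e : b ⟶ c) :
    φ.inclPath (p.fwd e) = φ.inclPath p ≫ φ.vert e :=
  (Quotient.functor φ.TwoCell).map_comp _ _

theorem inclPath_bwd {a b c : V} (p : EdgePath a b) (e : c ⟶ b) :
    φ.inclPath (p.bwd e) = φ.inclPath p ≫ inv (φ.vert e) := by
  refine ((Quotient.functor φ.TwoCell).map_comp _ _).trans ?_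
  rw [Groupoid.inv_eq_inv, Functor.map_inv]
  rfl

@[simp] theorem inclPath_comp {a b c : V} (p : EdgePath a b) (q : EdgePath b c) :
    φ.inclPath (p.comp q) = φ.inclPath p ≫ φ.inclPath q := by
  induction q with
  | nil => simp [comp]
  | fwd q e ih => rw [comp, inclPath_fwd, ih, inclPath_fwd, Category.assoc]
  | bwd q e ih => rw [comp, inclPath_bwd, ih, inclPath_bwd, Category.assoc]

@[simp] theorem inclPath_symm {a b : V} (p : EdgePath a b) :
    φ.inclPath p.symm = inv (φ.inclPath p) := by
  induction p with
  | nil => simp [EdgePath.symm]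
  | fwd q e ih =>
    rw [EdgePath.symm, inclPath_comp, ih, inclPath_bwd, inclPath_nil, Category.id_comp, inclPath_fwd,
      IsIso.inv_comp]
  | bwd q e ih =>
    rw [EdgePath.symm, inclPath_comp, ih, inclPath_fwd, inclPath_nil, Category.id_comp, inclPath_bwd,
      IsIso.inv_comp, IsIso.inv_inv]

theorem inclFunctor_pathClass {a b : V} (p : EdgePath a b) :
    φ.inclFunctor.map (pathClass p) = φ.inclPath p := by
  have h : ∀ {a b : V} (e : a ⟶ b), φ.inclFunctor.map (edgeClass e) = φ.vert e :=
    fun e => lift_edgeClass _ e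
  induction p with
  | nil => exact (φ.inclFunctor.map_id _).trans (φ.inclPath_nil _).symm
  | fwd p e ih =>
    rw [pathClass, Functor.map_comp, ih, inclPath_fwd]
    exact congrArg (_ ≫ ·) (h e)
  | bwd p e ih =>
    rw [pathClass, Functor.map_comp, ih, inclPath_bwd, Groupoid.inv_eq_inv, Functor.map_inv]
    congr 2

theorem inclPath_eq_of_pathClass_eq {a b : V} {p q : EdgePath a b}
    (h : pathClass p = pathClass q) : φ.inclPath p = φ.inclPath q := by
  rw [← inclFunctor_pathClass, h, inclFunctor_pathClass]

theorem hor_comp_inclPath_edge {a b : V} (e : a ⟶ b) :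
    φ.hor a ≫ φ.inclPath (φ.edge e) = φ.vert e ≫ φ.hor b := by
  have h := CategoryTheory.Quotient.sound φ.TwoCell (TwoCell.cell (φ := φ) e)
  rwa [Functor.map_comp, Functor.map_comp] at h

/-- The 2-cells give this for one edge, and the relation is compatible with concatenation and
reversal. -/
theorem hor_comp_inclPath_mapPath {a b : V} (p : EdgePath a b) :
    φ.hor a ≫ φ.inclPath (φ.mapPath p) = φ.inclPath p ≫ φ.hor b := by
  induction p with
  | nil => simp [mapPath]
  | fwd p e ih =>
    rw [mapPath, inclPath_comp, ← Category.assoc, ih, Category.assoc, hor_comp_inclPath_edge,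
      inclPath_fwd, Category.assoc]
  | @bwd b c p e ih =>
    rw [mapPath, inclPath_comp, ← Category.assoc, ih, Category.assoc, inclPath_bwd,
      Category.assoc, inclPath_symm]
    congr 1
    rw [IsIso.comp_inv_eq, Category.assoc, hor_comp_inclPath_edge, IsIso.inv_hom_id_assoc]

/-- The horizontal path of length `n` starting at `a`. -/
def horIter : ∀ (n : ℕ) (a : V), φ.base a ⟶ φ.base (φ.obj^[n] a)
  | 0, a => 𝟙 (φ.base a)
  | n + 1, a => φ.hor a ≫ horIter n (φ.obj a)

theorem horIter_comp_inclPath (n : ℕ) {a b : V} (p : EdgePath a b) :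
    φ.horIter n a ≫ φ.inclPath (φ.mapPathIter n p) = φ.inclPath p ≫ φ.horIter n b := by
  induction n generalizing a b with
  | zero => exact (Category.id_comp _).trans (Category.comp_id _).symm
  | succ n ih =>
    change (φ.hor a ≫ φ.horIter n _) ≫ φ.inclPath (φ.mapPathIter n (φ.mapPath p)) =
      φ.inclPath p ≫ φ.hor b ≫ φ.horIter n _
    rw [Category.assoc, ih, ← Category.assoc, hor_comp_inclPath_mapPath, Category.assoc]

/-- An induction principle for morphisms of the fundamental groupoid of the mapping torus. -/
theorem hom_induction {a : V} {P : ∀ b : V, (φ.base a ⟶ φ.base b) → Prop}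
    (hid : P a (𝟙 (φ.base a)))
    (hvert : ∀ {b c : V} (γ : φ.base a ⟶ φ.base b) (e : b ⟶ c), P b γ → P c (γ ≫ φ.vert e))
    (hvert' : ∀ {b c : V} (γ : φ.base a ⟶ φ.base b) (e : c ⟶ b), P b γ →
      P c (γ ≫ inv (φ.vert e)))
    (hhor : ∀ {b : V} (γ : φ.base a ⟶ φ.base b), P b γ → P _ (γ ≫ φ.hor b))
    (hhor' : ∀ {b : V} (γ : φ.base a ⟶ φ.base (φ.obj b)), P _ γ → P b (γ ≫ inv (φ.hor b)))
    {b : V} (γ : φ.base a ⟶ φ.base b) : P b γ := by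
  obtain ⟨γ, rfl⟩ := (Quotient.functor φ.TwoCell).map_surjective γ
  obtain ⟨p, rfl⟩ := exists_pathClass_eq (V := φ.Skel) (a := ⟨a⟩) (b := ⟨b⟩) γ
  suffices h : ∀ (c : φ.Skel) (p : EdgePath (V := φ.Skel) ⟨a⟩ c),
      P c.pt ((Quotient.functor φ.TwoCell).map (pathClass p)) from h ⟨b⟩ p
  intro c p
  induction p with
  | nil =>
    have h : (Quotient.functor φ.TwoCell).map (𝟙 (φ.vtx₁ a)) = 𝟙 (φ.base a) :=
      (Quotient.functor φ.TwoCell).map_id _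
    change P a ((Quotient.functor φ.TwoCell).map (𝟙 (φ.vtx₁ a)))
    rwa [h]
  | @fwd b c p e ih =>
    have hmap := (Quotient.functor φ.TwoCell).map_comp (pathClass p) (edgeClass e)
    rcases b with ⟨b⟩
    rcases c with ⟨c⟩
    refine Eq.mpr (congrArg (P c) hmap) ?_
    change φ.XEdge b c at e
    cases e with
    | vert e => exact hvert _ e ih
    | hor => exact hhor _ ih
  | @bwd b c p e ih =>
    have hmap := (Quotient.functor φ.TwoCell).map_comp (pathClass p) (inv (edgeClass e))
    rw [Functor.map_inv, ← Groupoid.inv_eq_inv (edgeClass e)] at hmap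
    rcases b with ⟨b⟩
    rcases c with ⟨c⟩
    refine Eq.mpr (congrArg (P c) hmap) ?_
    change φ.XEdge c b at e
    cases e with
    | vert e => exact hvert' _ e ih
    | hor => exact hhor' _ ih

/-- Normal form: every path in the mapping torus is homotopic to one which first travels forward
horizontally, then along `V`, and finally backward horizontally. -/
theorem exists_normal_form {a b : V} (γ : φ.base a ⟶ φ.base b) :
    ∃ (n m : ℕ) (p : EdgePath (φ.obj^[n] a) (φ.obj^[m] b)),
      γ ≫ φ.horIter m b = φ.horIter n a ≫ φ.inclPath p := by
  induction γ using φ.hom_induction with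
  | hid =>
    have h : 𝟙 (φ.base a) ≫ 𝟙 (φ.base a) = 𝟙 (φ.base a) ≫ φ.inclPath (nil : EdgePath a a) := by
      rw [inclPath_nil]
    exact ⟨0, 0, nil, h⟩
  | @hvert b c γ e ih =>
    obtain ⟨n, m, p, h⟩ := ih
    -- The new edge is moved past the `m` trailing backward edges, which replaces it by its `m`-th
    -- image.
    refine ⟨n, m, p.comp (φ.mapPathIter m (nil.fwd e)), ?_⟩
    have he := φ.horIter_comp_inclPath m (nil.fwd e)
    rw [inclPath_fwd, inclPath_nil, Category.id_comp] at he
    rw [inclPath_comp, ← Category.assoc, ← h, Category.assoc, Category.assoc, he]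
  | @hvert' b c γ e ih =>
    obtain ⟨n, m, p, h⟩ := ih
    refine ⟨n, m, p.comp (φ.mapPathIter m (nil.bwd e)), ?_⟩
    have he := φ.horIter_comp_inclPath m (nil.bwd e)
    rw [inclPath_bwd, inclPath_nil, Category.id_comp] at he
    rw [inclPath_comp, ← Category.assoc, ← h, Category.assoc, Category.assoc, he]
  | @hhor b γ ih =>
    obtain ⟨n, m, p, h⟩ := ih
    -- The vertices `φ (φ^m c)` and `φ^m (φ c)` are equal, but not by definition for a variable `m`;
    -- a path `q` stands for the identification.
    have hsucc : ∀ (m : ℕ) (c : V), ∃ q : EdgePath (φ.obj (φ.obj^[m] c)) (φ.obj^[m] (φ.obj c)),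
        φ.horIter m c ≫ φ.hor _ ≫ φ.inclPath q = φ.hor c ≫ φ.horIter m (φ.obj c) := by
      intro m
      induction m with
      | zero =>
        intro c
        refine ⟨nil, ?_⟩
        change 𝟙 (φ.base c) ≫ φ.hor c ≫ φ.inclPath (nil : EdgePath (φ.obj c) (φ.obj c)) =
          φ.hor c ≫ 𝟙 (φ.base (φ.obj c))
        rw [inclPath_nil, Category.id_comp]
      | succ m ih =>
        intro c
        obtain ⟨q, hq⟩ := ih (φ.obj c)
        have h : (φ.hor c ≫ φ.horIter m (φ.obj c)) ≫ φ.hor _ ≫ φ.inclPath q =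
            φ.hor c ≫ φ.hor (φ.obj c) ≫ φ.horIter m (φ.obj (φ.obj c)) := by
          rw [Category.assoc, hq]
        exact ⟨q, h⟩
    obtain ⟨q, hq⟩ := hsucc m b
    obtain ⟨q', hq'⟩ := hsucc n a
    have h' : (γ ≫ φ.hor b) ≫ φ.horIter m (φ.obj b) = (φ.hor a ≫ φ.horIter n (φ.obj a)) ≫
        φ.inclPath ((q'.symm.comp (φ.mapPath p)).comp q) := by
      rw [Category.assoc, ← hq, inclPath_comp, inclPath_comp, ← hq', inclPath_symm,
        ← Category.assoc γ, h]
      simp only [Category.assoc, IsIso.hom_inv_id_assoc]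
      rw [← Category.assoc (φ.inclPath p), ← hor_comp_inclPath_mapPath, Category.assoc]
    exact ⟨n + 1, m, _, h'⟩
  | @hhor' b γ ih =>
    obtain ⟨n, m, p, h⟩ := ih
    have h' : (γ ≫ inv (φ.hor b)) ≫ φ.hor b ≫ φ.horIter m (φ.obj b) =
        φ.horIter n a ≫ φ.inclPath p := by
      rw [Category.assoc, IsIso.inv_hom_id_assoc, h]
    exact ⟨n, m + 1, p, h'⟩

/-! ### Heights -/

@[simp] theorem height_comp {a b c : V} (γ : φ.base a ⟶ φ.base b) (γ' : φ.base b ⟶ φ.base c) :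
    φ.height (γ ≫ γ') = φ.height γ + φ.height γ' := by
  unfold height
  rw [Functor.map_comp, add_comm]
  rfl

@[simp] theorem height_id (a : V) : φ.height (𝟙 (φ.base a)) = 0 := by
  have := φ.height_comp (𝟙 (φ.base a)) (𝟙 (φ.base a))
  rw [Category.id_comp] at this
  omega

@[simp] theorem height_inv {a b : V} (γ : φ.base a ⟶ φ.base b) :
    φ.height (inv γ) = - φ.height γ := by
  have := φ.height_comp γ (inv γ)
  rw [IsIso.hom_inv_id, height_id] at this
  omega

@[simp] theorem height_inclPath {a b : V} (p : EdgePath a b) : φ.height (φ.inclPath p) = 0 :=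
  congrArg Multiplicative.toAdd (φ.heightAux_vertPath₁ p)

@[simp] theorem height_hor (a : V) : φ.height (φ.hor a) = 1 :=
  congrArg Multiplicative.toAdd
    (lift_edgeClass (W := φ.Skel) (D := SingleObj (Multiplicative ℤ)) (a := ⟨a⟩)
      (b := ⟨φ.obj a⟩) _ (XEdge.hor a))

@[simp] theorem height_vert {a b : V} (e : a ⟶ b) : φ.height (φ.vert e) = 0 :=
  congrArg Multiplicative.toAdd (φ.heightAux_vert₁ e)

@[simp] theorem height_horIter (n : ℕ) (a : V) : φ.height (φ.horIter n a) = n := by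
  induction n generalizing a with
  | zero => exact φ.height_id a
  | succ n ih =>
    change φ.height (φ.hor a ≫ φ.horIter n _) = _
    rw [height_comp, height_hor, ih]
    push_cast
    ring

/-- The height, as a homomorphism on the fundamental group. -/
def heightHom (v : V) : φ.G v →* Multiplicative ℤ where
  toFun g := Multiplicative.ofAdd (φ.height g)
  map_one' := congrArg Multiplicative.ofAdd (φ.height_id v)
  map_mul' g h := congrArg Multiplicative.ofAdd (φ.height_comp g h)

/-- Two vertices of the same height are carried to the same component by the flow. -/
theorem exists_comp_horIter_eq {a b : V} (γ : φ.base a ⟶ φ.base b) (h : φ.height γ = 0) :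
    ∃ (n : ℕ) (p : EdgePath (φ.obj^[n] a) (φ.obj^[n] b)),
      γ ≫ φ.horIter n b = φ.horIter n a ≫ φ.inclPath p := by
  obtain ⟨n, m, p, hp⟩ := φ.exists_normal_form γ
  have := congrArg φ.height hp
  simp only [height_comp, height_horIter, height_inclPath, h] at this
  obtain rfl : n = m := by omega
  exact ⟨n, p, hp⟩

/-! ### Injectivity of the inclusion -/

variable {φ}

/-- The inclusion of `V` in the mapping torus of a `π₁`-injective map is `π₁`-injective. -/
theorem IsPiOneInjective.pathClass_eq_of_inclPath_eq {v : V} (h : φ.IsPiOneInjective v)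
    (hconn : ∀ a b : V, Nonempty (EdgePath a b)) {a b : V} {p q : EdgePath a b}
    (hpq : φ.inclPath p = φ.inclPath q) : pathClass p = pathClass q := by
  -- Chosen paths from `v` turn every path class into a loop at `v`. In the same way `φ` becomes an
  -- injective endomorphism `θ` of the vertex group, after conjugation by a path `w` from `v` to
  -- `φ(v)`.
  have Q : ∀ a, vtx v ⟶ vtx a := fun a => pathClass (Classical.choice (hconn v a))
  let K := vtx v ⟶ vtx v
  let w : vtx v ⟶ vtx (φ.obj v) := Q (φ.obj v)
  let θ : K →* K :=
    { toFun := fun k => w ≫ φ.mapClass k ≫ inv w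
      map_one' := by
        change w ≫ φ.mapClass (𝟙 _) ≫ inv w = 𝟙 _
        rw [mapClass_id, Category.id_comp, IsIso.hom_inv_id]
      map_mul' := fun k k' => by
        change w ≫ φ.mapClass (k ≫ k') ≫ inv w = (w ≫ _ ≫ _) ≫ (w ≫ _ ≫ _)
        rw [mapClass_comp]
        simp only [Category.assoc, IsIso.inv_hom_id_assoc] }
  have hθ : Function.Injective θ := by
    intro k k' hk
    apply h
    change φ.mapClass k = φ.mapClass k'
    have hk' : w ≫ φ.mapClass k ≫ inv w = w ≫ φ.mapClass k' ≫ inv w := hk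
    rw [cancel_epi, cancel_mono] at hk'
    exact hk'
  let θ' : (⊤ : Subgroup K) ≃* θ.range := Subgroup.topEquiv.trans (MonoidHom.ofInjective hθ)
  -- The ascending HNN extension in which conjugation by `t` acts on the vertex group as `θ`.
  let H := HNNExtension K ⊤ θ.range θ'
  let ι : K →* H := HNNExtension.of
  let t : H := HNNExtension.t
  have ht : ∀ k : K, t * ι k = ι (θ k) * t := fun k =>
    HNNExtension.t_mul_of (φ := θ') ⟨k, trivial⟩
  let R : ∀ {a b : V}, (vtx a ⟶ vtx b) → K := fun {a b} f => Q a ≫ f ≫ inv (Q b)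
  have hRcomp : ∀ {a b c : V} (f : vtx a ⟶ vtx b) (g : vtx b ⟶ vtx c),
      R (f ≫ g) = R f * R g := by
    intro a b c f g
    change Q a ≫ (f ≫ g) ≫ inv (Q c) = (Q a ≫ f ≫ inv (Q b)) ≫ (Q b ≫ g ≫ inv (Q c))
    simp only [Category.assoc, IsIso.inv_hom_id_assoc]
  -- The loops `s a` measure how far `φ` is from respecting the chosen paths. Sending `t_a` to `t⁻¹
  -- * s a` makes the 2-cell relations hold, by the twisted commutation `hs`.
  let s : V → K := fun a => w ≫ φ.mapClass (Q a) ≫ inv (Q (φ.obj a))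
  have hs : ∀ {a b : V} (f : vtx a ⟶ vtx b), s a * R (φ.mapClass f) = θ (R f) * s b := by
    intro a b f
    change (w ≫ φ.mapClass (Q a) ≫ inv (Q (φ.obj a))) ≫
        (Q (φ.obj a) ≫ φ.mapClass f ≫ inv (Q (φ.obj b))) =
      (w ≫ φ.mapClass (Q a ≫ f ≫ inv (Q b)) ≫ inv w) ≫
        (w ≫ φ.mapClass (Q b) ≫ inv (Q (φ.obj b)))
    simp only [mapClass_comp, Category.assoc, IsIso.inv_hom_id_assoc, mapClass_inv]
  let ℓ : ∀ {a b : V}, φ.XEdge a b → H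
    | _, _, .vert e => ι (R (edgeClass e))
    | _, _, .hor a => t⁻¹ * ι (s a)
  let Ψ₁ : Quiver.FreeGroupoid φ.Skel ⥤ SingleObj Hᵐᵒᵖ :=
    Quiver.FreeGroupoid.lift
      { obj := fun _ => SingleObj.star _
        map := fun e => MulOpposite.op (ℓ e) }
  have hvert : ∀ {a b : V} (e : a ⟶ b),
      Ψ₁.map (φ.vert₁ e) = MulOpposite.op (ι (R (edgeClass e))) := fun {a b} e =>
    lift_edgeClass (W := φ.Skel) (D := SingleObj Hᵐᵒᵖ) (a := ⟨a⟩) (b := ⟨b⟩) _ (XEdge.vert e)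
  have hhor : ∀ a : V, Ψ₁.map (φ.hor₁ a) = MulOpposite.op (t⁻¹ * ι (s a)) := fun a =>
    lift_edgeClass (W := φ.Skel) (D := SingleObj Hᵐᵒᵖ) (a := ⟨a⟩) (b := ⟨φ.obj a⟩) _
      (XEdge.hor a)
  have hpath : ∀ {a b : V} (p : EdgePath a b),
      Ψ₁.map (φ.vertPath₁ p) = MulOpposite.op (ι (R (pathClass p))) := by
    intro a b p
    have hRid : R (𝟙 (vtx a)) = 1 := by
      change Q a ≫ 𝟙 _ ≫ inv (Q a) = 𝟙 _
      rw [Category.id_comp, IsIso.hom_inv_id]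
    induction p with
    | nil =>
      rw [pathClass, hRid, _root_.map_one]
      exact Ψ₁.map_id _
    | fwd p e ih =>
      rw [vertPath₁, Functor.map_comp, ih, hvert, pathClass, hRcomp, _root_.map_mul]
      rfl
    | bwd p e ih =>
      have hRinv : R (Groupoid.inv (edgeClass e)) = (R (edgeClass e))⁻¹ := by
        rw [eq_inv_iff_mul_eq_one, ← hRcomp, Groupoid.inv_comp]
        change Q _ ≫ 𝟙 _ ≫ inv (Q _) = 𝟙 _
        rw [Category.id_comp, IsIso.hom_inv_id]
      have hinv : Ψ₁.map (Groupoid.inv (φ.vert₁ e)) =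
          MulOpposite.op (ι (R (edgeClass e)))⁻¹ := by
        rw [Groupoid.inv_eq_inv, Functor.map_inv, ← Groupoid.inv_eq_inv]
        exact congrArg (fun x : Hᵐᵒᵖ => x⁻¹) (hvert e)
      rw [vertPath₁, Functor.map_comp, ih, hinv, pathClass, hRcomp, _root_.map_mul, hRinv,
        _root_.map_inv]
      rfl
  let Ψ : φ.PiX ⥤ SingleObj Hᵐᵒᵖ := CategoryTheory.Quotient.lift _ Ψ₁ <| by
    rintro _ _ _ _ ⟨e⟩
    rw [Functor.map_comp, Functor.map_comp, hhor, hhor, hvert, hpath]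
    apply MulOpposite.unop_injective
    change (t⁻¹ * ι (s _)) * ι (R (pathClass (φ.edge e))) = ι (R (edgeClass e)) * (t⁻¹ * ι (s _))
    rw [mul_assoc, ← _root_.map_mul, ← mapClass_edgeClass, hs, _root_.map_mul, ← mul_assoc,
      ← mul_assoc]
    congr 1
    rw [inv_mul_eq_iff_eq_mul, ← mul_assoc, ht, mul_inv_cancel_right]
  have key : ∀ p : EdgePath a b, Ψ.map (φ.inclPath p) = MulOpposite.op (ι (R (pathClass p))) :=
    fun p => hpath p
  have h1 : ι (R (pathClass p)) = ι (R (pathClass q)) := by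
    apply MulOpposite.op_injective
    rw [← key, ← key, hpq]
  -- The base group embeds in an HNN extension, so the loops of `p` and `q` already agree in the
  -- vertex group.
  have h2 : Q a ≫ pathClass p ≫ inv (Q b) = Q a ≫ pathClass q ≫ inv (Q b) :=
    HNNExtension.of_injective _ h1
  rwa [cancel_epi, cancel_mono] at h2

end GraphMap

/-! ## The path metric of a realised graph -/

namespace Gph

variable {Ve Ed : Type*} (Γ : Gph Ve Ed) {c : Ed → ℝ}

/-- A vertex, as a point of the realisation. -/
def node (x : Ve) : Γ.Pt := Sum.inl x

theorem locate_cons (p : Γ.Pt) (e : Ed) (b : Bool) (r : ℝ) (l : List ((Ed × Bool) × ℝ)) (s : ℝ) :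
    Γ.locate p (((e, b), r) :: l) s =
      if s ≤ r then Γ.onEdge e (if b then s / r else 1 - s / r) else Γ.locate p l (s - r) := rfl

@[simp] theorem onEdge_zero (e : Ed) : Γ.onEdge e 0 = Γ.node (Γ.ι e) := by
  exact (dif_neg (by simp)).trans (if_pos le_rfl)

@[simp] theorem onEdge_one (e : Ed) : Γ.onEdge e 1 = Γ.node (Γ.τ e) := by
  exact (dif_neg (by simp)).trans (if_neg (by norm_num))

theorem onEdge_of_mem (e : Ed) (s : Set.Ioo (0 : ℝ) 1) : Γ.onEdge e s = Sum.inr (e, s) :=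
  dif_pos s.2

theorem onEdge_of_nonpos (e : Ed) {s : ℝ} (hs : s ≤ 0) : Γ.onEdge e s = Γ.node (Γ.ι e) :=
  (dif_neg fun h => hs.not_gt h.1).trans (if_pos hs)

theorem onEdge_of_one_le (e : Ed) {s : ℝ} (hs : 1 ≤ s) : Γ.onEdge e s = Γ.node (Γ.τ e) :=
  (dif_neg fun h => hs.not_gt h.2).trans (if_neg (by linarith))

theorem onEdge_cases (s : ℝ) : s ≤ 0 ∨ 1 ≤ s ∨ ∃ t : Set.Ioo (0 : ℝ) 1, (t : ℝ) = s := by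
  by_cases h : 0 < s ∧ s < 1
  · exact Or.inr (Or.inr ⟨⟨s, h⟩, rfl⟩)
  · by_cases h0 : s ≤ 0
    · exact Or.inl h0
    · exact Or.inr (Or.inl (not_lt.1 fun h1 => h ⟨not_le.1 h0, h1⟩))

/-- A map which is given by `F` on the edges commutes with the parametrisation of paths. -/
theorem map_locate {Ve' Ed' : Type*} {Γ' : Gph Ve' Ed'} (f : Γ.Pt → Γ'.Pt) (F : Ed → Ed')
    (hf : ∀ e s, f (Γ.onEdge e s) = Γ'.onEdge (F e) s) (p : Γ.Pt) (l : List (Ed × Bool))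
    (r : List ℝ) (s : ℝ) :
    f (Γ.locate p (l.zip r) s) = Γ'.locate (f p) ((l.map (Prod.map F id)).zip r) s := by
  induction l generalizing r s with
  | nil => rfl
  | cons a l ih =>
    cases r with
    | nil => rfl
    | cons r₀ r =>
      obtain ⟨e, b⟩ := a
      simp only [List.map_cons, List.zip_cons_cons, Prod.map, id, locate_cons]
      split_ifs
      · exact hf _ _
      · exact hf _ _
      · exact ih _ _

/-! ### Walks and their parametrisation -/

/-- A combinatorial walk, given by its oriented edges. -/
def Walk : Ve → List (Ed × Bool) → Ve → Prop
  | x, [], y => x = y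
  | x, (e, b) :: l, y => (bif b then Γ.ι e else Γ.τ e) = x ∧ Walk (bif b then Γ.τ e else Γ.ι e) l y

theorem Walk.append {Γ : Gph Ve Ed} {x y z : Ve} {l l' : List (Ed × Bool)} (h : Γ.Walk x l y)
    (h' : Γ.Walk y l' z) : Γ.Walk x (l ++ l') z := by
  induction l generalizing x with
  | nil => obtain rfl : x = y := h; exact h'
  | cons a l ih => exact ⟨h.1, ih h.2⟩

theorem locate_zero {x y : Ve} {m : List ((Ed × Bool) × ℝ)} (h : Γ.Walk x (m.map Prod.fst) y)
    (hm : ∀ t ∈ m, 0 < t.2) : Γ.locate (Γ.node x) m 0 = Γ.node x := by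
  cases m with
  | nil => rfl
  | cons a m =>
    obtain ⟨⟨e, b⟩, r⟩ := a
    rw [locate_cons, if_pos (hm _ (List.mem_cons_self)).le]
    obtain ⟨rfl, -⟩ := h
    cases b <;> simp

/-- The default point is returned only when the list is exhausted. A positive parameter within the
total width never gets there. -/
theorem locate_base (p q : Γ.Pt) {m : List ((Ed × Bool) × ℝ)} {s : ℝ} (hs : 0 < s)
    (hs' : s ≤ (m.map Prod.snd).sum) : Γ.locate p m s = Γ.locate q m s := by
  induction m generalizing s with
  | nil => simp at hs'; linarith
  | cons a m ih =>
    obtain ⟨⟨e, b⟩, r⟩ := a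
    simp only [List.map_cons, List.sum_cons] at hs'
    rw [locate_cons, locate_cons]
    split_ifs with h1
    · rfl
    · rfl
    · exact ih (by linarith) (by linarith)

theorem locate_sum {x y : Ve} {m : List ((Ed × Bool) × ℝ)} (h : Γ.Walk x (m.map Prod.fst) y)
    (hm : ∀ t ∈ m, 0 < t.2) :
    Γ.locate (Γ.node x) m (m.map Prod.snd).sum = Γ.node y := by
  induction m generalizing x with
  | nil => exact congrArg Γ.node h
  | cons a m ih =>
    obtain ⟨⟨e, b⟩, r⟩ := a
    obtain ⟨hx, hy⟩ := h
    have hr : 0 < r := hm _ List.mem_cons_self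
    have hm' : ∀ t ∈ m, 0 < t.2 := fun t ht => hm t (List.mem_cons_of_mem _ ht)
    rw [List.map_cons, List.sum_cons, locate_cons]
    cases m with
    | nil =>
      obtain rfl := hy
      rw [if_pos (by simp)]
      cases b <;> simp [hr.ne']
    | cons a' m' =>
      have hpos : 0 < ((a' :: m').map Prod.snd).sum :=
        List.sum_pos _ (fun u hu => by
          obtain ⟨t, ht, rfl⟩ := List.mem_map.1 hu
          exact hm' t ht) (by simp)
      rw [if_neg (by linarith), add_sub_cancel_left, ← ih hy hm']
      exact Γ.locate_base _ _ hpos le_rfl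

theorem exists_locate_eq {p : Γ.Pt} {m : List ((Ed × Bool) × ℝ)} {s : ℝ} (hs : 0 ≤ s)
    (hne : m ≠ []) (hs' : s ≤ (m.map Prod.snd).sum) :
    ∃ e b, (e, b) ∈ m.map Prod.fst ∧ ∃ u ∈ Set.Icc (0 : ℝ) 1, Γ.locate p m s = Γ.onEdge e u := by
  induction m generalizing s with
  | nil => exact absurd rfl hne
  | cons a m ih =>
    obtain ⟨⟨e, b⟩, r⟩ := a
    simp only [List.map_cons, List.sum_cons] at hs'
    rw [locate_cons]
    split_ifs with h1 h2
    · exact ⟨e, b, by simp, _, ⟨div_nonneg hs (hs.trans h1), div_le_one_of_le₀ h1 (hs.trans h1)⟩,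
        rfl⟩
    · have h3 := div_nonneg hs (hs.trans h1)
      have h4 := div_le_one_of_le₀ h1 (hs.trans h1)
      exact ⟨e, b, by simp, _, ⟨by linarith, by linarith⟩, rfl⟩
    · have hne' : m ≠ [] := by
        rintro rfl
        simp at hs'
        exact h1 hs'
      obtain ⟨e', b', hmem, hu⟩ := ih (s := s - r) (by linarith) hne' (by linarith)
      exact ⟨e', b', List.mem_cons_of_mem _ hmem, hu⟩

section Chain

variable {Γ}

theorem Chain.nonneg (hc : ∀ e, 0 ≤ c e) {x y : Γ.Pt} {r : ℝ} (h : Γ.Chain c x y r) : 0 ≤ r := by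
  induction h with
  | refl => exact le_rfl
  | move e s t _ _ _ ih => have := hc e; positivity

theorem Chain.trans {x y z : Γ.Pt} {r r' : ℝ} (h : Γ.Chain c x y r) (h' : Γ.Chain c y z r') :
    Γ.Chain c x z (r + r') := by
  induction h' with
  | refl => simpa using h
  | move e s t hs ht _ ih => rw [← add_assoc]; exact .move e s t hs ht ih

theorem Chain.onEdge (e : Ed) {s t : ℝ} (hs : s ∈ Set.Icc (0 : ℝ) 1)
    (ht : t ∈ Set.Icc (0 : ℝ) 1) : Γ.Chain c (Γ.onEdge e s) (Γ.onEdge e t) (c e * |s - t|) := by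
  simpa using Chain.move (c := c) e s t hs ht (.refl _)

theorem Chain.symm {x y : Γ.Pt} {r : ℝ} (h : Γ.Chain c x y r) : Γ.Chain c y x r := by
  induction h with
  | refl => exact .refl _
  | move e s t hs ht _ ih =>
    rw [add_comm, abs_sub_comm]
    exact (Chain.onEdge e ht hs).trans ih

end Chain

theorem pathDist_le {x y : Γ.Pt} {r : ℝ} (h : Γ.Chain c x y r) :
    Γ.pathDist c x y ≤ ENNReal.ofReal r := iInf₂_le r h

theorem pathDist_onEdge_le (e : Ed) {s t : ℝ} (hs : s ∈ Set.Icc (0 : ℝ) 1)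
    (ht : t ∈ Set.Icc (0 : ℝ) 1) :
    Γ.pathDist c (Γ.onEdge e s) (Γ.onEdge e t) ≤ ENNReal.ofReal (c e * |s - t|) :=
  Γ.pathDist_le (.onEdge e hs ht)

@[simp] theorem pathDist_self (x : Γ.Pt) : Γ.pathDist c x x = 0 := by
  simpa using Γ.pathDist_le (c := c) (.refl x)

theorem pathDist_comm (x y : Γ.Pt) : Γ.pathDist c x y = Γ.pathDist c y x :=
  le_antisymm (le_iInf₂ fun _ h => Γ.pathDist_le h.symm)
    (le_iInf₂ fun _ h => Γ.pathDist_le h.symm)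

theorem pathDist_triangle (x y z : Γ.Pt) :
    Γ.pathDist c x z ≤ Γ.pathDist c x y + Γ.pathDist c y z := by
  rw [pathDist, pathDist, pathDist]
  simp_rw [ENNReal.iInf_add, ENNReal.add_iInf]
  exact le_iInf₂ fun r h => le_iInf₂ fun r' h' =>
    (Γ.pathDist_le (h.trans h')).trans ENNReal.ofReal_add_le

/-- A map which is Lipschitz on every edge is Lipschitz. -/
theorem pathDist_map_le (hc : ∀ e, 0 ≤ c e) {Ve' Ed' : Type*} (Γ' : Gph Ve' Ed') {c' : Ed' → ℝ}
    (f : Γ.Pt → Γ'.Pt) {K : ℝ} (hK : 0 < K)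
    (hf : ∀ e, ∀ s ∈ Set.Icc (0 : ℝ) 1, ∀ t ∈ Set.Icc (0 : ℝ) 1,
      Γ'.pathDist c' (f (Γ.onEdge e s)) (f (Γ.onEdge e t)) ≤ ENNReal.ofReal (K * (c e * |s - t|)))
    (x y : Γ.Pt) : Γ'.pathDist c' (f x) (f y) ≤ ENNReal.ofReal K * Γ.pathDist c x y := by
  have key : ∀ {y r}, Γ.Chain c x y r → Γ'.pathDist c' (f x) (f y) ≤ ENNReal.ofReal (K * r) := by
    intro y r h
    induction h with
    | refl => simp
    | @move r e s t hs ht h ih =>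
      have h1 := h.nonneg hc
      have h2 := hc e
      refine (Γ'.pathDist_triangle _ _ _).trans ((add_le_add ih (hf e s hs t ht)).trans_eq ?_)
      rw [← ENNReal.ofReal_add (by positivity) (by positivity), mul_add]
  unfold pathDist at key ⊢
  rw [ENNReal.mul_iInf_of_ne (by simpa using hK) ENNReal.ofReal_ne_top]
  refine le_iInf fun r => ?_
  rw [ENNReal.mul_iInf_of_ne (by simpa using hK) ENNReal.ofReal_ne_top]
  refine le_iInf fun h => ?_
  rw [← ENNReal.ofReal_mul hK.le]
  exact key h

/-- The parametrisation of a walk is Lipschitz. -/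
theorem pathDist_locate_le (hc : ∀ e, 0 ≤ c e) {K : ℝ} {x y : Ve} {m : List ((Ed × Bool) × ℝ)}
    (h : Γ.Walk x (m.map Prod.fst) y) (hm : ∀ t ∈ m, 0 < t.2 ∧ c t.1.1 ≤ K * t.2)
    {s t : ℝ} (hs : 0 ≤ s) (hst : s ≤ t) (ht : t ≤ (m.map Prod.snd).sum) :
    Γ.pathDist c (Γ.locate (Γ.node x) m s) (Γ.locate (Γ.node x) m t) ≤
      ENNReal.ofReal (K * (t - s)) := by
  induction m generalizing x s t with
  | nil => exact (Γ.pathDist_self _).trans_le bot_le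
  | cons a m ih =>
    obtain ⟨⟨e, b⟩, r⟩ := a
    obtain ⟨hx, hy⟩ := h
    obtain ⟨hr, hK⟩ := hm _ List.mem_cons_self
    change 0 < r at hr
    change c e ≤ K * r at hK
    have hm' : ∀ t ∈ m, 0 < t.2 ∧ c t.1.1 ≤ K * t.2 := fun t ht =>
      hm t (List.mem_cons_of_mem _ ht)
    simp only [List.map_cons, List.sum_cons] at ht
    have hK0 : 0 ≤ K := nonneg_of_mul_nonneg_left ((hc e).trans hK) hr
    have h01 : ∀ u, 0 ≤ u → u ≤ r → (if b then u / r else 1 - u / r) ∈ Set.Icc (0 : ℝ) 1 := by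
      intro u hu hur
      have h1 := div_nonneg hu hr.le
      have h2 := div_le_one_of_le₀ hur hr.le
      split_ifs
      · exact ⟨h1, h2⟩
      · exact ⟨by linarith, by linarith⟩
    have hedge : ∀ u u', 0 ≤ u → u ≤ u' → u' ≤ r →
        Γ.pathDist c (Γ.onEdge e (if b then u / r else 1 - u / r))
          (Γ.onEdge e (if b then u' / r else 1 - u' / r)) ≤ ENNReal.ofReal (K * (u' - u)) := by
      intro u u' hu huu' hu'
      refine (Γ.pathDist_onEdge_le e (h01 u hu (huu'.trans hu'))
        (h01 u' (hu.trans huu') hu')).trans (ENNReal.ofReal_le_ofReal ?_)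
      have : |(if b then u / r else 1 - u / r) - (if b then u' / r else 1 - u' / r)| =
          (u' - u) / r := by
        have h1 : 0 ≤ (u' - u) / r := div_nonneg (by linarith) hr.le
        split_ifs
        · rw [abs_sub_comm, ← sub_div, abs_of_nonneg h1]
        · rw [sub_sub_sub_cancel_left, ← sub_div, abs_of_nonneg h1]
      rw [this, mul_div_assoc', div_le_iff₀ hr]
      nlinarith [mul_le_mul_of_nonneg_right hK (sub_nonneg.2 huu')]
    have hend : Γ.onEdge e (if b then r / r else 1 - r / r) =
        Γ.node (bif b then Γ.τ e else Γ.ι e) := by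
      cases b <;> simp [hr.ne']
    have hbase : ∀ u, r < u → u ≤ r + (m.map Prod.snd).sum →
        Γ.locate (Γ.node x) m (u - r) =
          Γ.locate (Γ.node (bif b then Γ.τ e else Γ.ι e)) m (u - r) := fun u h1 h2 =>
      Γ.locate_base _ _ (by linarith) (by linarith)
    rw [locate_cons, locate_cons]
    by_cases h1 : t ≤ r
    · rw [if_pos h1, if_pos (hst.trans h1)]
      exact hedge s t hs hst h1
    · push Not at h1
      rw [if_neg h1.not_ge]
      by_cases h2 : s ≤ r
      -- If `s` is on the first edge and `t` beyond it, the path is cut at the end of that edge,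
      -- which is parameter `0` of the remaining walk.
      · rw [if_pos h2, hbase t h1 ht]
        refine (Γ.pathDist_triangle _ _ _).trans
          ((add_le_add (hedge s r hs h2 le_rfl) ?_).trans_eq
            (b := ENNReal.ofReal (K * (r - s)) + ENNReal.ofReal (K * (t - r - 0))) ?_)
        · have := ih hy hm' le_rfl (by linarith : 0 ≤ t - r) (by linarith)
          rw [Γ.locate_zero hy fun t ht => (hm' t ht).1] at this
          rwa [hend]
        · rw [← ENNReal.ofReal_add (mul_nonneg hK0 (by linarith))
            (mul_nonneg hK0 (by linarith))]
          congr 1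
          ring
      · push Not at h2
        rw [if_neg h2.not_ge, hbase t h1 ht, hbase s h2 (hst.trans ht)]
        have := ih hy hm' (by linarith : 0 ≤ s - r) (by linarith : s - r ≤ t - r) (by linarith)
        rwa [sub_sub_sub_cancel_right] at this

end Gph

/-! ## Lifts of paths and the flow on the preimage of `V` -/

namespace GraphMap

open EdgePath FreeGroup

variable {V : Type u} [Quiver.{w} V] (φ : GraphMap V) {v : V}

/-- The vertices of the preimage of `V` in the universal cover. -/
abbrev CoverVertex (v : V) : Type _ := Σ a : V, (φ.base v ⟶ φ.base a)

/-- The edges of the preimage of `V` in the universal cover. -/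
abbrev CoverEdge (v : V) : Type _ := Σ e : Quiver.Total V, (φ.base v ⟶ φ.base e.left)

theorem liftList_fwd {a b c : V} (γ : φ.base v ⟶ φ.base a) (p : EdgePath a b) (e : b ⟶ c) :
    φ.liftList γ (p.fwd e) =
      φ.liftList γ p ++ [((⟨⟨_, _, e⟩, γ ≫ φ.inclPath p⟩ : φ.CoverEdge v), true)] := rfl

theorem liftList_bwd {a b c : V} (γ : φ.base v ⟶ φ.base a) (p : EdgePath a b) (e : c ⟶ b) :
    φ.liftList γ (p.bwd e) =
      φ.liftList γ p ++ [((⟨⟨_, _, e⟩, γ ≫ φ.inclPath (p.bwd e)⟩ : φ.CoverEdge v), false)] := by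
  rw [inclPath_bwd, ← Groupoid.inv_eq_inv]
  rfl

theorem liftList_comp {a b c : V} (γ : φ.base v ⟶ φ.base a) (p : EdgePath a b)
    (q : EdgePath b c) :
    φ.liftList γ (p.comp q) = φ.liftList γ p ++ φ.liftList (γ ≫ φ.inclPath p) q := by
  induction q with
  | nil => simp [comp, liftList]
  | fwd q e ih => rw [comp, liftList_fwd, ih, liftList_fwd, inclPath_comp, Category.assoc,
      List.append_assoc]
  | bwd q e ih => rw [comp, liftList_bwd, ih, liftList_bwd, ← comp, inclPath_comp, Category.assoc,
      List.append_assoc]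

theorem map_liftList_proj {a b : V} (γ : φ.base v ⟶ φ.base a) (p : EdgePath a b) :
    (φ.liftList γ p).map (Prod.map Sigma.fst id) = edgeList p := by
  induction p with
  | nil => rfl
  | fwd p e ih => rw [liftList_fwd, List.map_append, ih]; rfl
  | bwd p e ih => rw [liftList_bwd, List.map_append, ih]; rfl

/-- Deck transformations on the edges of the preimage of `V`. -/
def actEdge (g : φ.G v) (e : φ.CoverEdge v) : φ.CoverEdge v := ⟨e.1, g ≫ e.2⟩

theorem map_liftList_act (g : φ.G v) {a b : V} (γ : φ.base v ⟶ φ.base a) (p : EdgePath a b) :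
    (φ.liftList γ p).map (Prod.map (φ.actEdge g) id) = φ.liftList (g ≫ γ) p := by
  induction p with
  | nil => rfl
  | fwd p e ih => rw [liftList_fwd, List.map_append, ih, liftList_fwd, Category.assoc]; rfl
  | bwd p e ih => rw [liftList_bwd, List.map_append, ih, liftList_bwd, Category.assoc]; rfl

theorem walk_liftList {a b : V} (γ : φ.base v ⟶ φ.base a) (p : EdgePath a b) :
    (φ.coverGraph v).Walk ⟨a, γ⟩ (φ.liftList γ p) ⟨b, γ ≫ φ.inclPath p⟩ := by
  induction p with
  | nil =>
    change (⟨a, γ⟩ : φ.CoverVertex v) = ⟨a, γ ≫ φ.inclPath nil⟩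
    rw [inclPath_nil, Category.comp_id]
  | fwd p e ih =>
    rw [liftList_fwd, inclPath_fwd, ← Category.assoc]
    exact ih.append ⟨rfl, rfl⟩
  | bwd p e ih =>
    rw [liftList_bwd]
    refine ih.append ⟨?_, rfl⟩
    change (⟨_, (γ ≫ φ.inclPath (p.bwd e)) ≫ φ.vert e⟩ : φ.CoverVertex v) = _
    rw [inclPath_bwd, Category.assoc, Category.assoc, IsIso.inv_hom_id, Category.comp_id]

/-- The lift of `φ(e)` which is the image of the edge `e` of the cover, with its widths. -/
def edgeImage (e : φ.CoverEdge v) : List ((φ.CoverEdge v × Bool) × ℝ) :=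
  (φ.liftList (e.2 ≫ φ.hor e.1.left) (φ.edge e.1.hom)).zip (φ.width e.1.hom)

theorem length_liftList {a b : V} (γ : φ.base v ⟶ φ.base a) (p : EdgePath a b) :
    (φ.liftList γ p).length = (edgeList p).length := by
  rw [← φ.map_liftList_proj γ p, List.length_map]

theorem map_fst_edgeImage (e : φ.CoverEdge v) : (φ.edgeImage e).map Prod.fst =
    φ.liftList (e.2 ≫ φ.hor e.1.left) (φ.edge e.1.hom) :=
  List.map_fst_zip (by rw [length_liftList, φ.width_length])

theorem sum_edgeImage (e : φ.CoverEdge v) : ((φ.edgeImage e).map Prod.snd).sum = 1 := by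
  rw [edgeImage, List.map_snd_zip (by rw [length_liftList, φ.width_length]), φ.width_sum]

theorem edgeImage_pos (e : φ.CoverEdge v) : ∀ t ∈ φ.edgeImage e, 0 < t.2 := fun _ ht =>
  φ.width_pos e.1.hom _ (List.of_mem_zip ht).2

theorem edgeImage_ne_nil (e : φ.CoverEdge v) : φ.edgeImage e ≠ [] := by
  intro h
  have := φ.sum_edgeImage e
  simp [h] at this

theorem walk_edgeImage (e : φ.CoverEdge v) :
    (φ.coverGraph v).Walk ⟨_, e.2 ≫ φ.hor e.1.left⟩ ((φ.edgeImage e).map Prod.fst)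
      ⟨_, (e.2 ≫ φ.vert e.1.hom) ≫ φ.hor e.1.right⟩ := by
  rw [map_fst_edgeImage]
  have := φ.walk_liftList (e.2 ≫ φ.hor e.1.left) (φ.edge e.1.hom)
  rwa [Category.assoc, hor_comp_inclPath_edge, ← Category.assoc] at this

theorem flow_node (x : φ.CoverVertex v) : φ.flow ((φ.coverGraph v).node x) =
    (φ.coverGraph v).node ⟨φ.obj x.1, x.2 ≫ φ.hor x.1⟩ := rfl

theorem iterate_flow_node (n : ℕ) (x : φ.CoverVertex v) :
    φ.flow^[n] ((φ.coverGraph v).node x) =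
      (φ.coverGraph v).node ⟨φ.obj^[n] x.1, x.2 ≫ φ.horIter n x.1⟩ := by
  induction n generalizing x with
  | zero =>
    obtain ⟨a, γ⟩ := x
    exact congrArg (fun γ' => (φ.coverGraph v).node ⟨a, γ'⟩) (Category.comp_id γ).symm
  | succ n ih =>
    rw [Function.iterate_succ_apply, flow_node, ih]
    exact congrArg (fun γ' => (φ.coverGraph v).node ⟨_, γ'⟩) (Category.assoc _ _ _)

/-- In the interior this is the definition. At the ends it says that the lift of `φ(e)` joins the
images of the endpoints; for the terminal one this is the 2-cell relation. -/
theorem flow_onEdge (e : φ.CoverEdge v) {s : ℝ} (hs : s ∈ Set.Icc (0 : ℝ) 1) :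
    φ.flow ((φ.coverGraph v).onEdge e s) =
      (φ.coverGraph v).locate ((φ.coverGraph v).node ⟨_, e.2 ≫ φ.hor e.1.left⟩)
        (φ.edgeImage e) s := by
  rcases hs.1.eq_or_lt with rfl | h0
  · rw [Gph.onEdge_zero, Gph.locate_zero _ (φ.walk_edgeImage e) (φ.edgeImage_pos e)]
    rfl
  · rcases hs.2.eq_or_lt with rfl | h1
    · rw [Gph.onEdge_one]
      conv_rhs => rw [← φ.sum_edgeImage e]
      rw [Gph.locate_sum _ (φ.walk_edgeImage e) (φ.edgeImage_pos e)]
      rfl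
    · rw [Gph.onEdge_of_mem _ e ⟨s, h0, h1⟩]
      rfl

/-! ### Deck transformations and the projection -/

theorem actPt_onEdge (g : φ.G v) (e : φ.CoverEdge v) (s : ℝ) :
    φ.actPt g ((φ.coverGraph v).onEdge e s) = (φ.coverGraph v).onEdge (φ.actEdge g e) s := by
  rcases Gph.onEdge_cases s with h | h | ⟨t, rfl⟩
  · rw [Gph.onEdge_of_nonpos _ _ h, Gph.onEdge_of_nonpos _ _ h]
    rfl
  · rw [Gph.onEdge_of_one_le _ _ h, Gph.onEdge_of_one_le _ _ h]
    exact congrArg (fun γ => (φ.coverGraph v).node ⟨_, γ⟩) (Category.assoc _ _ _).symm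
  · rw [Gph.onEdge_of_mem, Gph.onEdge_of_mem]
    rfl

theorem proj_onEdge (e : φ.CoverEdge v) (s : ℝ) :
    φ.proj ((φ.coverGraph v).onEdge e s) = (baseGraph V).onEdge e.1 s := by
  rcases Gph.onEdge_cases s with h | h | ⟨t, rfl⟩
  · rw [Gph.onEdge_of_nonpos _ _ h, Gph.onEdge_of_nonpos _ _ h]
    rfl
  · rw [Gph.onEdge_of_one_le _ _ h, Gph.onEdge_of_one_le _ _ h]
    rfl
  · rw [Gph.onEdge_of_mem, Gph.onEdge_of_mem]
    rfl

theorem flow_actPt (g : φ.G v) (z : φ.CoverPt v) : φ.flow (φ.actPt g z) = φ.actPt g (φ.flow z) := by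
  rcases z with x | ⟨e, s⟩
  · exact congrArg (fun γ => (φ.coverGraph v).node ⟨_, γ⟩) (Category.assoc _ _ _)
  · change (φ.coverGraph v).locate ((φ.coverGraph v).node ⟨_, (g ≫ e.2) ≫ φ.hor e.1.left⟩)
        ((φ.liftList ((g ≫ e.2) ≫ φ.hor e.1.left) (φ.edge e.1.hom)).zip (φ.width e.1.hom)) s =
      φ.actPt g ((φ.coverGraph v).locate ((φ.coverGraph v).node ⟨_, e.2 ≫ φ.hor e.1.left⟩)
        ((φ.liftList (e.2 ≫ φ.hor e.1.left) (φ.edge e.1.hom)).zip (φ.width e.1.hom)) s)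
    rw [Gph.map_locate _ (φ.actPt g) (φ.actEdge g) (φ.actPt_onEdge g), map_liftList_act,
      Category.assoc]
    rfl

theorem iterate_flow_actPt (g : φ.G v) (n : ℕ) (z : φ.CoverPt v) :
    φ.flow^[n] (φ.actPt g z) = φ.actPt g (φ.flow^[n] z) := by
  induction n generalizing z with
  | zero => rfl
  | succ n ih => rw [Function.iterate_succ_apply, flow_actPt, ih, Function.iterate_succ_apply]

theorem proj_flow (z : φ.CoverPt v) : φ.proj (φ.flow z) = φ.onPt (φ.proj z) := by
  rcases z with x | ⟨e, s⟩
  · rfl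
  · change φ.proj ((φ.coverGraph v).locate ((φ.coverGraph v).node ⟨_, e.2 ≫ φ.hor e.1.left⟩)
        ((φ.liftList (e.2 ≫ φ.hor e.1.left) (φ.edge e.1.hom)).zip (φ.width e.1.hom)) s) =
      (baseGraph V).locate ((baseGraph V).node _) ((edgeList (φ.edge e.1.hom)).zip
        (φ.width e.1.hom)) s
    rw [Gph.map_locate _ φ.proj Sigma.fst φ.proj_onEdge, map_liftList_proj]
    rfl

theorem proj_iterate_flow (n : ℕ) (z : φ.CoverPt v) :
    φ.proj (φ.flow^[n] z) = φ.onPt^[n] (φ.proj z) := by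
  induction n generalizing z with
  | zero => rfl
  | succ n ih => rw [Function.iterate_succ_apply, ih, proj_flow, Function.iterate_succ_apply]

/-! ### The vertex next to a point -/

variable {φ} in
/-- A vertex is its own nearby vertex; the vertex near an interior point of an edge is the initial
vertex of the edge. -/
def near : φ.CoverPt v → φ.CoverVertex v
  | Sum.inl x => x
  | Sum.inr (e, _) => ⟨e.1.left, e.2⟩

theorem near_actPt (g : φ.G v) (z : φ.CoverPt v) :
    near (φ.actPt g z) = ⟨(near z).1, g ≫ (near z).2⟩ := by
  rcases z with x | ⟨e, s⟩ <;> rfl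

theorem ptHeight_eq (z : φ.CoverPt v) : φ.ptHeight z = φ.height (near z).2 := by
  rcases z with x | ⟨e, s⟩ <;> rfl

theorem near_fst_eq_of_proj_eq {z z' : φ.CoverPt v} (h : φ.proj z = φ.proj z') :
    (near z).1 = (near z').1 := by
  rcases z with x | ⟨e, s⟩ <;> rcases z' with x' | ⟨e', s'⟩
  · exact Sum.inl_injective h
  · exact absurd h Sum.inl_ne_inr
  · exact absurd h Sum.inr_ne_inl
  · exact congrArg (fun t => Quiver.Total.left t.1) (Sum.inr_injective h)

theorem near_onEdge (e : φ.CoverEdge v) (s : ℝ) :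
    near ((φ.coverGraph v).onEdge e s) = (φ.coverGraph v).ι e ∨
      near ((φ.coverGraph v).onEdge e s) = (φ.coverGraph v).τ e := by
  rcases Gph.onEdge_cases s with h | h | ⟨t, rfl⟩
  · rw [Gph.onEdge_of_nonpos _ _ h]
    exact Or.inl rfl
  · rw [Gph.onEdge_of_one_le _ _ h]
    exact Or.inr rfl
  · rw [Gph.onEdge_of_mem]
    exact Or.inl rfl

/-! ### Edges on lifts of paths, and where the flow takes them -/

/-- The set of edges traversed by the lift of an edge path. -/
def edgesOn {a b : V} (γ : φ.base v ⟶ φ.base a) (p : EdgePath a b) : Set (φ.CoverEdge v) :=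
  {e | ∃ s, (e, s) ∈ φ.liftList γ p}

theorem edgesOn_comp {a b c : V} (γ : φ.base v ⟶ φ.base a) (p : EdgePath a b)
    (q : EdgePath b c) :
    φ.edgesOn γ (p.comp q) = φ.edgesOn γ p ∪ φ.edgesOn (γ ≫ φ.inclPath p) q := by
  ext e
  simp only [edgesOn, liftList_comp, List.mem_append, Set.mem_ofPred_eq, Set.mem_union, exists_or]

theorem edgesOn_nil {a : V} (γ : φ.base v ⟶ φ.base a) : φ.edgesOn γ (nil : EdgePath a a) = ∅ := by
  ext e
  simp [edgesOn, liftList]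

theorem edgesOn_fwd {a b c : V} (γ : φ.base v ⟶ φ.base a) (p : EdgePath a b) (e : b ⟶ c) :
    φ.edgesOn γ (p.fwd e) = φ.edgesOn γ p ∪ {⟨⟨_, _, e⟩, γ ≫ φ.inclPath p⟩} := by
  ext e'
  simp only [edgesOn, liftList_fwd, List.mem_append, Set.mem_ofPred_eq, Set.mem_union, exists_or,
    List.mem_singleton, Prod.mk.injEq, Set.mem_singleton_iff]
  simp

theorem edgesOn_bwd {a b c : V} (γ : φ.base v ⟶ φ.base a) (p : EdgePath a b) (e : c ⟶ b) :
    φ.edgesOn γ (p.bwd e) = φ.edgesOn γ p ∪ {⟨⟨_, _, e⟩, γ ≫ φ.inclPath (p.bwd e)⟩} := by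
  ext e'
  simp only [edgesOn, liftList_bwd, List.mem_append, Set.mem_ofPred_eq, Set.mem_union, exists_or,
    List.mem_singleton, Prod.mk.injEq, Set.mem_singleton_iff]
  simp

theorem edgesOn_subset_symm {a b : V} (γ : φ.base v ⟶ φ.base a) (p : EdgePath a b) :
    φ.edgesOn γ p ⊆ φ.edgesOn (γ ≫ φ.inclPath p) p.symm := by
  induction p with
  | nil => rw [edgesOn_nil]; exact Set.empty_subset _
  | fwd p e ih =>
    have h : (γ ≫ φ.inclPath (p.fwd e)) ≫ φ.inclPath (nil.bwd e) = γ ≫ φ.inclPath p := by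
      rw [inclPath_fwd, inclPath_bwd, inclPath_nil, Category.id_comp, Category.assoc,
        Category.assoc, IsIso.hom_inv_id, Category.comp_id]
    rw [edgesOn_fwd, EdgePath.symm, edgesOn_comp, edgesOn_bwd, h]
    exact Set.union_subset (ih.trans Set.subset_union_right)
      (fun x hx => Or.inl (Or.inr hx))
  | bwd p e ih =>
    have h : (γ ≫ φ.inclPath (p.bwd e)) ≫ φ.inclPath (nil.fwd e) = γ ≫ φ.inclPath p := by
      rw [inclPath_fwd, inclPath_bwd, inclPath_nil, Category.id_comp, Category.assoc,
        Category.assoc, IsIso.inv_hom_id, Category.comp_id]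
    rw [edgesOn_bwd, EdgePath.symm, edgesOn_comp, edgesOn_fwd, h, inclPath_nil, Category.comp_id]
    exact Set.union_subset (ih.trans Set.subset_union_right)
      (fun x hx => Or.inl (Or.inr hx))

/-- The image of an edge on the lift of `p` is on the lift of `φ(p)`. -/
theorem edgesOn_mapPath {a b : V} (γ : φ.base v ⟶ φ.base a) (p : EdgePath a b)
    {e : φ.CoverEdge v} (he : e ∈ φ.edgesOn γ p) :
    φ.edgesOn (e.2 ≫ φ.hor e.1.left) (φ.edge e.1.hom) ⊆
      φ.edgesOn (γ ≫ φ.hor a) (φ.mapPath p) := by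
  have hpath : ∀ {b : V} (p : EdgePath a b),
      (γ ≫ φ.hor a) ≫ φ.inclPath (φ.mapPath p) = (γ ≫ φ.inclPath p) ≫ φ.hor b := fun p => by
    rw [Category.assoc, hor_comp_inclPath_mapPath, Category.assoc]
  induction p with
  | nil => rw [edgesOn_nil] at he; exact absurd he (Set.notMem_empty e)
  | fwd p e' ih =>
    rw [mapPath, edgesOn_comp]
    rw [edgesOn_fwd] at he
    rcases he with he | rfl
    · exact (ih he).trans Set.subset_union_left
    · rw [hpath]
      exact Set.subset_union_right
  | bwd p e' ih =>
    rw [mapPath, edgesOn_comp]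
    rw [edgesOn_bwd] at he
    rcases he with he | rfl
    · exact (ih he).trans Set.subset_union_left
    · refine (φ.edgesOn_subset_symm _ _).trans (Eq.subset ?_ |>.trans Set.subset_union_right)
      rw [hpath]
      congr 1
      simp only [Category.assoc]
      rw [hor_comp_inclPath_edge, inclPath_bwd, Category.assoc, IsIso.inv_hom_id_assoc]

/-- In whichever direction the edge is traversed, the path reaches one endpoint just before it and
the other just after. This locates the vertex near a flowed point, which may be either endpoint. -/
theorem exists_prefix_of_mem_edgesOn {a b : V} (γ : φ.base v ⟶ φ.base a) (p : EdgePath a b)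
    {e : φ.CoverEdge v} (he : e ∈ φ.edgesOn γ p) :
    (∃ (c : V) (p₁ : EdgePath a c), edgeList p₁ <+: edgeList p ∧
      (φ.coverGraph v).ι e = ⟨c, γ ≫ φ.inclPath p₁⟩) ∧
    ∃ (c : V) (p₁ : EdgePath a c), edgeList p₁ <+: edgeList p ∧
      (φ.coverGraph v).τ e = ⟨c, γ ≫ φ.inclPath p₁⟩ := by
  induction p with
  | nil => rw [edgesOn_nil] at he; exact absurd he (Set.notMem_empty e)
  | fwd p e' ih =>
    rw [edgesOn_fwd] at he
    rcases he with he | rfl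
    · obtain ⟨⟨c, p₁, h1, h2⟩, d, p₂, h3, h4⟩ := ih he
      exact ⟨⟨c, p₁, h1.trans (List.prefix_append _ _), h2⟩,
        d, p₂, h3.trans (List.prefix_append _ _), h4⟩
    · refine ⟨⟨_, p, List.prefix_append _ _, rfl⟩, _, p.fwd e', List.prefix_rfl, ?_⟩
      rw [inclPath_fwd, ← Category.assoc]
      rfl
  | bwd p e' ih =>
    rw [edgesOn_bwd] at he
    rcases he with he | rfl
    · obtain ⟨⟨c, p₁, h1, h2⟩, d, p₂, h3, h4⟩ := ih he
      exact ⟨⟨c, p₁, h1.trans (List.prefix_append _ _), h2⟩,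
        d, p₂, h3.trans (List.prefix_append _ _), h4⟩
    · refine ⟨⟨_, p.bwd e', List.prefix_rfl, rfl⟩, _, p, List.prefix_append _ _, ?_⟩
      change (⟨_, (γ ≫ φ.inclPath (p.bwd e')) ≫ φ.vert e'⟩ : φ.CoverVertex v) = _
      rw [inclPath_bwd, Category.assoc, Category.assoc, IsIso.inv_hom_id, Category.comp_id]

/-- The images of a point on an edge under the flow are on the lifts of the iterated images of the
edge. -/
theorem exists_iterate_flow_onEdge {a b : V} (n : ℕ) (γ : φ.base v ⟶ φ.base a) (p : EdgePath a b)
    {e : φ.CoverEdge v} (he : e ∈ φ.edgesOn γ p) {s : ℝ} (hs : s ∈ Set.Icc (0 : ℝ) 1) :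
    ∃ e' ∈ φ.edgesOn (γ ≫ φ.horIter n a) (φ.mapPathIter n p), ∃ t ∈ Set.Icc (0 : ℝ) 1,
      φ.flow^[n] ((φ.coverGraph v).onEdge e s) = (φ.coverGraph v).onEdge e' t := by
  induction n generalizing a b e s with
  | zero =>
    have h : γ ≫ 𝟙 (φ.base a) = γ := Category.comp_id γ
    refine ⟨e, ?_, s, hs, rfl⟩
    change e ∈ φ.edgesOn (γ ≫ 𝟙 (φ.base a)) p
    rwa [h]
  | succ n ih =>
    obtain ⟨e', s', hmem, t, ht, heq⟩ := Gph.exists_locate_eq (φ.coverGraph v)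
      (p := (φ.coverGraph v).node ⟨_, e.2 ≫ φ.hor e.1.left⟩) hs.1 (φ.edgeImage_ne_nil e)
      (hs.2.trans_eq (φ.sum_edgeImage e).symm)
    rw [map_fst_edgeImage] at hmem
    obtain ⟨e'', he'', u, hu, h⟩ :=
      ih (γ ≫ φ.hor a) (φ.mapPath p) (φ.edgesOn_mapPath γ p he ⟨s', hmem⟩) ht
    refine ⟨e'', ?_, u, hu, (congrArg φ.flow^[n] ((φ.flow_onEdge e hs).trans heq)).trans h⟩
    have hassoc : (γ ≫ φ.hor a) ≫ φ.horIter n (φ.obj a) = γ ≫ φ.hor a ≫ φ.horIter n (φ.obj a) :=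
      Category.assoc _ _ _
    have hset := congrArg (fun δ => φ.edgesOn δ (φ.mapPathIter n (φ.mapPath p))) hassoc
    exact hset ▸ he''

/-- The vertex near the image of a point `z` under the `n`-th iterate of the flow is joined to the
image of the vertex near `z` by an initial segment of the `n`-th iterated image of an edge. -/
theorem exists_near_iterate (n : ℕ) (z : φ.CoverPt v) :
    ∃ (c : V) (p : EdgePath (φ.obj^[n] (near z).1) c),
      near (φ.flow^[n] z) = ⟨c, ((near z).2 ≫ φ.horIter n (near z).1) ≫ φ.inclPath p⟩ ∧
        (edgeList p = [] ∨ ∃ e, edgeList p <+: φ.iterEdge n e) := by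
  rcases z with x | ⟨e, s⟩
  · have h : (x.2 ≫ φ.horIter n x.1) ≫ φ.inclPath nil = x.2 ≫ φ.horIter n x.1 := by
      rw [inclPath_nil, Category.comp_id]
    exact ⟨φ.obj^[n] x.1, nil, (congrArg near (φ.iterate_flow_node n x)).trans
      (congrArg (fun δ => (⟨_, δ⟩ : φ.CoverVertex v)) h.symm), Or.inl rfl⟩
  · have hmem : e ∈ φ.edgesOn e.2 (nil.fwd e.1.hom) := by
      rw [edgesOn_fwd, inclPath_nil, Category.comp_id]
      exact Or.inr rfl
    obtain ⟨e', he', t, ht, heq⟩ := φ.exists_iterate_flow_onEdge n e.2 (nil.fwd e.1.hom) hmem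
      (s := s) ⟨s.2.1.le, s.2.2.le⟩
    rw [Gph.onEdge_of_mem] at heq
    obtain ⟨⟨c, p₁, h1, h2⟩, d, p₂, h3, h4⟩ := φ.exists_prefix_of_mem_edgesOn _ _ he'
    rw [edgeList_mapPathIter] at h1 h3
    rw [heq]
    rcases φ.near_onEdge e' t with h | h
    · exact ⟨c, p₁, h.trans h2, Or.inr ⟨e.1, h1⟩⟩
    · exact ⟨d, p₂, h.trans h4, Or.inr ⟨e.1, h3⟩⟩

theorem ptHeight_iterate_flow (n : ℕ) (z : φ.CoverPt v) :
    φ.ptHeight (φ.flow^[n] z) = φ.ptHeight z + n := by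
  obtain ⟨c, p, h, -⟩ := φ.exists_near_iterate n z
  rw [ptHeight_eq, ptHeight_eq, h, height_comp, height_comp, height_horIter, height_inclPath,
    add_zero]

theorem ptHeight_actPt (g : φ.G v) (z : φ.CoverPt v) :
    φ.ptHeight (φ.actPt g z) = φ.height g + φ.ptHeight z := by
  rw [ptHeight_eq, ptHeight_eq, near_actPt, height_comp]

end GraphMap

/-! ## The path metric on the preimage of `V` -/

namespace GraphMap

open EdgePath FreeGroup
open scoped Classical

variable {V : Type u} [Quiver.{w} V] {φ : GraphMap V} {v : V}

section Metric

variable {c : Quiver.Total V → ℝ}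

variable (φ) in
/-- The path metric on the preimage of `V` in which a lift of `e` has length `c e`. -/
abbrev coverDist (c : Quiver.Total V → ℝ) (x y : φ.CoverPt v) : ENNReal :=
  (φ.coverGraph v).pathDist (fun e => c e.1) x y

/-- Two vertices are joined by a path whose tightening has length at most `r`. -/
def Reach (c : Quiver.Total V → ℝ) (x y : φ.CoverVertex v) (r : ℝ) : Prop :=
  ∃ p : EdgePath x.1 y.1, x.2 ≫ φ.inclPath p = y.2 ∧ nrm c (word p) ≤ r

theorem Reach.mono {x y : φ.CoverVertex v} {r r' : ℝ} (h : Reach c x y r) (hr : r ≤ r') :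
    Reach c x y r' := by
  obtain ⟨p, h1, h2⟩ := h
  exact ⟨p, h1, h2.trans hr⟩

theorem nrm_singleton (x : Quiver.Total V × Bool) : nrm c (FreeGroup.mk [x]) = c x.1 := by
  rw [nrm_mk_of_isReduced IsReduced.singleton]
  simp

variable (hc : ∀ e, 0 < c e)
include hc

theorem Reach.target {x : φ.CoverVertex v} {e : φ.CoverEdge v} {r : ℝ}
    (h : Reach c x ((φ.coverGraph v).ι e) r) :
    Reach c x ((φ.coverGraph v).τ e) (r + c e.1) := by
  obtain ⟨p, h1, h2⟩ := h
  change EdgePath x.1 e.1.left at p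
  change x.2 ≫ φ.inclPath p = e.2 at h1
  have key : Reach c x (⟨e.1.right, e.2 ≫ φ.vert e.1.hom⟩ : φ.CoverVertex v) (r + c e.1) := by
    refine ⟨p.comp (nil.fwd e.1.hom), ?_, ?_⟩
    · rw [inclPath_comp, inclPath_fwd, inclPath_nil, Category.id_comp, ← h1, Category.assoc]
    · rw [word_comp]
      exact (nrm_mul_le hc _ _).trans (add_le_add h2 (nrm_singleton _).le)
  exact key

theorem Reach.source {x : φ.CoverVertex v} {e : φ.CoverEdge v} {r : ℝ}
    (h : Reach c x ((φ.coverGraph v).τ e) r) :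
    Reach c x ((φ.coverGraph v).ι e) (r + c e.1) := by
  obtain ⟨p, h1, h2⟩ := h
  change EdgePath x.1 e.1.right at p
  change x.2 ≫ φ.inclPath p = e.2 ≫ φ.vert e.1.hom at h1
  have key : Reach c x (⟨e.1.left, e.2⟩ : φ.CoverVertex v) (r + c e.1) := by
    refine ⟨p.comp (nil.bwd e.1.hom), ?_, ?_⟩
    · rw [inclPath_comp, inclPath_bwd, inclPath_nil, Category.id_comp, ← Category.assoc, h1,
        Category.assoc, IsIso.hom_inv_id, Category.comp_id]
    · rw [word_comp]
      exact (nrm_mul_le hc _ _).trans (add_le_add h2 (nrm_singleton _).le)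
  exact key

omit hc in
/-- The extension of `Reach` to points on edges. -/
def ReachPt (c : Quiver.Total V → ℝ) (x : φ.CoverVertex v) : φ.CoverPt v → ℝ → Prop
  | Sum.inl y, r => Reach c x y r
  | Sum.inr (e, s), r => Reach c x ((φ.coverGraph v).ι e) (r - c e.1 * s) ∨
      Reach c x ((φ.coverGraph v).τ e) (r - c e.1 * (1 - s))

/-- A path to a point of an edge arrives through one of its ends. At parameters `0` and `1` the two
alternatives are reconciled by traversing the whole edge. -/
theorem reachPt_onEdge {x : φ.CoverVertex v} {e : φ.CoverEdge v} {s : ℝ}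
    (hs : s ∈ Set.Icc (0 : ℝ) 1) {r : ℝ} :
    ReachPt c x ((φ.coverGraph v).onEdge e s) r ↔
      Reach c x ((φ.coverGraph v).ι e) (r - c e.1 * s) ∨
        Reach c x ((φ.coverGraph v).τ e) (r - c e.1 * (1 - s)) := by
  rcases hs.1.eq_or_lt with rfl | h0
  · rw [Gph.onEdge_zero]
    change Reach c x _ r ↔ _
    refine ⟨fun h => Or.inl (h.mono (by simp)), ?_⟩
    rintro (h | h)
    · exact h.mono (by simp)
    · exact (h.source hc).mono (by simp)
  · rcases hs.2.eq_or_lt with rfl | h1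
    · rw [Gph.onEdge_one]
      change Reach c x _ r ↔ _
      refine ⟨fun h => Or.inr (h.mono (by simp)), ?_⟩
      rintro (h | h)
      · exact (h.target hc).mono (by simp)
      · exact h.mono (by simp)
    · rw [Gph.onEdge_of_mem _ e ⟨s, h0, h1⟩]
      rfl

/-- The lower bound for the path metric: a move from `s` to `t` changes the offset from either end
by at most its own length, so chains are never shorter than tightened edge paths. -/
theorem reachPt_of_chain {x : φ.CoverVertex v} {z : φ.CoverPt v} {r : ℝ}
    (h : (φ.coverGraph v).Chain (fun e => c e.1) ((φ.coverGraph v).node x) z r) :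
    ReachPt c x z r := by
  induction h with
  | refl => exact ⟨nil, by rw [inclPath_nil, Category.comp_id], by simp⟩
  | @move r e s t hs ht _ ih =>
    rw [reachPt_onEdge hc hs] at ih
    rw [reachPt_onEdge hc ht]
    have h1 := hc e.1
    have h2 := mul_le_mul_of_nonneg_left (le_abs_self (s - t)) h1.le
    have h3 := mul_le_mul_of_nonneg_left (neg_abs_le (s - t)) h1.le
    rcases ih with h | h
    · exact Or.inl (h.mono (by linarith))
    · exact Or.inr (h.mono (by linarith))

theorem coverDist_le_wt (x : φ.CoverVertex v) {b : V} (p : EdgePath x.1 b) :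
    φ.coverDist c ((φ.coverGraph v).node x) ((φ.coverGraph v).node ⟨b, x.2 ≫ φ.inclPath p⟩) ≤
      ENNReal.ofReal (wt c (edgeList p)) := by
  have h01 : (0 : ℝ) ∈ Set.Icc (0 : ℝ) 1 := ⟨le_rfl, zero_le_one⟩
  have h11 : (1 : ℝ) ∈ Set.Icc (0 : ℝ) 1 := ⟨zero_le_one, le_rfl⟩
  induction p with
  | nil => rw [inclPath_nil, Category.comp_id]; simp
  | fwd p e ih =>
    rw [edgeList_fwd, wt_append, ENNReal.ofReal_add (wt_nonneg hc _) (wt_nonneg hc _)]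
    refine (Gph.pathDist_triangle _ _ _ _).trans (add_le_add ih ?_)
    have h := (φ.coverGraph v).pathDist_onEdge_le (c := fun e => c e.1)
      ⟨⟨_, _, e⟩, x.2 ≫ φ.inclPath p⟩ h01 h11
    rw [Gph.onEdge_zero, Gph.onEdge_one] at h
    have h' : (⟨_, x.2 ≫ φ.inclPath (p.fwd e)⟩ : φ.CoverVertex v) =
        (φ.coverGraph v).τ ⟨⟨_, _, e⟩, x.2 ≫ φ.inclPath p⟩ := by
      rw [inclPath_fwd, ← Category.assoc]; rfl
    rw [h']
    exact h.trans_eq (by simp)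
  | bwd p e ih =>
    rw [edgeList_bwd, wt_append, ENNReal.ofReal_add (wt_nonneg hc _) (wt_nonneg hc _)]
    refine (Gph.pathDist_triangle _ _ _ _).trans (add_le_add ih ?_)
    have h := (φ.coverGraph v).pathDist_onEdge_le (c := fun e => c e.1)
      ⟨⟨_, _, e⟩, x.2 ≫ φ.inclPath (p.bwd e)⟩ h11 h01
    rw [Gph.onEdge_zero, Gph.onEdge_one] at h
    have h' : (⟨_, x.2 ≫ φ.inclPath p⟩ : φ.CoverVertex v) =
        (φ.coverGraph v).τ ⟨⟨_, _, e⟩, x.2 ≫ φ.inclPath (p.bwd e)⟩ := by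
      change _ = (⟨_, (x.2 ≫ φ.inclPath (p.bwd e)) ≫ φ.vert e⟩ : φ.CoverVertex v)
      rw [inclPath_bwd, Category.assoc, Category.assoc, IsIso.inv_hom_id, Category.comp_id]
    rw [h']
    exact h.trans_eq (by simp)

theorem coverDist_le_nrm {x y : φ.CoverVertex v} (p : EdgePath x.1 y.1)
    (hp : x.2 ≫ φ.inclPath p = y.2) :
    φ.coverDist c ((φ.coverGraph v).node x) ((φ.coverGraph v).node y) ≤
      ENNReal.ofReal (nrm c (word p)) := by
  obtain ⟨p', h1, h2⟩ := p.exists_isReduced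
  have h3 := coverDist_le_wt hc x p'
  rw [φ.inclPath_eq_of_pathClass_eq h2, hp, h1] at h3
  exact h3

theorem exists_path_of_coverDist_ne_top {x y : φ.CoverVertex v}
    (h : φ.coverDist c ((φ.coverGraph v).node x) ((φ.coverGraph v).node y) ≠ ⊤) :
    ∃ p : EdgePath x.1 y.1, x.2 ≫ φ.inclPath p = y.2 := by
  by_contra hne
  refine h ?_
  simp only [coverDist, Gph.pathDist, iInf_eq_top]
  intro r hr
  obtain ⟨p, hp, -⟩ := reachPt_of_chain hc hr
  exact absurd ⟨p, hp⟩ hne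

/-- By injectivity the components are trees: all edge paths from `x` to `y` are homotopic and share
one reduced form, which is the shortest connection. -/
theorem coverDist_eq_nrm
    (hinj : ∀ {a b : V} {p q : EdgePath a b}, φ.inclPath p = φ.inclPath q →
      pathClass p = pathClass q) {x y : φ.CoverVertex v} (p : EdgePath x.1 y.1)
    (hp : x.2 ≫ φ.inclPath p = y.2) :
    φ.coverDist c ((φ.coverGraph v).node x) ((φ.coverGraph v).node y) =
      ENNReal.ofReal (nrm c (word p)) := by
  refine le_antisymm (coverDist_le_nrm hc p hp) (le_iInf₂ fun r hr => ?_)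
  obtain ⟨q, hq, hle⟩ := reachPt_of_chain hc hr
  change EdgePath x.1 y.1 at q
  have : φ.inclPath p = φ.inclPath q := by
    rw [← cancel_epi x.2, hp]
    exact hq.symm
  rw [word_eq_of_pathClass_eq (hinj this)]
  exact ENNReal.ofReal_le_ofReal hle

theorem coverDist_actPt (g : φ.G v) (x y : φ.CoverPt v) :
    φ.coverDist c (φ.actPt g x) (φ.actPt g y) = φ.coverDist c x y := by
  have key : ∀ (g : φ.G v) (x y : φ.CoverPt v),
      φ.coverDist c (φ.actPt g x) (φ.actPt g y) ≤ φ.coverDist c x y := fun g x y => by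
    have := (φ.coverGraph v).pathDist_map_le (c := fun e => c e.1) (fun e => (hc _).le)
      (φ.coverGraph v) (c' := fun e => c e.1) (φ.actPt g) one_pos
      (fun e s hs t ht => by
        rw [actPt_onEdge, actPt_onEdge, one_mul]
        exact Gph.pathDist_onEdge_le _ (φ.actEdge g e) hs ht) x y
    rwa [ENNReal.ofReal_one, one_mul] at this
  refine le_antisymm (key g x y) ?_
  conv_lhs => rw [← φ.one_actPt x, ← φ.one_actPt y, ← inv_mul_cancel g, φ.mul_actPt, φ.mul_actPt]
  exact key _ _ _

end Metric

/-! ### Growth under the flow -/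

variable (φ) in
/-- The properties of a train track map and its Perron-Frobenius lengths on which the construction
of the forward space rests. -/
structure IsMetricTrainTrack (ϖ : ℝ) (c : Quiver.Total V → ℝ) : Prop where
  pathClass_eq : ∀ {a b : V} {p q : EdgePath a b}, φ.inclPath p = φ.inclPath q →
    pathClass p = pathClass q
  legal : ∀ x, Legal φ.letters [x]
  pos : ∀ e, 0 < c e
  wt_letters : ∀ e, wt c (φ.letters e) = ϖ * c e
  one_lt : 1 < ϖ

variable [Finite (Quiver.Total V)] {ϖ : ℝ} {c : Quiver.Total V → ℝ}

omit [Finite (Quiver.Total V)] in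
theorem _root_.exists_pos_bound {ι : Type*} {s : Set ι} (hs : s.Finite) (f : ι → ℝ) :
    ∃ C, 0 < C ∧ ∀ i ∈ s, f i ≤ C := by
  obtain ⟨C, hC⟩ := (hs.image f).bddAbove
  exact ⟨max C 1, lt_max_of_lt_right one_pos,
    fun i hi => (hC (Set.mem_image_of_mem f hi)).trans (le_max_left _ _)⟩

namespace IsMetricTrainTrack

variable (h : φ.IsMetricTrainTrack ϖ c)
include h

omit [Finite (Quiver.Total V)] in
theorem ofReal_pow_pos (n : ℕ) : 0 < ENNReal.ofReal (ϖ ^ n) :=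
  ENNReal.ofReal_pos.2 (pow_pos (one_pos.trans h.one_lt) n)

theorem exists_coverDist_near_le : ∃ C, 0 < C ∧ (∀ e, c e ≤ C) ∧ ∀ z : φ.CoverPt v,
    φ.coverDist c z ((φ.coverGraph v).node (near z)) ≤ ENNReal.ofReal C := by
  obtain ⟨C, hC, hle⟩ := exists_pos_bound (Set.finite_univ (α := Quiver.Total V)) c
  refine ⟨C, hC, fun e => hle e trivial, fun z => ?_⟩
  rcases z with x | ⟨e, s⟩
  · exact (Gph.pathDist_self _ _).trans_le bot_le
  · have h1 := (φ.coverGraph v).pathDist_onEdge_le (c := fun e => c e.1) e (s := s) (t := 0)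
      ⟨s.2.1.le, s.2.2.le⟩ ⟨le_rfl, zero_le_one⟩
    rw [Gph.onEdge_of_mem, Gph.onEdge_zero] at h1
    refine h1.trans (ENNReal.ofReal_le_ofReal ?_)
    rw [sub_zero, abs_of_pos s.2.1]
    exact (mul_le_of_le_one_right (h.pos _).le s.2.2.le).trans (hle _ trivial)

/-- The widths of the subdivisions need not match the lengths `c`, so inside an edge the flow need
not be `ϖ`-Lipschitz. But the image of a point stays on the image of its edge, which has length `ϖ ^
n * c e`. -/
theorem exists_coverDist_iterate_near_le : ∃ C, 0 < C ∧ ∀ (n : ℕ) (z : φ.CoverPt v),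
    φ.coverDist c (φ.flow^[n] z) (φ.flow^[n] ((φ.coverGraph v).node (near z))) ≤
      ENNReal.ofReal (ϖ ^ n) * ENNReal.ofReal C := by
  obtain ⟨C, hC, hle, hnear⟩ := h.exists_coverDist_near_le (v := v)
  refine ⟨2 * C, by positivity, fun n z => ?_⟩
  have hpow : 1 ≤ ϖ ^ n := one_le_pow₀ h.one_lt.le
  obtain ⟨b, p, hp, hlist⟩ := φ.exists_near_iterate n z
  have hwt : wt c (edgeList p) ≤ ϖ ^ n * C := by
    rcases hlist with h0 | ⟨e, he⟩
    · rw [h0, wt_nil]; positivity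
    · refine (wt_le_of_sublist h.pos he.sublist).trans ?_
      rw [iterEdge_eq, wt_iterate_subst h.wt_letters]
      simpa using mul_le_mul_of_nonneg_left (hle e) (zero_le_one.trans hpow)
  have h1 := (coverDist_le_wt h.pos
    (⟨_, (near z).2 ≫ φ.horIter n (near z).1⟩ : φ.CoverVertex v) p).trans
      (ENNReal.ofReal_le_ofReal hwt)
  rw [← iterate_flow_node] at h1
  have h2 := hnear (φ.flow^[n] z)
  rw [hp] at h2
  refine (Gph.pathDist_triangle _ _ _ _).trans ((add_le_add h2
    ((Gph.pathDist_comm _ _ _).trans_le h1)).trans ?_)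
  rw [← ENNReal.ofReal_mul (by positivity), ← ENNReal.ofReal_add hC.le (by positivity)]
  exact ENNReal.ofReal_le_ofReal (by nlinarith)

omit [Finite (Quiver.Total V)] in
theorem nrm_iterate_substHom_le (n : ℕ) (g : FreeGroup (Quiver.Total V)) :
    nrm c ((substHom φ.letters)^[n] g) ≤ ϖ ^ n * nrm c g := by
  induction n with
  | zero => simp
  | succ n ih =>
    rw [Function.iterate_succ_apply', pow_succ', mul_assoc]
    exact (nrm_substHom_le h.pos h.wt_letters _).trans
      (mul_le_mul_of_nonneg_left ih (one_pos.trans h.one_lt).le)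

omit [Finite (Quiver.Total V)] in
theorem coverDist_iterate_node_le (n : ℕ) (x y : φ.CoverVertex v) :
    φ.coverDist c (φ.flow^[n] ((φ.coverGraph v).node x)) (φ.flow^[n] ((φ.coverGraph v).node y)) ≤
      ENNReal.ofReal (ϖ ^ n) *
        φ.coverDist c ((φ.coverGraph v).node x) ((φ.coverGraph v).node y) := by
  by_cases htop : φ.coverDist c ((φ.coverGraph v).node x) ((φ.coverGraph v).node y) = ⊤
  · rw [htop, ENNReal.mul_top (h.ofReal_pow_pos n).ne']
    exact le_top
  · obtain ⟨p, hp⟩ := exists_path_of_coverDist_ne_top h.pos htop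
    rw [coverDist_eq_nrm h.pos h.pathClass_eq p hp, iterate_flow_node, iterate_flow_node,
      ← ENNReal.ofReal_mul (pow_nonneg (one_pos.trans h.one_lt).le n)]
    refine (coverDist_le_nrm h.pos (φ.mapPathIter n p) ?_).trans (ENNReal.ofReal_le_ofReal ?_)
    · rw [Category.assoc, horIter_comp_inclPath, ← hp, Category.assoc]
    · rw [word_mapPathIter]
      exact h.nrm_iterate_substHom_le n _

/-- Up to a bounded error, the `n`-th iterate of the flow stretches distances by at most
`ϖ ^ n`. -/
theorem exists_coverDist_iterate_le : ∃ B, 0 < B ∧ ∀ (n : ℕ) (x y : φ.CoverPt v),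
    φ.coverDist c (φ.flow^[n] x) (φ.flow^[n] y) ≤
      ENNReal.ofReal (ϖ ^ n) * (φ.coverDist c x y + ENNReal.ofReal B) := by
  obtain ⟨C, hC, -, hnear⟩ := h.exists_coverDist_near_le (v := v)
  obtain ⟨D, hD, hiter⟩ := h.exists_coverDist_iterate_near_le (v := v)
  -- Passing to nearby vertices costs `C` per point before the flow and `ϖ ^ n * D` per point after
  -- it; between vertices there is no error.
  refine ⟨2 * C + 2 * D, by positivity, fun n x y => ?_⟩
  have h1 : φ.coverDist c ((φ.coverGraph v).node (near x)) ((φ.coverGraph v).node (near y)) ≤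
      ENNReal.ofReal C + (φ.coverDist c x y + ENNReal.ofReal C) :=
    (Gph.pathDist_triangle _ _ _ _).trans (add_le_add
      ((Gph.pathDist_comm _ _ _).trans_le (hnear x))
      ((Gph.pathDist_triangle _ _ _ _).trans (add_le_add le_rfl (hnear y))))
  have h2 := (h.coverDist_iterate_node_le n (near x) (near y)).trans (mul_le_mul_right h1 _)
  refine (Gph.pathDist_triangle _ _ _ _).trans ((add_le_add (hiter n x)
    ((Gph.pathDist_triangle _ _ _ _).trans (add_le_add h2
      ((Gph.pathDist_comm _ _ _).trans_le (hiter n y))))).trans_eq ?_)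
  rw [show (2 * C + 2 * D) = C + C + D + D by ring, ENNReal.ofReal_add (by positivity) hD.le,
    ENNReal.ofReal_add (by positivity) hD.le, ENNReal.ofReal_add hC.le hC.le]
  ring

/-- The flow is Lipschitz. -/
theorem exists_coverDist_flow_le : ∃ K, 0 < K ∧ ∀ x y : φ.CoverPt v,
    φ.coverDist c (φ.flow x) (φ.flow y) ≤ ENNReal.ofReal K * φ.coverDist c x y := by
  obtain ⟨C, hC, hle, -⟩ := h.exists_coverDist_near_le (v := v)
  have hfin : (⋃ e : Quiver.Total V, (fun r => (e, r)) '' {r | r ∈ φ.width e.hom}).Finite :=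
    Set.finite_iUnion fun e => (List.finite_toSet _).image _
  -- On an interval of width `r` the speed, relative to the length of `e`, is at most `C / (c e *
  -- r)`. There are finitely many such intervals.
  obtain ⟨K, hK, hbound⟩ := exists_pos_bound hfin fun t => C / (c t.1 * t.2)
  have hmain : ∀ e : Quiver.Total V, ∀ r ∈ φ.width e.hom, C ≤ K * c e * r := fun e r hr => by
    have h1 := hbound (e, r) (Set.mem_iUnion.2 ⟨e, r, hr, rfl⟩)
    have h2 := mul_pos (h.pos e) (φ.width_pos e.hom r hr)
    rw [div_le_iff₀ h2] at h1
    linarith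
  have hedge : ∀ e : φ.CoverEdge v, ∀ s ∈ Set.Icc (0 : ℝ) 1, ∀ t ∈ Set.Icc (0 : ℝ) 1, s ≤ t →
      φ.coverDist c (φ.flow ((φ.coverGraph v).onEdge e s)) (φ.flow ((φ.coverGraph v).onEdge e t)) ≤
        ENNReal.ofReal (K * (c e.1 * |s - t|)) := by
    intro e s hs t ht hst
    rw [flow_onEdge φ e hs, flow_onEdge φ e ht]
    refine (Gph.pathDist_locate_le _ (c := fun e => c e.1) (fun e => (h.pos _).le)
      (φ.walk_edgeImage e) (K := K * c e.1) (fun u hu => ⟨φ.edgeImage_pos e u hu, ?_⟩) hs.1 hst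
      (ht.2.trans_eq (φ.sum_edgeImage e).symm)).trans_eq ?_
    · exact (hle _).trans (hmain _ _ (List.of_mem_zip hu).2)
    · rw [abs_sub_comm, abs_of_nonneg (sub_nonneg.2 hst), mul_assoc]
  refine ⟨K, hK, (φ.coverGraph v).pathDist_map_le (fun e => (h.pos _).le) _ _ hK ?_⟩
  intro e s hs t ht
  rcases le_total s t with hst | hst
  · exact hedge e s hs t ht hst
  · rw [Gph.pathDist_comm, abs_sub_comm]
    exact hedge e t ht s hs hst

theorem exists_coverDist_iterate_flow_le (n : ℕ) : ∃ K, 0 < K ∧ ∀ x y : φ.CoverPt v,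
    φ.coverDist c (φ.flow^[n] x) (φ.flow^[n] y) ≤ ENNReal.ofReal K * φ.coverDist c x y := by
  obtain ⟨K, hK, hle⟩ := h.exists_coverDist_flow_le (v := v)
  refine ⟨K ^ n, by positivity, ?_⟩
  induction n with
  | zero => intro x y; simp
  | succ n ih =>
    intro x y
    rw [Function.iterate_succ_apply', Function.iterate_succ_apply', pow_succ',
      ENNReal.ofReal_mul hK.le, mul_assoc]
    exact (hle _ _).trans (mul_le_mul_right (ih x y) _)

end IsMetricTrainTrack

/-! ### The Perron-Frobenius lengths -/

omit [Finite (Quiver.Total V)] in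
theorem transition_mulVec [Fintype (Quiver.Total V)] (c : Quiver.Total V → ℝ)
    (e : Quiver.Total V) : φ.transition.mulVec c e = wt c (φ.letters e) := by
  have h : wt c (φ.letters e) = ((φ.letters e).map Prod.fst |>.map c).sum := by
    rw [List.map_map]; rfl
  rw [h, Finset.sum_list_map_count, Matrix.mulVec, dotProduct]
  refine (Finset.sum_subset (Finset.subset_univ ((φ.letters e).map Prod.fst).toFinset)
    fun f _ hf => ?_).symm.trans (Finset.sum_congr rfl fun f _ => ?_)
  · have : ((φ.letters e).map Prod.fst).count f = 0 :=
      List.count_eq_zero.2 fun hmem => hf (List.mem_toFinset.2 hmem)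
    change ((((φ.letters e).map Prod.fst).count f : ℕ) : ℝ) * c f = 0
    rw [this, Nat.cast_zero, zero_mul]
  · rw [nsmul_eq_mul]
    rfl

/-- If `ϖ ≤ 1`, the iterated images of a shortest edge are no longer than the edge, hence are single
edges. By finiteness one of them recurs, contrary to expansion. -/
theorem one_lt_of_wt_letters [Nonempty (Quiver.Total V)] (htt : φ.IsTrainTrack)
    (hexp : φ.HasExpandingEdges) (hc : ∀ e, 0 < c e)
    (hwt : ∀ e, wt c (φ.letters e) = ϖ * c e) : 1 < ϖ := by
  obtain ⟨e, he⟩ := Finite.exists_min c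
  by_contra! hle
  have hlen : ∀ l : List (Quiver.Total V × Bool), l.length * c e ≤ wt c l := by
    intro l
    induction l with
    | nil => simp
    | cons a l ih =>
      rw [wt_cons, List.length_cons]
      push_cast
      linarith [he a.1]
  have hϖ : 0 < ϖ := by
    have h1 : 0 ≤ wt c (φ.letters e) := wt_nonneg hc _
    rw [hwt] at h1
    refine (nonneg_of_mul_nonneg_left h1 (hc e)).lt_of_ne' fun h0 => (htt e 1).1 ?_
    have h2 := hwt e
    rw [h0, zero_mul, wt_eq_zero hc] at h2
    rw [iterEdge_eq]
    simpa [subst, substLetter] using h2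
  have hsingle : ∀ n, ∃ x, φ.iterEdge n e = [x] := by
    intro n
    rw [← List.length_eq_one_iff]
    refine le_antisymm ?_ (List.length_pos_iff.2 (htt e n).1)
    have h1 := hlen (φ.iterEdge n e)
    rw [iterEdge_eq, wt_iterate_subst hwt, wt_cons, wt_nil, add_zero] at h1
    have h2 : ϖ ^ n * c e ≤ c e := mul_le_of_le_one_left (hc e).le (pow_le_one₀ hϖ.le hle)
    have h3 : ((φ.iterEdge n e).length : ℝ) * c e ≤ 1 * c e := by
      rw [iterEdge_eq]; linarith
    exact_mod_cast le_of_mul_le_mul_right h3 (hc e)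
  choose x hx using hsingle
  obtain ⟨m, n, hmn, hxmn⟩ : ∃ m n, m < n ∧ x m = x n := by
    obtain ⟨m, n, hne, heq⟩ := Finite.exists_ne_map_eq_of_infinite x
    rcases hne.lt_or_gt with hlt | hlt
    · exact ⟨m, n, hlt, heq⟩
    · exact ⟨n, m, hlt, heq.symm⟩
  have hfix : (subst φ.letters)^[n - m] [x m] = [x m] := by
    rw [← hx m, iterEdge_eq, ← Function.iterate_add_apply, Nat.sub_add_cancel hmn.le,
      ← iterEdge_eq, ← iterEdge_eq, hx, hx, hxmn]
  refine hexp (x m).1 (n - m) (Nat.sub_pos_of_lt hmn) ?_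
  rw [iterEdge_eq]
  rcases hxm : x m with ⟨f, b⟩
  rw [hxm] at hfix
  -- A recurring reversed edge yields the recurring edge itself by reversing the word.
  cases b with
  | true => exact hfix
  | false =>
    have h1 : [((f, true) : Quiver.Total V × Bool)] = invRev [(f, false)] := rfl
    change (subst φ.letters)^[n - m] [(f, true)] = [(f, true)]
    rw [h1, iterate_subst_invRev, hfix]

end GraphMap

/-! ## The limit distance -/

/-- Almost monotone sequences converge: the limsup is at most `f N + ε N` for all large `N`, hence
at most the liminf. -/
theorem ENNReal.tendsto_limsup_of_le_add {f ε : ℤ → ENNReal} {N₀ : ℤ}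
    (hf : ∀ N M, N₀ ≤ N → N ≤ M → f M ≤ f N + ε N) (hε : Tendsto ε atTop (𝓝 0)) :
    Tendsto f atTop (𝓝 (limsup f atTop)) := by
  have hle : ∀ N, N₀ ≤ N → limsup f atTop ≤ f N + ε N := fun N hN =>
    limsup_le_of_le (by isBoundedDefault) (eventually_atTop.2 ⟨N, fun M hM => hf N M hN hM⟩)
  refine tendsto_of_le_liminf_of_limsup_le ?_ le_rfl
  have h1 : Tendsto (fun N => limsup f atTop - ε N) atTop (𝓝 (limsup f atTop)) := by
    have := ENNReal.Tendsto.sub (tendsto_const_nhds (x := limsup f atTop)) hε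
      (Or.inr ENNReal.zero_ne_top)
    rwa [tsub_zero] at this
  rw [← h1.liminf_eq]
  exact liminf_le_liminf (eventually_atTop.2 ⟨N₀, fun N hN => tsub_le_iff_right.2 (hle N hN)⟩)

theorem tendsto_zpow_neg_atTop {r : ℝ} (hr : 1 < r) :
    Tendsto (fun N : ℤ => r ^ (-N)) atTop (𝓝 0) := by
  rw [← Nat.map_cast_int_atTop, tendsto_map'_iff]
  refine (tendsto_pow_atTop_nhds_zero_of_lt_one (inv_nonneg.2 (one_pos.trans hr).le)
    (inv_lt_one_of_one_lt₀ hr)).congr fun n => ?_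
  simp

namespace GraphMap

open EdgePath FreeGroup
open scoped Classical

variable {V : Type u} [Quiver.{w} V] {φ : GraphMap V} {v : V}

section Level

variable (φ)

/-- The image of `x` at height `N` under the flow. -/
def up (N : ℤ) (x : φ.CoverPt v) : φ.CoverPt v := φ.flow^[(N - φ.ptHeight x).toNat] x

variable {φ}

theorem ptHeight_up {N : ℤ} {x : φ.CoverPt v} (h : φ.ptHeight x ≤ N) :
    φ.ptHeight (φ.up N x) = N := by
  rw [up, ptHeight_iterate_flow]
  omega

theorem up_add {N : ℤ} {x : φ.CoverPt v} (h : φ.ptHeight x ≤ N) (j : ℕ) :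
    φ.up (N + j) x = φ.flow^[j] (φ.up N x) := by
  rw [up, up, ← Function.iterate_add_apply]
  congr 1
  omega

theorem up_iterate {N : ℤ} {x : φ.CoverPt v} {m : ℕ} (h : φ.ptHeight x + m ≤ N) :
    φ.up N (φ.flow^[m] x) = φ.up N x := by
  rw [up, up, ptHeight_iterate_flow, ← Function.iterate_add_apply]
  congr 1
  omega

theorem up_add_ptHeight (x : φ.CoverPt v) (n : ℕ) :
    φ.up (φ.ptHeight x + n) x = φ.flow^[n] x := by
  rw [up]
  congr 1
  omega

theorem up_actPt (N : ℤ) (g : φ.G v) (x : φ.CoverPt v) :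
    φ.up N (φ.actPt g x) = φ.actPt g (φ.up (N - φ.height g) x) := by
  rw [up, up, iterate_flow_actPt, ptHeight_actPt, sub_sub]

variable (φ) in
/-- The scaled distance of the images at height `N`. -/
def levelDist (ϖ : ℝ) (c : Quiver.Total V → ℝ) (N : ℤ) (x y : φ.CoverPt v) : ENNReal :=
  φ.scaledDist ϖ c N (φ.up N x) (φ.up N y)

variable (φ) in
/-- The limit of the scaled distances of the images under the flow. -/
def limDist (ϖ : ℝ) (c : Quiver.Total V → ℝ) (x y : φ.CoverPt v) : ENNReal :=
  limsup (fun N => φ.levelDist ϖ c N x y) atTop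

theorem exists_path_iterate {x y : φ.CoverVertex v} (h : φ.height x.2 = φ.height y.2) :
    ∃ (n : ℕ) (p : EdgePath (φ.obj^[n] x.1) (φ.obj^[n] y.1)),
      (x.2 ≫ φ.horIter n x.1) ≫ φ.inclPath p = y.2 ≫ φ.horIter n y.1 := by
  obtain ⟨n, p, hp⟩ := φ.exists_comp_horIter_eq (inv x.2 ≫ y.2) (by
    rw [height_comp, height_inv, h, neg_add_cancel])
  exact ⟨n, p, by rw [Category.assoc, ← hp, Category.assoc, IsIso.hom_inv_id_assoc]⟩

end Level

variable [Finite (Quiver.Total V)] {ϖ : ℝ} {c : Quiver.Total V → ℝ}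

namespace IsMetricTrainTrack

variable (h : φ.IsMetricTrainTrack ϖ c)
include h

omit [Finite (Quiver.Total V)] in
theorem ofReal_zpow_mul (N : ℤ) (j : ℕ) :
    ENNReal.ofReal (ϖ ^ (-(N + j))) * ENNReal.ofReal (ϖ ^ j) = ENNReal.ofReal (ϖ ^ (-N)) := by
  have h0 : 0 < ϖ := one_pos.trans h.one_lt
  rw [← ENNReal.ofReal_mul (by positivity), neg_add, zpow_add₀ h0.ne', mul_assoc, zpow_neg ϖ j,
    zpow_natCast, inv_mul_cancel₀ (by positivity), mul_one]

/-- Rescaling absorbs the stretching factor of the flow and turns its additive error into `ϖ ^ (-N)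
* B`, which tends to `0`. -/
theorem exists_levelDist_le : ∃ B, 0 < B ∧ ∀ (N M : ℤ) (x y : φ.CoverPt v), φ.ptHeight x ≤ N →
    φ.ptHeight y ≤ N → N ≤ M → φ.levelDist ϖ c M x y ≤
      φ.levelDist ϖ c N x y + ENNReal.ofReal (ϖ ^ (-N)) * ENNReal.ofReal B := by
  obtain ⟨B, hB, hle⟩ := h.exists_coverDist_iterate_le (v := v)
  refine ⟨B, hB, fun N M x y hx hy hNM => ?_⟩
  obtain ⟨j, rfl⟩ := Int.le.dest hNM
  rw [levelDist, levelDist, up_add hx, up_add hy, scaledDist, scaledDist, ← mul_add,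
    ← h.ofReal_zpow_mul N j, mul_assoc]
  exact mul_le_mul_right (hle j _ _) _

omit [Finite (Quiver.Total V)] in
theorem tendsto_error (B : ℝ) :
    Tendsto (fun N : ℤ => ENNReal.ofReal (ϖ ^ (-N)) * ENNReal.ofReal B) atTop (𝓝 0) := by
  have := ENNReal.Tendsto.mul_const
    (ENNReal.tendsto_ofReal (tendsto_zpow_neg_atTop h.one_lt)) (b := ENNReal.ofReal B)
    (Or.inr ENNReal.ofReal_ne_top)
  rwa [ENNReal.ofReal_zero, zero_mul] at this

theorem tendsto_levelDist (x y : φ.CoverPt v) :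
    Tendsto (fun N => φ.levelDist ϖ c N x y) atTop (𝓝 (φ.limDist ϖ c x y)) := by
  obtain ⟨B, -, hle⟩ := h.exists_levelDist_le (v := v)
  exact ENNReal.tendsto_limsup_of_le_add
    (fun N M hN hNM => hle N M x y ((le_max_left _ _).trans hN) ((le_max_right _ _).trans hN) hNM)
    (h.tendsto_error B)

theorem exists_limDist_le : ∃ B, 0 < B ∧ ∀ (N : ℤ) (x y : φ.CoverPt v), φ.ptHeight x ≤ N →
    φ.ptHeight y ≤ N → φ.limDist ϖ c x y ≤
      φ.levelDist ϖ c N x y + ENNReal.ofReal (ϖ ^ (-N)) * ENNReal.ofReal B := by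
  obtain ⟨B, hB, hle⟩ := h.exists_levelDist_le (v := v)
  exact ⟨B, hB, fun N x y hx hy => le_of_tendsto (h.tendsto_levelDist x y)
    (eventually_atTop.2 ⟨N, fun M hM => hle N M x y hx hy hM⟩)⟩

/-- By the normal form, the path between vertices near the two points becomes vertical after flowing
far enough. -/
theorem exists_coverDist_iterate_ne_top {x y : φ.CoverPt v} (hxy : φ.ptHeight x = φ.ptHeight y) :
    ∃ n, φ.coverDist c (φ.flow^[n] x) (φ.flow^[n] y) ≠ ⊤ := by
  rw [ptHeight_eq, ptHeight_eq] at hxy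
  obtain ⟨n, p, hp⟩ := exists_path_iterate hxy
  obtain ⟨C, -, hC⟩ := h.exists_coverDist_iterate_near_le (v := v)
  have hfin : ∀ z : φ.CoverPt v, φ.coverDist c (φ.flow^[n] z)
      (φ.flow^[n] ((φ.coverGraph v).node (near z))) < ⊤ := fun z =>
    (hC n z).trans_lt (ENNReal.mul_lt_top ENNReal.ofReal_lt_top ENNReal.ofReal_lt_top)
  have h1 : φ.coverDist c (φ.flow^[n] ((φ.coverGraph v).node (near x)))
      (φ.flow^[n] ((φ.coverGraph v).node (near y))) < ⊤ := by
    rw [iterate_flow_node, iterate_flow_node]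
    exact (coverDist_le_nrm h.pos p hp).trans_lt ENNReal.ofReal_lt_top
  refine ⟨n, ne_of_lt (((Gph.pathDist_triangle _ _ _ _).trans (add_le_add le_rfl
    (Gph.pathDist_triangle _ _ _ _))).trans_lt (ENNReal.add_lt_top.2 ⟨hfin x,
      ENNReal.add_lt_top.2 ⟨h1, (Gph.pathDist_comm _ _ _).trans_lt (hfin y)⟩⟩))⟩

theorem limDist_ne_top (x y : φ.CoverPt v) : φ.limDist ϖ c x y ≠ ⊤ := by
  set N := max (φ.ptHeight x) (φ.ptHeight y)
  have hx : φ.ptHeight x ≤ N := le_max_left _ _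
  have hy : φ.ptHeight y ≤ N := le_max_right _ _
  obtain ⟨n, hn⟩ := h.exists_coverDist_iterate_ne_top (x := φ.up N x) (y := φ.up N y)
    (by rw [ptHeight_up hx, ptHeight_up hy])
  obtain ⟨B, -, hB⟩ := h.exists_limDist_le (v := v)
  refine ne_of_lt ((hB (N + n) x y (by omega) (by omega)).trans_lt (ENNReal.add_lt_top.2
    ⟨?_, ENNReal.mul_lt_top ENNReal.ofReal_lt_top ENNReal.ofReal_lt_top⟩))
  rw [levelDist, up_add hx, up_add hy]
  exact ENNReal.mul_lt_top ENNReal.ofReal_lt_top hn.lt_top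

omit [Finite (Quiver.Total V)] h in
theorem _root_.GraphMap.limDist_self (x : φ.CoverPt v) : φ.limDist ϖ c x x = 0 := by
  simp [limDist, levelDist, scaledDist]

omit [Finite (Quiver.Total V)] h in
theorem _root_.GraphMap.limDist_comm (x y : φ.CoverPt v) :
    φ.limDist ϖ c x y = φ.limDist ϖ c y x := by
  simp only [limDist, levelDist, scaledDist]
  simp_rw [Gph.pathDist_comm _ (φ.up _ x)]

theorem limDist_triangle (x y z : φ.CoverPt v) :
    φ.limDist ϖ c x z ≤ φ.limDist ϖ c x y + φ.limDist ϖ c y z := by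
  refine le_of_tendsto_of_tendsto' (h.tendsto_levelDist x z)
    ((h.tendsto_levelDist x y).add (h.tendsto_levelDist y z)) fun N => ?_
  rw [levelDist, levelDist, levelDist, scaledDist, scaledDist, scaledDist, ← mul_add]
  exact mul_le_mul_right (Gph.pathDist_triangle _ _ _ _) _

omit h [Finite (Quiver.Total V)] in
theorem _root_.GraphMap.limDist_iterate_left (m : ℕ) (x y : φ.CoverPt v) :
    φ.limDist ϖ c (φ.flow^[m] x) y = φ.limDist ϖ c x y := by
  refine limsup_congr (eventually_atTop.2 ⟨φ.ptHeight x + m, fun N hN => ?_⟩)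
  rw [levelDist, levelDist, up_iterate hN]

omit h [Finite (Quiver.Total V)] in
theorem _root_.GraphMap.limDist_iterate_right (m : ℕ) (x y : φ.CoverPt v) :
    φ.limDist ϖ c x (φ.flow^[m] y) = φ.limDist ϖ c x y := by
  rw [limDist_comm, limDist_iterate_left, limDist_comm]

-- No bound on `N` is needed, as `up` fixes a point whose height is at least `N`.
omit h [Finite (Quiver.Total V)] in
theorem _root_.GraphMap.limDist_up_left (N : ℤ) (x y : φ.CoverPt v) :
    φ.limDist ϖ c (φ.up N x) y = φ.limDist ϖ c x y := limDist_iterate_left _ _ _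

omit h [Finite (Quiver.Total V)] in
theorem _root_.GraphMap.limDist_up_right (N : ℤ) (x y : φ.CoverPt v) :
    φ.limDist ϖ c x (φ.up N y) = φ.limDist ϖ c x y := limDist_iterate_right _ _ _

-- A deck transformation is an isometry of the unscaled metric but shifts the level; the change of
-- scale is the homothety factor.
omit [Finite (Quiver.Total V)] in
theorem levelDist_actPt (N : ℤ) (g : φ.G v) (x y : φ.CoverPt v) :
    φ.levelDist ϖ c N (φ.actPt g x) (φ.actPt g y) =
      ENNReal.ofReal (ϖ ^ (-φ.height g)) * φ.levelDist ϖ c (N - φ.height g) x y := by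
  have h0 : 0 < ϖ := one_pos.trans h.one_lt
  rw [levelDist, levelDist, up_actPt, up_actPt, scaledDist, scaledDist, ← mul_assoc,
    ← ENNReal.ofReal_mul (by positivity), ← zpow_add₀ h0.ne']
  congr 1
  · congr 2
    ring
  · exact coverDist_actPt h.pos g _ _

theorem limDist_actPt (g : φ.G v) (x y : φ.CoverPt v) :
    φ.limDist ϖ c (φ.actPt g x) (φ.actPt g y) =
      ENNReal.ofReal (ϖ ^ (-φ.height g)) * φ.limDist ϖ c x y := by
  refine tendsto_nhds_unique (h.tendsto_levelDist _ _) ?_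
  simp_rw [h.levelDist_actPt]
  exact ENNReal.Tendsto.const_mul ((h.tendsto_levelDist x y).comp
    (tendsto_atTop_add_const_right _ (-φ.height g) tendsto_id)) (Or.inr ENNReal.ofReal_ne_top)

theorem tendsto_flowDist {k : ℤ} {x y : φ.CoverPt v} (hx : φ.ptHeight x = k)
    (hy : φ.ptHeight y = k) :
    Tendsto (φ.flowDist ϖ c k x y) atTop (𝓝 (φ.limDist ϖ c x y)) := by
  refine ((h.tendsto_levelDist x y).comp
    (tendsto_atTop_add_const_left _ k tendsto_natCast_atTop_atTop)).congr fun n => ?_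
  simp only [Function.comp, levelDist, flowDist]
  rw [← up_add_ptHeight x n, ← up_add_ptHeight y n, hx, hy]

/-- The limit distance, computed from the vertices near the images. -/
theorem tendsto_nearDist (x y : φ.CoverPt v) :
    Tendsto (fun N => ENNReal.ofReal (ϖ ^ (-N)) *
      φ.coverDist c ((φ.coverGraph v).node (near (φ.up N x)))
        ((φ.coverGraph v).node (near (φ.up N y)))) atTop (𝓝 (φ.limDist ϖ c x y)) := by
  obtain ⟨C, hC, -, hle⟩ := h.exists_coverDist_near_le (v := v)
  have h1 := h.tendsto_levelDist x y
  have h2 := h.tendsto_error (2 * C)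
  have h3 := ENNReal.Tendsto.sub h1 h2 (Or.inr ENNReal.zero_ne_top)
  have h4 := h1.add h2
  rw [tsub_zero] at h3
  rw [add_zero] at h4
  have e : ENNReal.ofReal (2 * C) = ENNReal.ofReal C + ENNReal.ofReal C := by
    rw [two_mul, ENNReal.ofReal_add hC.le hC.le]
  refine tendsto_of_tendsto_of_tendsto_of_le_of_le h3 h4 (fun N => ?_) (fun N => ?_)
  · rw [tsub_le_iff_right, levelDist, scaledDist, ← mul_add, e]
    refine mul_le_mul_right ((Gph.pathDist_triangle _ _ _ _).trans ((add_le_add (hle _)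
      ((Gph.pathDist_triangle _ _ _ _).trans (add_le_add le_rfl
        ((Gph.pathDist_comm _ _ _).trans_le (hle _))))).trans_eq ?_)) _
    ring
  · simp only [levelDist, scaledDist]
    rw [← mul_add, e]
    refine mul_le_mul_right ((Gph.pathDist_triangle _ _ _ _).trans ((add_le_add
      ((Gph.pathDist_comm _ _ _).trans_le (hle _))
      ((Gph.pathDist_triangle _ _ _ _).trans (add_le_add le_rfl (hle _)))).trans_eq ?_)) _
    ring

-- Reading words of paths from `t` embeds the vertices of its component, with their distances, in
-- the weighted free group.
omit [Finite (Quiver.Total V)] in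
theorem fourPoint_coverDist {x y z t : φ.CoverVertex v}
    (hx : φ.coverDist c ((φ.coverGraph v).node t) ((φ.coverGraph v).node x) ≠ ⊤)
    (hy : φ.coverDist c ((φ.coverGraph v).node t) ((φ.coverGraph v).node y) ≠ ⊤)
    (hz : φ.coverDist c ((φ.coverGraph v).node t) ((φ.coverGraph v).node z) ≠ ⊤) :
    φ.coverDist c ((φ.coverGraph v).node x) ((φ.coverGraph v).node y) +
      φ.coverDist c ((φ.coverGraph v).node z) ((φ.coverGraph v).node t) ≤
    max (φ.coverDist c ((φ.coverGraph v).node x) ((φ.coverGraph v).node z) +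
      φ.coverDist c ((φ.coverGraph v).node y) ((φ.coverGraph v).node t))
      (φ.coverDist c ((φ.coverGraph v).node x) ((φ.coverGraph v).node t) +
        φ.coverDist c ((φ.coverGraph v).node y) ((φ.coverGraph v).node z)) := by
  have key : ∀ {a b : φ.CoverVertex v} (p : EdgePath t.1 a.1) (q : EdgePath t.1 b.1),
      t.2 ≫ φ.inclPath p = a.2 → t.2 ≫ φ.inclPath q = b.2 →
      φ.coverDist c ((φ.coverGraph v).node a) ((φ.coverGraph v).node b) =
        ENNReal.ofReal (nrm c ((word p)⁻¹ * word q)) := fun {a b} p q hp hq => by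
    have h1 : a.2 ≫ φ.inclPath (p.symm.comp q) = b.2 := by
      rw [inclPath_comp, inclPath_symm, ← hp, Category.assoc, IsIso.hom_inv_id_assoc, hq]
    rw [coverDist_eq_nrm h.pos h.pathClass_eq _ h1, word_comp, word_symm]
  have ht : t.2 ≫ φ.inclPath nil = t.2 := by rw [inclPath_nil, Category.comp_id]
  obtain ⟨p, hp⟩ := exists_path_of_coverDist_ne_top h.pos hx
  obtain ⟨q, hq⟩ := exists_path_of_coverDist_ne_top h.pos hy
  obtain ⟨r, hr⟩ := exists_path_of_coverDist_ne_top h.pos hz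
  have hnn := nrm_nonneg (c := c) h.pos
  rw [key p q hp hq, key r nil hr ht, key p r hp hr, key q nil hq ht, key p nil hp ht,
    key q r hq hr, ← ENNReal.ofReal_add (hnn _) (hnn _), ← ENNReal.ofReal_add (hnn _) (hnn _),
    ← ENNReal.ofReal_add (hnn _) (hnn _), ← ENNReal.ofReal_max]
  refine ENNReal.ofReal_le_ofReal ?_
  have := fourPoint_nrm h.pos (word p) (word q) (word r) (word (nil : EdgePath t.1 t.1))
  simpa using this

theorem fourPoint_limDist (x y z t : φ.CoverPt v) :
    φ.limDist ϖ c x y + φ.limDist ϖ c z t ≤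
      max (φ.limDist ϖ c x z + φ.limDist ϖ c y t)
        (φ.limDist ϖ c x t + φ.limDist ϖ c y z) := by
  -- The limit is finite and the scale positive, so eventually the nearby vertices lie in a single
  -- component, where the four-point inequality is available.
  have hfin : ∀ a : φ.CoverPt v, ∀ᶠ N in atTop,
      φ.coverDist c ((φ.coverGraph v).node (near (φ.up N t)))
        ((φ.coverGraph v).node (near (φ.up N a))) ≠ ⊤ := fun a => by
    filter_upwards [(h.tendsto_nearDist t a).eventually_lt_const (h.limDist_ne_top t a).lt_top]
      with N hN htop
    rw [htop, ENNReal.mul_top (ENNReal.ofReal_pos.2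
      (zpow_pos (one_pos.trans h.one_lt) _)).ne'] at hN
    exact lt_irrefl _ hN
  refine le_of_tendsto_of_tendsto ((h.tendsto_nearDist x y).add (h.tendsto_nearDist z t))
    (((h.tendsto_nearDist x z).add (h.tendsto_nearDist y t)).max
      ((h.tendsto_nearDist x t).add (h.tendsto_nearDist y z))) ?_
  filter_upwards [hfin x, hfin y, hfin z] with N hx hy hz
  rw [← mul_add, ← mul_add, ← mul_add, ← mul_max]
  exact mul_le_mul_right (h.fourPoint_coverDist hx hy hz) _

end IsMetricTrainTrack

end GraphMap

/-! ## The forward space -/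

namespace GraphMap

open EdgePath FreeGroup
open scoped Classical

variable {V : Type u} [Quiver.{w} V] {φ : GraphMap V} {v : V}

section Leaves

theorem mkX_fst (x : φ.CoverPt v) (s : unitInterval) :
    (φ.mkX (x, s)).1 = x ∨ (φ.mkX (x, s)).1 = φ.flow x := by
  by_cases hs : (s : ℝ) < 1
  · exact Or.inl (congrArg Prod.fst (dif_pos hs : φ.mkX (x, s) = _))
  · exact Or.inr (congrArg Prod.fst (dif_neg hs : φ.mkX (x, s) = _))

theorem mkX_one (x : φ.CoverPt v) : φ.mkX (x, 1) = φ.ofPt (φ.flow x) :=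
  dif_neg (lt_irrefl (1 : ℝ))

theorem mkX_fst_snd (x : φ.XTilde v) :
    φ.mkX (x.1, ⟨x.2, x.2.2.1, x.2.2.2.le⟩) = x := dif_pos x.2.2.2

theorem ofPt_mem_forwardPath (x : φ.CoverPt v) (M : ℕ) : φ.ofPt x ∈ φ.forwardPath x M :=
  Or.inl rfl

theorem mkX_mem_forwardPath (x : φ.CoverPt v) (s : unitInterval) :
    φ.mkX (x, s) ∈ φ.forwardPath x 1 :=
  Or.inr (Set.mem_biUnion (x := 0) (Set.mem_Iio.2 one_pos) ⟨s, rfl⟩)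

theorem exists_fst_eq_iterate {a : φ.CoverPt v} {M : ℕ} {z : φ.XTilde v}
    (hz : z ∈ φ.forwardPath a M) : ∃ j, z.1 = φ.flow^[j] a := by
  rcases hz with rfl | hz
  · exact ⟨0, rfl⟩
  · obtain ⟨i, -, s, rfl⟩ := Set.mem_iUnion₂.1 hz
    rcases φ.mkX_fst (φ.flow^[i] a) s with h | h
    · exact ⟨i, h⟩
    · exact ⟨i + 1, by rw [Function.iterate_succ_apply']; exact h⟩

theorem leafRel_mkX (x : φ.CoverPt v) (s t : unitInterval) :
    φ.LeafRel (φ.mkX (x, s)) (φ.mkX (x, t)) :=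
  ⟨x, x, 1, 1, mkX_mem_forwardPath x s, mkX_mem_forwardPath x t, φ.ofPt x,
    ofPt_mem_forwardPath x 1, ofPt_mem_forwardPath x 1⟩

theorem mkX_zero (x : φ.CoverPt v) : φ.mkX (x, 0) = φ.ofPt x := dif_pos one_pos

theorem leaf_mkX (x : φ.CoverPt v) (s : unitInterval) :
    φ.leaf (φ.mkX (x, s)) = φ.leaf (φ.ofPt x) := by
  rw [← mkX_zero]
  exact Quot.sound (leafRel_mkX _ _ _)

theorem leaf_ofPt_fst (x : φ.XTilde v) : φ.leaf (φ.ofPt x.1) = φ.leaf x := by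
  conv_rhs => rw [← mkX_fst_snd x]
  rw [leaf_mkX]

theorem leaf_iterate_flow (n : ℕ) (x : φ.CoverPt v) :
    φ.leaf (φ.ofPt (φ.flow^[n] x)) = φ.leaf (φ.ofPt x) := by
  induction n with
  | zero => rfl
  | succ n ih => rw [Function.iterate_succ_apply', ← mkX_one, leaf_mkX, ih]

/-- A forward path follows one flow orbit, so points on intersecting forward paths have a common
future. Hence the limit distance depends only on leaves. -/
theorem LeafRel.exists_iterate_eq {x y : φ.XTilde v} (h : φ.LeafRel x y) :
    ∃ m n, φ.flow^[m] x.1 = φ.flow^[n] y.1 := by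
  obtain ⟨a, b, M, N, hx, hy, w, hwa, hwb⟩ := h
  obtain ⟨i, hi⟩ := exists_fst_eq_iterate hx
  obtain ⟨j, hj⟩ := exists_fst_eq_iterate hwa
  obtain ⟨k, hk⟩ := exists_fst_eq_iterate hy
  obtain ⟨l, hl⟩ := exists_fst_eq_iterate hwb
  refine ⟨k + j, i + l, ?_⟩
  have h1 : φ.flow^[j] x.1 = φ.flow^[i] w.1 := by
    rw [hi, hj, ← Function.iterate_add_apply, ← Function.iterate_add_apply, add_comm]
  have h2 : φ.flow^[l] y.1 = φ.flow^[k] w.1 := by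
    rw [hk, hl, ← Function.iterate_add_apply, ← Function.iterate_add_apply, add_comm]
  rw [Function.iterate_add_apply, Function.iterate_add_apply, h1, h2,
    ← Function.iterate_add_apply, ← Function.iterate_add_apply, add_comm]

end Leaves

variable {ϖ : ℝ} {c : Quiver.Total V → ℝ}

/-- A point of the preimage of `V` representing a point of the forward space. -/
def rep (q : φ.ForwardSpace v ϖ c) : φ.CoverPt v := (Quot.out (Quot.out q)).1

theorem rho_ofPt_fst (x : φ.XTilde v) : φ.rho ϖ c (φ.ofPt x.1) = φ.rho ϖ c x :=
  congrArg (Quot.mk _) (leaf_ofPt_fst x)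

theorem rho_ofPt_rep (q : φ.ForwardSpace v ϖ c) : φ.rho ϖ c (φ.ofPt (rep q)) = q := by
  rw [rep, rho_ofPt_fst]
  exact (congrArg (Quot.mk _) (Quot.out_eq _)).trans (Quot.out_eq q)

theorem rho_iterate_flow (n : ℕ) (x : φ.CoverPt v) :
    φ.rho ϖ c (φ.ofPt (φ.flow^[n] x)) = φ.rho ϖ c (φ.ofPt x) :=
  congrArg (Quot.mk _) (leaf_iterate_flow n x)

theorem rho_up (N : ℤ) (x : φ.CoverPt v) :
    φ.rho ϖ c (φ.ofPt (φ.up N x)) = φ.rho ϖ c (φ.ofPt x) := rho_iterate_flow _ _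

theorem rho_mkX (x : φ.CoverPt v) (s : unitInterval) :
    φ.rho ϖ c (φ.mkX (x, s)) = φ.rho ϖ c (φ.ofPt x) := congrArg (Quot.mk _) (leaf_mkX x s)

theorem ptHeight_onEdge (e : φ.CoverEdge v) (s : ℝ) :
    φ.ptHeight ((φ.coverGraph v).onEdge e s) = φ.height e.2 := by
  rw [ptHeight_eq]
  rcases φ.near_onEdge e s with h | h
  · rw [h]; rfl
  · rw [h]
    change φ.height (e.2 ≫ φ.vert e.1.hom) = _
    rw [height_comp, height_vert, add_zero]

namespace IsMetricTrainTrack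

variable [Finite (Quiver.Total V)] (h : φ.IsMetricTrainTrack ϖ c)
include h

theorem limDist_eq_of_eq_zero {x y : φ.CoverPt v} (hxy : φ.limDist ϖ c x y = 0)
    (z : φ.CoverPt v) : φ.limDist ϖ c x z = φ.limDist ϖ c y z := by
  refine le_antisymm ?_ ?_
  · have := h.limDist_triangle x y z
    rwa [hxy, zero_add] at this
  · have := h.limDist_triangle y x z
    rwa [limDist_comm y x, hxy, zero_add] at this

/-- The limit distance to `z`, on the forward space. -/
def distTo (z : φ.CoverPt v) : φ.ForwardSpace v ϖ c → ENNReal :=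
  Quot.lift (Quot.lift (fun x => φ.limDist ϖ c x.1 z) fun x y hxy => by
    obtain ⟨m, n, hmn⟩ := hxy.exists_iterate_eq
    rw [← limDist_iterate_left m, hmn, limDist_iterate_left]) <| by
      rintro _ _ ⟨k, x, y, hx, hy, rfl, rfl, hlim⟩
      exact h.limDist_eq_of_eq_zero (tendsto_nhds_unique (h.tendsto_flowDist hx hy) hlim) z

/-- Equality in the iterated quotient only means equivalence under the generated relations. Lifting
the function `distTo` avoids unwinding chains of them. -/
theorem limDist_congr_left {x y : φ.CoverPt v}
    (hxy : φ.rho ϖ c (φ.ofPt x) = φ.rho ϖ c (φ.ofPt y)) (z : φ.CoverPt v) :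
    φ.limDist ϖ c x z = φ.limDist ϖ c y z := congrArg (h.distTo z) hxy

/-- For the converse, both points are flowed to a common height, where the defining relation of the
quotient applies. -/
theorem rho_eq_iff {x y : φ.CoverPt v} :
    φ.rho ϖ c (φ.ofPt x) = φ.rho ϖ c (φ.ofPt y) ↔ φ.limDist ϖ c x y = 0 := by
  refine ⟨fun hxy => (h.limDist_congr_left hxy y).trans (limDist_self y), fun hxy => ?_⟩
  set N := max (φ.ptHeight x) (φ.ptHeight y)
  have hx : φ.ptHeight (φ.up N x) = N := ptHeight_up (le_max_left _ _)
  have hy : φ.ptHeight (φ.up N y) = N := ptHeight_up (le_max_right _ _)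
  rw [← rho_up N x, ← rho_up N y]
  refine Quot.sound ⟨N, _, _, hx, hy, rfl, rfl, ?_⟩
  rw [← hxy, ← limDist_up_left N, ← limDist_up_right N]
  exact h.tendsto_flowDist hx hy

/-- The metric of the forward space. -/
@[reducible] def metricSpace : MetricSpace (φ.ForwardSpace v ϖ c) where
  dist q q' := (φ.limDist ϖ c (rep q) (rep q')).toReal
  dist_self q := by rw [limDist_self, ENNReal.toReal_zero]
  dist_comm q q' := by rw [limDist_comm]
  dist_triangle q q' q'' := by
    rw [← ENNReal.toReal_add (h.limDist_ne_top _ _) (h.limDist_ne_top _ _)]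
    exact ENNReal.toReal_mono (ENNReal.add_ne_top.2 ⟨h.limDist_ne_top _ _, h.limDist_ne_top _ _⟩)
      (h.limDist_triangle _ _ _)
  eq_of_dist_eq_zero {q q'} hqq := by
    rw [ENNReal.toReal_eq_zero_iff] at hqq
    rw [← rho_ofPt_rep q, ← rho_ofPt_rep q']
    exact h.rho_eq_iff.2 (hqq.resolve_right (h.limDist_ne_top _ _))

theorem edist_rho (x y : φ.CoverPt v) : letI := h.metricSpace (v := v)
    edist (φ.rho ϖ c (φ.ofPt x)) (φ.rho ϖ c (φ.ofPt y)) = φ.limDist ϖ c x y := by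
  let _ := h.metricSpace (v := v)
  rw [edist_dist]
  change ENNReal.ofReal (ENNReal.toReal _) = _
  rw [ENNReal.ofReal_toReal (h.limDist_ne_top _ _), h.limDist_congr_left (rho_ofPt_rep _),
    limDist_comm, h.limDist_congr_left (rho_ofPt_rep _), limDist_comm]

/-- The limit distance is at most the scaled distance after `n` steps plus an error. First `n` is
chosen to make the error small; for this fixed `n` the flow is Lipschitz, which controls the other
term. -/
theorem continuous_rho_onEdge (e : φ.CoverEdge v) : letI := h.metricSpace (v := v)
    Continuous fun s : unitInterval => φ.rho ϖ c (φ.ofPt ((φ.coverGraph v).onEdge e s)) := by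
  let _ := h.metricSpace (v := v)
  refine continuous_iff_continuousAt.2 fun s₀ => ?_
  rw [ContinuousAt, tendsto_iff_edist_tendsto_0]
  simp_rw [h.edist_rho]
  rw [ENNReal.tendsto_nhds_zero]
  intro ε hε
  obtain ⟨B, -, hB⟩ := h.exists_limDist_le (v := v)
  have h1 := (h.tendsto_error B).comp
    (tendsto_atTop_add_const_left _ (φ.height e.2) tendsto_natCast_atTop_atTop)
  obtain ⟨n, hn⟩ := ((ENNReal.tendsto_nhds_zero.1 h1) (ε / 2)
    (ENNReal.div_pos hε.ne' ENNReal.ofNat_ne_top)).exists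
  obtain ⟨K, hK, hflow⟩ := h.exists_coverDist_iterate_flow_le (v := v) n
  set N := φ.height e.2 + n
  have h2 : Tendsto (fun s : unitInterval => ENNReal.ofReal (ϖ ^ (-N)) *
      (ENNReal.ofReal K * ENNReal.ofReal (c e.1 * |(s : ℝ) - s₀|))) (𝓝 s₀) (𝓝 0) := by
    have h3 : Tendsto (fun s : unitInterval => c e.1 * |(s : ℝ) - s₀|) (𝓝 s₀) (𝓝 0) := by
      have : Continuous fun s : unitInterval => c e.1 * |(s : ℝ) - s₀| := by fun_prop
      simpa using this.tendsto s₀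
    have h4 := ENNReal.Tendsto.const_mul (a := ENNReal.ofReal (ϖ ^ (-N)))
      (ENNReal.Tendsto.const_mul (a := ENNReal.ofReal K) (ENNReal.tendsto_ofReal h3)
        (Or.inr ENNReal.ofReal_ne_top)) (Or.inr ENNReal.ofReal_ne_top)
    simpa using h4
  filter_upwards [(ENNReal.tendsto_nhds_zero.1 h2) (ε / 2)
    (ENNReal.div_pos hε.ne' ENNReal.ofNat_ne_top)] with s hs
  have hht : ∀ s : ℝ, φ.ptHeight ((φ.coverGraph v).onEdge e s) = φ.height e.2 :=
    ptHeight_onEdge e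
  refine (hB N _ _ ((hht s).trans_le (by omega)) ((hht s₀).trans_le (by omega))).trans
    ((add_le_add (le_trans ?_ hs) hn).trans_eq (ENNReal.add_halves ε))
  have hup : ∀ s : ℝ, φ.up N ((φ.coverGraph v).onEdge e s) =
      φ.flow^[n] ((φ.coverGraph v).onEdge e s) := fun s => by
    rw [← up_add_ptHeight, hht s]
  rw [levelDist, scaledDist, hup, hup]
  exact mul_le_mul_right ((hflow _ _).trans (mul_le_mul_right
    (Gph.pathDist_onEdge_le _ (c := fun e => c e.1) e s.2 s₀.2) _)) _

theorem continuous_rho : letI := h.metricSpace (v := v)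
    Continuous (φ.rho ϖ c : φ.XTilde v → φ.ForwardSpace v ϖ c) := by
  let _ := h.metricSpace (v := v)
  have h1 : Continuous fun x : φ.CoverPt v => φ.rho ϖ c (φ.ofPt x) :=
    continuous_iSup_dom.2 fun e => continuous_coinduced_dom.2 (h.continuous_rho_onEdge e)
  -- In the quotient topology it suffices that `ρ` is constant along midsegments and continuous on
  -- their starting points.
  refine continuous_coinduced_dom.2 ((h1.comp continuous_fst).congr fun x => ?_)
  exact (rho_mkX x.1 x.2).symm

theorem joined_onEdge (e : φ.CoverEdge v) (s t : unitInterval) : letI := h.metricSpace (v := v)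
    Joined (φ.rho ϖ c (φ.ofPt ((φ.coverGraph v).onEdge e s)))
      (φ.rho ϖ c (φ.ofPt ((φ.coverGraph v).onEdge e t))) := by
  let _ := h.metricSpace (v := v)
  have := isPathConnected_iff_pathConnectedSpace.1
    ((convex_Icc (0 : ℝ) 1).isPathConnected (Set.nonempty_Icc.2 zero_le_one))
  exact (PathConnectedSpace.joined s t).map (h.continuous_rho_onEdge e)

theorem joined_near (z : φ.CoverPt v) : letI := h.metricSpace (v := v)
    Joined (φ.rho ϖ c (φ.ofPt z)) (φ.rho ϖ c (φ.ofPt ((φ.coverGraph v).node (near z)))) := by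
  let _ := h.metricSpace (v := v)
  rcases z with x | ⟨e, s⟩
  · exact Joined.refl _
  · have := h.joined_onEdge e ⟨s, s.2.1.le, s.2.2.le⟩ 0
    rw [Set.Icc.coe_zero, Gph.onEdge_zero, Gph.onEdge_of_mem] at this
    exact this

theorem joined_inclPath (x : φ.CoverVertex v) {b : V} (p : EdgePath x.1 b) :
    letI := h.metricSpace (v := v)
    Joined (φ.rho ϖ c (φ.ofPt ((φ.coverGraph v).node x)))
      (φ.rho ϖ c (φ.ofPt ((φ.coverGraph v).node ⟨b, x.2 ≫ φ.inclPath p⟩))) := by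
  let _ := h.metricSpace (v := v)
  induction p with
  | nil => rw [inclPath_nil, Category.comp_id]
  | fwd p e ih =>
    have h1 := h.joined_onEdge ⟨⟨_, _, e⟩, x.2 ≫ φ.inclPath p⟩ 0 1
    rw [Set.Icc.coe_zero, Set.Icc.coe_one, Gph.onEdge_zero, Gph.onEdge_one] at h1
    have h' : (⟨_, x.2 ≫ φ.inclPath (p.fwd e)⟩ : φ.CoverVertex v) =
        (φ.coverGraph v).τ ⟨⟨_, _, e⟩, x.2 ≫ φ.inclPath p⟩ := by
      rw [inclPath_fwd, ← Category.assoc]; rfl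
    rw [h']
    exact ih.trans h1
  | bwd p e ih =>
    have h1 := h.joined_onEdge ⟨⟨_, _, e⟩, x.2 ≫ φ.inclPath (p.bwd e)⟩ 1 0
    rw [Set.Icc.coe_zero, Set.Icc.coe_one, Gph.onEdge_zero, Gph.onEdge_one] at h1
    have h' : (⟨_, x.2 ≫ φ.inclPath p⟩ : φ.CoverVertex v) =
        (φ.coverGraph v).τ ⟨⟨_, _, e⟩, x.2 ≫ φ.inclPath (p.bwd e)⟩ := by
      change _ = (⟨_, (x.2 ≫ φ.inclPath (p.bwd e)) ≫ φ.vert e⟩ : φ.CoverVertex v)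
      rw [inclPath_bwd, Category.assoc, Category.assoc, IsIso.inv_hom_id, Category.comp_id]
    rw [h'] at ih
    exact ih.trans h1

/-- Both points may be moved along their leaves without changing their images. After reaching a
common height, and then a common component, an edge path joins the nearby vertices. -/
theorem joined (q q' : φ.ForwardSpace v ϖ c) : letI := h.metricSpace (v := v)
    Joined q q' := by
  let _ := h.metricSpace (v := v)
  rw [← rho_ofPt_rep q, ← rho_ofPt_rep q']
  generalize rep q = x
  generalize rep q' = y
  set N := max (φ.ptHeight x) (φ.ptHeight y)
  have hx : φ.ptHeight (φ.up N x) = N := ptHeight_up (le_max_left _ _)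
  have hy : φ.ptHeight (φ.up N y) = N := ptHeight_up (le_max_right _ _)
  rw [← rho_up N x, ← rho_up N y]
  refine (h.joined_near _).trans (Joined.trans ?_ (h.joined_near _).symm)
  obtain ⟨n, p, hp⟩ := exists_path_iterate (x := near (φ.up N x)) (y := near (φ.up N y))
    (by rw [← ptHeight_eq, ← ptHeight_eq, hx, hy])
  rw [← rho_iterate_flow n, ← rho_iterate_flow n ((φ.coverGraph v).node (near (φ.up N y))),
    iterate_flow_node, iterate_flow_node, ← hp]
  exact h.joined_inclPath ⟨_, _⟩ p

theorem isRTree : letI := h.metricSpace (v := v); IsRTree (φ.ForwardSpace v ϖ c) := by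
  let _ := h.metricSpace (v := v)
  have h4 : FourPoint (fun x y : φ.ForwardSpace v ϖ c => dist x y) 0 := by
    intro x y z t
    rw [mul_zero, add_zero]
    have hfin := h.limDist_ne_top (v := v)
    have hadd : ∀ a b a' b' : φ.ForwardSpace v ϖ c, dist a b + dist a' b' =
        (φ.limDist ϖ c (rep a) (rep b) + φ.limDist ϖ c (rep a') (rep b')).toReal :=
      fun a b a' b' => (ENNReal.toReal_add (hfin _ _) (hfin _ _)).symm
    have hnt : ∀ a b a' b' : φ.CoverPt v,
        φ.limDist ϖ c a b + φ.limDist ϖ c a' b' ≠ ⊤ := fun a b a' b' =>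
      ENNReal.add_ne_top.2 ⟨hfin _ _, hfin _ _⟩
    rw [hadd, hadd, hadd, ← ENNReal.toReal_max (hnt _ _ _ _) (hnt _ _ _ _)]
    refine ENNReal.toReal_mono (max_lt (hnt _ _ _ _).lt_top (hnt _ _ _ _).lt_top).ne
      (h.fourPoint_limDist _ _ _ _)
  have : PreconnectedSpace (φ.ForwardSpace v ϖ c) := by
    refine ⟨isPreconnected_of_forall_pair fun q _ q' _ => ?_⟩
    obtain ⟨γ⟩ := h.joined q q'
    exact ⟨Set.range γ, Set.subset_univ _, ⟨0, γ.source⟩, ⟨1, γ.target⟩,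
      isPreconnected_range γ.continuous⟩
  exact ⟨h4.isGeodesicSpace, h4⟩

/-! ### The action of `G` by homotheties of the forward space -/

theorem rho_actPt_congr (g : φ.G v) {x y : φ.CoverPt v}
    (hxy : φ.rho ϖ c (φ.ofPt x) = φ.rho ϖ c (φ.ofPt y)) :
    φ.rho ϖ c (φ.ofPt (φ.actPt g x)) = φ.rho ϖ c (φ.ofPt (φ.actPt g y)) := by
  rw [h.rho_eq_iff] at hxy ⊢
  rw [h.limDist_actPt, hxy, mul_zero]

/-- The action of `G` on the forward space. -/
@[reducible] def mulAction : MulAction (φ.G v) (φ.ForwardSpace v ϖ c) where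
  smul g q := φ.rho ϖ c (φ.ofPt (φ.actPt g (rep q)))
  one_smul q := by
    change φ.rho ϖ c (φ.ofPt (φ.actPt 1 (rep q))) = q
    rw [φ.one_actPt, rho_ofPt_rep]
  mul_smul g g' q := by
    change φ.rho ϖ c (φ.ofPt (φ.actPt (g * g') (rep q))) = φ.rho ϖ c (φ.ofPt (φ.actPt g (rep
      (φ.rho ϖ c (φ.ofPt (φ.actPt g' (rep q)))))))
    rw [φ.mul_actPt]
    exact h.rho_actPt_congr g (rho_ofPt_rep _).symm

theorem smul_rho (g : φ.G v) (x : φ.CoverPt v) : letI := h.mulAction (v := v)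
    g • φ.rho ϖ c (φ.ofPt x) = φ.rho ϖ c (φ.ofPt (φ.actPt g x)) :=
  h.rho_actPt_congr g (rho_ofPt_rep _)

theorem edist_smul (g : φ.G v) (q q' : φ.ForwardSpace v ϖ c) :
    letI := h.metricSpace (v := v); letI := h.mulAction (v := v)
    edist (g • q) (g • q') = ENNReal.ofReal (ϖ ^ (-φ.height g)) * edist q q' := by
  let _ := h.metricSpace (v := v)
  let _ := h.mulAction (v := v)
  rw [← rho_ofPt_rep q, ← rho_ofPt_rep q', h.smul_rho, h.smul_rho, h.edist_rho, h.edist_rho,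
    h.limDist_actPt]

theorem continuous_smul (g : φ.G v) : letI := h.metricSpace (v := v)
    letI := h.mulAction (v := v)
    Continuous fun q : φ.ForwardSpace v ϖ c => g • q := by
  let _ := h.metricSpace (v := v)
  let _ := h.mulAction (v := v)
  exact LipschitzWith.continuous (K := (ϖ ^ (-φ.height g)).toNNReal)
    fun q q' => (h.edist_smul g q q').le

theorem isHomeomorph_smul (g : φ.G v) : letI := h.metricSpace (v := v)
    letI := h.mulAction (v := v)
    IsHomeomorph fun q : φ.ForwardSpace v ϖ c => g • q := by
  let _ := h.metricSpace (v := v)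
  let _ := h.mulAction (v := v)
  exact (Homeomorph.mk (MulAction.toPerm g) (h.continuous_smul g)
    (h.continuous_smul g⁻¹)).isHomeomorph

omit [Finite (Quiver.Total V)] h in
theorem _root_.GraphMap.height_eq_zero_of_mem {f : φ.G v} (hf : f ∈ φ.F v) : φ.height f = 0 := by
  obtain ⟨f, rfl⟩ := hf
  obtain ⟨p, rfl⟩ := exists_pathClass_eq (show vtx v ⟶ vtx v from f)
  exact (congrArg φ.height (φ.inclFunctor_pathClass p)).trans (φ.height_inclPath p)

theorem isometry_smul {f : φ.G v} (hf : f ∈ φ.F v) : letI := h.metricSpace (v := v)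
    letI := h.mulAction (v := v)
    Isometry fun q : φ.ForwardSpace v ϖ c => f • q := by
  let _ := h.metricSpace (v := v)
  let _ := h.mulAction (v := v)
  intro q q'
  change edist (f • q) (f • q') = _
  rw [h.edist_smul, height_eq_zero_of_mem hf]
  simp

end IsMetricTrainTrack

end GraphMap

/-! ## Stabilizers of periodic points -/

namespace GraphMap

open EdgePath FreeGroup
open scoped Classical

variable {V : Type u} [Quiver.{w} V] {φ : GraphMap V} {v : V}
variable {ϖ : ℝ} {c : Quiver.Total V → ℝ}

theorem up_ptHeight (x : φ.CoverPt v) : φ.up (φ.ptHeight x) x = x := by simp [up]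

theorem exists_word_pow {a : V} (q : EdgePath a a) (n : ℕ) :
    ∃ q' : EdgePath a a, word q' = word q ^ n ∧ φ.inclPath q' = (φ.inclPath q : φ.G a) ^ n := by
  induction n with
  | zero => exact ⟨nil, by simp, by rw [pow_zero]; exact φ.inclPath_nil a⟩
  | succ n ih =>
    obtain ⟨q', h1, h2⟩ := ih
    refine ⟨q'.comp q, by rw [word_comp, h1, pow_succ], ?_⟩
    rw [inclPath_comp, h2, pow_succ]
    rfl

namespace IsMetricTrainTrack

variable (h : φ.IsMetricTrainTrack ϖ c)
include h

/-- Torsion-freeness of `F`: a loop is detected by its word in a free group, and free groups are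
torsion-free. -/
theorem eq_one_of_pow_eq_one {f : φ.G v} (hf : f ∈ φ.F v) {n : ℕ} (hn : n ≠ 0)
    (hpow : f ^ n = 1) : f = 1 := by
  obtain ⟨f, rfl⟩ := hf
  obtain ⟨q, rfl⟩ := exists_pathClass_eq (show vtx v ⟶ vtx v from f)
  have hq : φ.inclFunctor.mapVertexGroup (vtx v) (pathClass q) = φ.inclPath q :=
    φ.inclFunctor_pathClass q
  rw [hq] at hpow ⊢
  obtain ⟨q', h1, h2⟩ := exists_word_pow (φ := φ) q n
  have h3 : φ.inclPath q' = φ.inclPath nil := by rw [h2, hpow, inclPath_nil]; rfl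
  have h4 := word_eq_of_pathClass_eq (h.pathClass_eq h3)
  rw [h1, word_nil] at h4
  have h5 : word q = word (nil : EdgePath v v) := (pow_eq_one_iff_left hn).1 h4
  rw [φ.inclPath_eq_of_pathClass_eq (pathClass_eq_of_word_eq h5), inclPath_nil]
  rfl

/-- In `X` a path and its image differ by horizontal edges only, so injectivity of the inclusion
makes `φ` injective on path classes with given endpoints. -/
theorem pathClass_eq_of_mapPath {a b : V} {p q : EdgePath a b}
    (hpq : pathClass (φ.mapPath p) = pathClass (φ.mapPath q)) : pathClass p = pathClass q := by
  refine h.pathClass_eq ?_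
  rw [← cancel_mono (φ.hor b), ← hor_comp_inclPath_mapPath, ← hor_comp_inclPath_mapPath,
    φ.inclPath_eq_of_pathClass_eq hpq]

theorem eq_of_word_mapPath {a b : V} {p q : EdgePath a b} (hp : IsReduced (edgeList p))
    (hq : IsReduced (edgeList q)) (hpq : word (φ.mapPath p) = word (φ.mapPath q)) :
    edgeList p = edgeList q := by
  have h1 := word_eq_of_pathClass_eq (h.pathClass_eq_of_mapPath (pathClass_eq_of_word_eq hpq))
  rw [← hp.reduce_eq, ← hq.reduce_eq, ← toWord_mk, ← toWord_mk]
  exact congrArg toWord h1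

variable [Finite (Quiver.Total V)]

/-- Properness of `φ`: for each of the finitely many pairs of endpoints, reduced paths inject into
tightened images, and only finitely many words have length at most `R`. -/
theorem exists_bound_of_nrm_substHom_le [Finite V] (R : ℝ) :
    ∃ B, ∀ l ∈ {l | ∃ (a b : V) (p : EdgePath a b), edgeList p = l}, IsReduced l →
      nrm c (substHom φ.letters (FreeGroup.mk l)) ≤ R → wt c l ≤ B := by
  have hfin : (⋃ a : V, ⋃ b : V, {l | ∃ p : EdgePath a b, edgeList p = l ∧ IsReduced l ∧
      nrm c (substHom φ.letters (FreeGroup.mk l)) ≤ R}).Finite := by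
    refine Set.finite_iUnion fun a => Set.finite_iUnion fun b => ?_
    refine Set.Finite.of_finite_image (f := fun l => (substHom φ.letters (FreeGroup.mk l)).toWord)
      ((finite_wt_le h.pos R).subset ?_) ?_
    · rintro _ ⟨l, ⟨p, -, -, hl⟩, rfl⟩
      exact hl
    · rintro _ ⟨p, rfl, hp, -⟩ _ ⟨q, rfl, hq, -⟩ hpq
      refine h.eq_of_word_mapPath hp hq ?_
      rw [word_mapPath, word_mapPath]
      exact toWord_injective hpq
  obtain ⟨B, -, hB⟩ := exists_pos_bound hfin (wt c)
  exact ⟨B, fun l ⟨a, b, p, hp⟩ hl hR =>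
    hB l (Set.mem_iUnion₂.2 ⟨a, b, p, hp, hl, hR⟩)⟩

/-- The growth estimate is applied to words of actual edge paths, because properness is established
only for these and not for arbitrary words in the edges. -/
theorem exists_growth_path [Finite V] : ∃ K, ∀ {a b : V} (p : EdgePath a b) (l),
    l <:+: (word p).toWord → Legal φ.letters l → ∀ n,
      ϖ ^ n * (wt c l - K) ≤ nrm c ((substHom φ.letters)^[n] (word p)) := by
  have hinfix : ∀ l ∈ {l | ∃ (a b : V) (p : EdgePath a b), edgeList p = l}, ∀ l', l' <:+: l →
      l' ∈ {l | ∃ (a b : V) (p : EdgePath a b), edgeList p = l} := by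
    rintro _ ⟨a, b, p, rfl⟩ l' ⟨s, t, hst⟩
    obtain ⟨_, p₁, -, h1, -, -⟩ := p.exists_split (s ++ l') t hst.symm
    obtain ⟨_, -, p₂, -, h2, -⟩ := p₁.exists_split s l' h1
    exact ⟨_, _, p₂, h2⟩
  obtain ⟨K, hK⟩ := exists_growth h.pos h.one_lt h.wt_letters hinfix
    (by
      rintro _ ⟨a, b, p, rfl⟩
      exact ⟨b, a, p.symm, edgeList_symm p⟩)
    (by
      rintro _ ⟨a, b, p, rfl⟩
      obtain ⟨p', hp', -⟩ := (φ.mapPath p).exists_isReduced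
      exact ⟨_, _, p', by rw [hp', word, edgeList_mapPath]⟩)
    h.exists_bound_of_nrm_substHom_le
  refine ⟨K, fun {a b} p l hl hlegal n => ?_⟩
  obtain ⟨p', hp', -⟩ := p.exists_isReduced
  have := hK _ ⟨a, b, p', hp'⟩ isReduced_toWord l hl hlegal n
  rwa [mk_toWord] at this

/-- A legal subpath longer than the cancellation constant keeps the leaves of the endpoints apart.
-/
theorem exists_le_limDist [Finite V] : ∃ K, ∀ {a b : φ.CoverVertex v} (p : EdgePath a.1 b.1),
    a.2 ≫ φ.inclPath p = b.2 → ∀ l, l <:+: (word p).toWord → Legal φ.letters l →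
      ENNReal.ofReal (ϖ ^ (-φ.height a.2)) * ENNReal.ofReal (wt c l - K) ≤
        φ.limDist ϖ c ((φ.coverGraph v).node a) ((φ.coverGraph v).node b) := by
  obtain ⟨K, hK⟩ := h.exists_growth_path
  refine ⟨K, fun {a b} p hp l hl hlegal => ?_⟩
  have h0 : 0 < ϖ := one_pos.trans h.one_lt
  have hht : φ.ptHeight ((φ.coverGraph v).node b) = φ.ptHeight ((φ.coverGraph v).node a) := by
    change φ.height b.2 = φ.height a.2
    rw [← hp, height_comp, height_inclPath, add_zero]
  refine ge_of_tendsto' (h.tendsto_flowDist (k := φ.ptHeight ((φ.coverGraph v).node a)) rfl hht)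
    fun n => ?_
  have hp' : (a.2 ≫ φ.horIter n a.1) ≫ φ.inclPath (φ.mapPathIter n p) =
      b.2 ≫ φ.horIter n b.1 := by
    rw [Category.assoc, horIter_comp_inclPath, ← hp, Category.assoc]
  rw [flowDist, scaledDist, iterate_flow_node, iterate_flow_node]
  have h1 := coverDist_eq_nrm h.pos h.pathClass_eq (x := ⟨_, a.2 ≫ φ.horIter n a.1⟩)
    (y := ⟨_, b.2 ≫ φ.horIter n b.1⟩) (φ.mapPathIter n p) hp'
  rw [coverDist] at h1
  rw [h1, word_mapPathIter]
  have h2 : ENNReal.ofReal (ϖ ^ (-φ.height a.2)) =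
      ENNReal.ofReal (ϖ ^ (-(φ.height a.2 + n))) * ENNReal.ofReal (ϖ ^ n) :=
    (h.ofReal_zpow_mul _ n).symm
  rw [h2, mul_assoc, ← ENNReal.ofReal_mul (by positivity)]
  exact mul_le_mul_right (ENNReal.ofReal_le_ofReal (hK p l hl hlegal n)) _

theorem exists_limDist_near_le : ∃ C, 0 < C ∧ ∀ z : φ.CoverPt v,
    φ.limDist ϖ c z ((φ.coverGraph v).node (near z)) ≤
      ENNReal.ofReal (ϖ ^ (-φ.ptHeight z)) * ENNReal.ofReal C := by
  obtain ⟨C, hC, -, hnear⟩ := h.exists_coverDist_near_le (v := v)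
  obtain ⟨B, hB, hle⟩ := h.exists_limDist_le (v := v)
  refine ⟨C + B, by positivity, fun z => ?_⟩
  have hht : φ.ptHeight ((φ.coverGraph v).node (near z)) = φ.ptHeight z := (φ.ptHeight_eq z).symm
  refine (hle (φ.ptHeight z) _ _ le_rfl hht.le).trans ?_
  have h1 := up_ptHeight ((φ.coverGraph v).node (near z))
  rw [hht] at h1
  rw [levelDist, up_ptHeight, h1, scaledDist, ← mul_add, ENNReal.ofReal_add hC.le hB.le]
  exact mul_le_mul_right (add_le_add (hnear z) le_rfl) _

/-- Legal subpaths of the path joining the vertex near `z` to its translate are bounded, if the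
leaf of `z` is at distance `0` from its translate. -/
theorem exists_legal_le [Finite V] : ∃ K, ∀ (z : φ.CoverPt v) {f : φ.G v}, f ∈ φ.F v →
    φ.limDist ϖ c z (φ.actPt f z) = 0 → ∀ p : EdgePath (near z).1 (near z).1,
      (near z).2 ≫ φ.inclPath p = f ≫ (near z).2 → ∀ l, l <:+: (word p).toWord →
        Legal φ.letters l → wt c l ≤ K := by
  obtain ⟨C, hC, hnear⟩ := h.exists_limDist_near_le (v := v)
  obtain ⟨K, hK⟩ := h.exists_le_limDist (v := v)
  -- The two vertices are within scaled limit distance `C` of `z` and of its translate, whose leaves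
  -- are at distance `0`.
  refine ⟨K + 2 * C, fun z f hf hz p hp l hl hlegal => ?_⟩
  have h1 := hK (a := near z) (b := ⟨(near z).1, f ≫ (near z).2⟩) p hp l hl hlegal
  have h2 : φ.limDist ϖ c ((φ.coverGraph v).node (near z))
      ((φ.coverGraph v).node ⟨(near z).1, f ≫ (near z).2⟩) ≤
      ENNReal.ofReal (ϖ ^ (-φ.ptHeight z)) * ENNReal.ofReal (2 * C) := by
    have h3 := hnear (φ.actPt f z)
    rw [near_actPt, ptHeight_actPt, height_eq_zero_of_mem hf, zero_add] at h3
    refine (h.limDist_triangle _ z _).trans ((add_le_add ((limDist_comm _ _).trans_le (hnear z))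
      ((h.limDist_triangle _ (φ.actPt f z) _).trans (add_le_add hz.le h3))).trans_eq ?_)
    rw [two_mul, ENNReal.ofReal_add hC.le hC.le]
    ring
  have h4 := h1.trans h2
  rw [← ptHeight_eq, ENNReal.mul_le_mul_iff_right
    (ENNReal.ofReal_pos.2 (zpow_pos (one_pos.trans h.one_lt) _)).ne' ENNReal.ofReal_ne_top,
    ENNReal.ofReal_le_ofReal_iff (by positivity)] at h4
  linarith

omit [Finite (Quiver.Total V)] in
/-- The loop at the vertex near the image of `z` obtained from a loop at the image of the vertex
near `z`. -/
theorem exists_conj_loop (n : ℕ) (z : φ.CoverPt v) {f : φ.G v}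
    (p : EdgePath (φ.obj^[n] (near z).1) (φ.obj^[n] (near z).1))
    (hp : ((near z).2 ≫ φ.horIter n _) ≫ φ.inclPath p = (f ≫ (near z).2) ≫ φ.horIter n _) :
    ∃ (w : EdgePath (near (φ.flow^[n] z)).1 (near (φ.flow^[n] z)).1) (u : List _),
      Legal φ.letters u ∧
      (near (φ.flow^[n] z)).2 ≫ φ.inclPath w = f ≫ (near (φ.flow^[n] z)).2 ∧
        word w = (FreeGroup.mk u)⁻¹ * word p * FreeGroup.mk u := by
  obtain ⟨b, q, hq, hlist⟩ := φ.exists_near_iterate n z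
  rw [hq]
  refine ⟨q.symm.comp (p.comp q), edgeList q, ?_, ?_, ?_⟩
  · rcases hlist with h0 | ⟨e, he⟩
    · rw [h0]; exact legal_nil
    · exact ((h.legal (e, true)).iterate n).infix he.isInfix
  · change (((near z).2 ≫ φ.horIter n _) ≫ φ.inclPath q) ≫ φ.inclPath (q.symm.comp (p.comp q)) =
      f ≫ ((near z).2 ≫ φ.horIter n _) ≫ φ.inclPath q
    rw [inclPath_comp, inclPath_comp, inclPath_symm, Category.assoc, IsIso.hom_inv_id_assoc,
      ← Category.assoc, hp, Category.assoc, Category.assoc, Category.assoc]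
  · rw [word_comp, word_comp, word_symm, mul_assoc]
    rfl

-- The word is a product of legal pieces: `u`, its inverse, and the `n`-th images of the letters of
-- `l`. Their number `l.length + 2` does not depend on `n`.
omit [Finite (Quiver.Total V)] in
theorem nrm_conj_iterate_le {l u : List (Quiver.Total V × Bool)} (hu : Legal φ.letters u)
    {n : ℕ} {g : FreeGroup (Quiver.Total V)}
    (hg : g = (FreeGroup.mk u)⁻¹ * (substHom φ.letters)^[n] (FreeGroup.mk l) * FreeGroup.mk u)
    {K : ℝ} (hK : ∀ l', l' <:+: g.toWord → Legal φ.letters l' → wt c l' ≤ K) :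
    nrm c g ≤ (l.length + 2) * K := by
  have hflat : ∀ l : List (Quiver.Total V × Bool),
      (l.map fun x => (subst φ.letters)^[n] [x]).flatten = (subst φ.letters)^[n] l := by
    intro l
    induction l with
    | nil =>
      have := iterate_subst_append φ.letters n [] []
      simpa using this
    | cons x l ih =>
      rw [List.map_cons, List.flatten_cons, ih, ← iterate_subst_append]
      rfl
  set Q := [invRev u] ++ (l.map fun x => (subst φ.letters)^[n] [x]) ++ [u] with hQ
  have hg' : g = FreeGroup.mk Q.flatten := by
    rw [hg, substHom_iterate_mk, hQ, List.flatten_append, List.flatten_append, hflat]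
    simp [← mul_mk, ← inv_mk, mul_assoc]
  have hlegal : ∀ l ∈ Q, Legal φ.letters l := by
    intro l' hl'
    simp only [hQ, List.mem_append, List.mem_singleton, List.mem_map] at hl'
    rcases hl' with (rfl | ⟨x, -, rfl⟩) | rfl
    · exact hu.invRev
    · exact (h.legal x).iterate n
    · exact hu
  rw [hg'] at hK ⊢
  refine (nrm_le_of_legal_pieces Q hlegal hK).trans_eq ?_
  congr 1
  simp [hQ]
  ring

theorem eq_one_of_fixes [Finite V] (hhyp : IsWordHyperbolic (φ.G v)) {x : φ.CoverPt v}
    (hx : φ.IsPeriodicPoint (φ.proj x)) {f : φ.G v} (hf : f ∈ φ.F v)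
    (hfx : φ.limDist ϖ c x (φ.actPt f x) = 0) : f = 1 := by
  by_contra hf1
  obtain ⟨P, hP, hper⟩ := hx
  have hht : φ.height f = 0 := height_eq_zero_of_mem hf
  -- Flowing far enough brings the vertex near the image of `x` and its translate by `f` into one
  -- component, so that `f` is represented by a loop `w₀` in `V`.
  obtain ⟨n₀, p₀, hp₀⟩ := exists_path_iterate (x := near x) (y := ⟨_, f ≫ (near x).2⟩) (by
    rw [height_comp, hht, zero_add])
  obtain ⟨y, hy⟩ : ∃ y, y = φ.flow^[n₀] x := ⟨_, rfl⟩
  have hconj := h.exists_conj_loop n₀ x p₀ hp₀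
  rw [← hy] at hconj
  obtain ⟨w₀, -, -, hw₀, -⟩ := hconj
  have hyper : ∀ n : ℕ, φ.onPt^[n * P] (φ.proj y) = φ.proj y := by
    intro n
    have h1 : φ.onPt^[P] (φ.proj y) = φ.proj y := by
      rw [hy, proj_iterate_flow, ← Function.iterate_add_apply, add_comm,
        Function.iterate_add_apply, hper]
    rw [mul_comm, Function.iterate_mul]
    exact Function.iterate_fixed h1 n
  have hfy : ∀ n, φ.limDist ϖ c (φ.flow^[n] y) (φ.actPt f (φ.flow^[n] y)) = 0 := fun n => by
    rw [hy, ← iterate_flow_actPt, ← iterate_flow_actPt, limDist_iterate_left,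
      limDist_iterate_left, limDist_iterate_right, limDist_iterate_right, hfx]
  obtain ⟨K, hK⟩ := h.exists_legal_le (v := v)
  -- Each further period gives a loop representing `f`, based at the same vertex of `V` because the
  -- projected point returns. All its legal subpaths are bounded by `K`, so its length is bounded
  -- independently of `n`.
  have hloop : ∀ n : ℕ, ∃ (γ : φ.base v ⟶ φ.base (near y).1) (w : EdgePath (near y).1 (near y).1),
      φ.height γ = φ.ptHeight y + (n * P : ℕ) ∧ γ ≫ φ.inclPath w = f ≫ γ ∧
        nrm c (word w) ≤ ((edgeList w₀).length + 2) * K := by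
    intro n
    obtain ⟨w, u, hu, hw, hword⟩ := h.exists_conj_loop (n * P) y (f := f)
      (φ.mapPathIter (n * P) w₀) (by
        rw [Category.assoc, horIter_comp_inclPath, ← Category.assoc, hw₀])
    rw [word_mapPathIter] at hword
    have hnrm := h.nrm_conj_iterate_le hu hword (hK _ hf (hfy _) w hw)
    have hbase : (near (φ.flow^[n * P] y)).1 = (near y).1 :=
      φ.near_fst_eq_of_proj_eq (by rw [proj_iterate_flow, hyper])
    have hheight := φ.ptHeight_iterate_flow (n * P) y
    rw [ptHeight_eq] at hheight
    generalize near (φ.flow^[n * P] y) = a at *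
    obtain ⟨a, γ⟩ := a
    change a = (near y).1 at hbase
    subst hbase
    exact ⟨γ, w, hheight, hw, hnrm⟩
  choose γ w hγ hw hnrm using hloop
  -- Infinitely many loops share finitely many reduced words.
  obtain ⟨m, n, hmn, heq⟩ : ∃ m n, m ≠ n ∧ (word (w m)).toWord = (word (w n)).toWord := by
    have := (finite_wt_le h.pos (((edgeList w₀).length + 2) * K)).to_subtype
    obtain ⟨m, n, hne, heq⟩ := Finite.exists_ne_map_eq_of_infinite
      (fun n => (⟨(word (w n)).toWord, hnrm n⟩ : {l | wt c l ≤ ((edgeList w₀).length + 2) * K}))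
    exact ⟨m, n, hne, congrArg Subtype.val heq⟩
  have hincl : φ.inclPath (w m) = φ.inclPath (w n) :=
    φ.inclPath_eq_of_pathClass_eq (pathClass_eq_of_word_eq (toWord_injective heq))
  -- Conjugating the common loop by `γ m` and by `γ n` gives `f` both times, so `f` commutes with `γ
  -- m ≫ inv (γ n)`, whose height is `(m - n) * P`.
  refine hhyp.not_commute (heightHom φ v) (f := f) (g := γ m ≫ inv (γ n))
    (fun k hk => by_contra fun hk0 => hf1 (h.eq_one_of_pow_eq_one hf hk0 hk)) ?_ ?_ ?_
  · exact congrArg Multiplicative.ofAdd hht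
  · intro h1
    have h2 : φ.height (γ m ≫ inv (γ n)) = 0 := congrArg Multiplicative.toAdd h1
    rw [height_comp, height_inv, hγ, hγ] at h2
    have h3 : ((m * P : ℕ) : ℤ) = (n * P : ℕ) := by linarith
    exact hmn (Nat.eq_of_mul_eq_mul_right hP (by exact_mod_cast h3))
  · change f ≫ γ m ≫ inv (γ n) = (γ m ≫ inv (γ n)) ≫ f
    have h1 : f = γ n ≫ φ.inclPath (w n) ≫ inv (γ n) := by
      rw [← Category.assoc, hw, Category.assoc, IsIso.hom_inv_id, Category.comp_id]
    rw [← Category.assoc, ← hw, hincl]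
    conv_rhs => rw [h1]
    simp only [Category.assoc, IsIso.inv_hom_id_assoc]

end IsMetricTrainTrack

end GraphMap

/-! ## Graphs without edges -/

namespace GraphMap

open EdgePath

variable {V : Type u} [Quiver.{w} V] {φ : GraphMap V} {v : V} {ϖ : ℝ} {c : Quiver.Total V → ℝ}

section NoEdges

variable [IsEmpty (Quiver.Total V)]

theorem eq_nil_of_isEmpty {a b : V} (p : EdgePath a b) : ∃ hab : a = b, p = hab ▸ nil :=
  p.edgeList_eq_nil (List.eq_nil_iff_forall_not_mem.2 fun x _ => isEmptyElim x.1)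

theorem exists_node_of_isEmpty (z : φ.CoverPt v) : ∃ x, z = (φ.coverGraph v).node x := by
  rcases z with x | ⟨e, -⟩
  · exact ⟨x, rfl⟩
  · exact isEmptyElim e.1

theorem node_eq_of_isEmpty {a b : V} (γ : φ.base v ⟶ φ.base a) (p : EdgePath a b) :
    (φ.coverGraph v).node ⟨b, γ ≫ φ.inclPath p⟩ = (φ.coverGraph v).node ⟨a, γ⟩ := by
  obtain ⟨rfl, rfl⟩ := eq_nil_of_isEmpty p
  rw [inclPath_nil, Category.comp_id]

/-- Without edges, the vertical part of a normal form is trivial, so every vertex flows into the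
orbit of the base vertex and there is a single leaf. -/
theorem rho_eq_of_isEmpty (z : φ.CoverPt v) : φ.rho ϖ c (φ.ofPt z) =
    φ.rho ϖ c (φ.ofPt ((φ.coverGraph v).node ⟨v, 𝟙 (φ.base v)⟩)) := by
  obtain ⟨⟨a, γ⟩, rfl⟩ := exists_node_of_isEmpty z
  obtain ⟨n, m, p, hp⟩ := φ.exists_normal_form γ
  rw [← rho_iterate_flow m, ← rho_iterate_flow n ((φ.coverGraph v).node ⟨v, 𝟙 (φ.base v)⟩),
    iterate_flow_node, iterate_flow_node, hp, node_eq_of_isEmpty, Category.id_comp]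

theorem subsingleton_of_isEmpty : Subsingleton (φ.ForwardSpace v ϖ c) :=
  ⟨fun q q' => by
    rw [← rho_ofPt_rep q, ← rho_ofPt_rep q', rho_eq_of_isEmpty, rho_eq_of_isEmpty (rep q')]⟩

theorem tendsto_flowDist_of_isEmpty {k : ℤ} {x y : φ.CoverPt v} (hx : φ.ptHeight x = k)
    (hy : φ.ptHeight y = k) : Tendsto (φ.flowDist ϖ c k x y) atTop (𝓝 0) := by
  obtain ⟨a, rfl⟩ := exists_node_of_isEmpty x
  obtain ⟨b, rfl⟩ := exists_node_of_isEmpty y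
  obtain ⟨n, p, hp⟩ := exists_path_iterate (x := a) (y := b) (hx.trans hy.symm)
  have hn : φ.flow^[n] ((φ.coverGraph v).node a) = φ.flow^[n] ((φ.coverGraph v).node b) := by
    rw [iterate_flow_node, iterate_flow_node, ← hp, node_eq_of_isEmpty]
  refine tendsto_const_nhds.congr' (eventually_atTop.2 ⟨n, fun m hm => ?_⟩)
  obtain ⟨j, rfl⟩ := Nat.exists_eq_add_of_le' hm
  rw [flowDist, scaledDist, Function.iterate_add_apply, Function.iterate_add_apply, hn,
    Gph.pathDist_self, mul_zero]

theorem eq_one_of_mem_of_isEmpty {f : φ.G v} (hf : f ∈ φ.F v) : f = 1 := by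
  obtain ⟨f, rfl⟩ := hf
  obtain ⟨q, rfl⟩ := exists_pathClass_eq (show vtx v ⟶ vtx v from f)
  obtain ⟨_, rfl⟩ := eq_nil_of_isEmpty q
  exact map_one (φ.inclFunctor.mapVertexGroup (vtx v))

end NoEdges

end GraphMap

theorem mainTheorem7 {V : Type u} [Quiver.{w} V] [Finite V] [Fintype (Quiver.Total V)]
    (hconn : ∀ a b : V, Nonempty (EdgePath a b)) (v : V) (φ : GraphMap V)
    (hinj : φ.IsPiOneInjective v) (htt : φ.IsTrainTrack) (hexp : φ.HasExpandingEdges)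
    (hirr : φ.transition.IsIrreducible) (hhyp : IsWordHyperbolic (φ.G v)) :
    (∃ (ϖ : ℝ) (c : Quiver.Total V → ℝ), 1 < ϖ ∧ φ.IsPerron ϖ c) ∧
    ∀ (ϖ : ℝ) (c : Quiver.Total V → ℝ), φ.IsPerron ϖ c →
      ∃ _ : MetricSpace (φ.ForwardSpace v ϖ c),
        (∀ (k : ℤ) (x y : φ.CoverPt v), φ.ptHeight x = k → φ.ptHeight y = k →
          Tendsto (φ.flowDist ϖ c k x y) atTop
            (𝓝 (edist (φ.rho ϖ c (φ.ofPt x)) (φ.rho ϖ c (φ.ofPt y))))) ∧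
        Continuous (φ.rho ϖ c : φ.XTilde v → φ.ForwardSpace v ϖ c) ∧
        IsRTree (φ.ForwardSpace v ϖ c) ∧
        ∃ _ : MulAction (φ.G v) (φ.ForwardSpace v ϖ c),
          (∀ g : φ.G v, IsHomeomorph fun y : φ.ForwardSpace v ϖ c => g • y) ∧
          (∀ (g : φ.G v) (x : φ.XTilde v), φ.rho ϖ c (g • x) = g • φ.rho ϖ c x) ∧
          (∀ f ∈ φ.F v, Isometry fun y : φ.ForwardSpace v ϖ c => f • y) ∧
          ∀ x : φ.CoverPt v, φ.IsPeriodicPoint (φ.proj x) →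
            MulAction.stabilizer (φ.F v) (φ.rho ϖ c (φ.ofPt x)) = ⊥ := by
  refine ⟨?_, fun ϖ c hPF => ?_⟩
  · rcases isEmpty_or_nonempty (Quiver.Total V) with hE | hE
    -- Without edges the eigenvector equation is vacuous, and any number above `1` serves.
    · exact ⟨2, fun _ => 1, one_lt_two, fun _ => one_pos, funext fun e => isEmptyElim e⟩
    · obtain ⟨r, c, hc, hr⟩ := hirr.exists_pos_eigenvector
      exact ⟨r, c, GraphMap.one_lt_of_wt_letters htt hexp hc fun e => by
        rw [← GraphMap.transition_mulVec, hr]; rfl, hc, hr⟩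
  -- Without edges `ϖ` is unconstrained and may be at most `1`, so the convergence argument is
  -- unavailable; but then the forward space is a single point.
  rcases isEmpty_or_nonempty (Quiver.Total V) with hE | hE
  · have hsub : Subsingleton (φ.ForwardSpace v ϖ c) := GraphMap.subsingleton_of_isEmpty
    let M : MetricSpace (φ.ForwardSpace v ϖ c) :=
      { dist := fun _ _ => 0
        dist_self := fun _ => rfl
        dist_comm := fun _ _ => rfl
        dist_triangle := fun _ _ _ => (add_zero (0 : ℝ)).ge
        eq_of_dist_eq_zero := fun _ => Subsingleton.elim _ _ }
    let A : MulAction (φ.G v) (φ.ForwardSpace v ϖ c) :=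
      { smul := fun _ q => q
        one_smul := fun _ => rfl
        mul_smul := fun _ _ _ => rfl }
    refine ⟨M, fun k x y hx hy => ?_, continuous_of_const fun _ _ => Subsingleton.elim _ _,
      ⟨fun x y => ⟨fun _ => x, rfl, Subsingleton.elim _ _, fun s hs t ht => ?_⟩, fun x y z t => ?_⟩,
      A, fun g => IsHomeomorph.id, fun g x => Subsingleton.elim _ _, fun f _ => isometry_id,
      fun x _ => ?_⟩
    · rw [Subsingleton.elim (φ.rho ϖ c (φ.ofPt x)) (φ.rho ϖ c (φ.ofPt y)), edist_self]
      exact GraphMap.tendsto_flowDist_of_isEmpty hx hy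
    · rw [Subsingleton.elim y x, dist_self] at hs ht
      rw [dist_self, le_antisymm hs.2 hs.1, le_antisymm ht.2 ht.1, sub_self, abs_zero]
    · simp [Subsingleton.elim _ x]
    · exact (Subgroup.eq_bot_iff_forall _).2 fun f _ =>
        Subtype.ext (GraphMap.eq_one_of_mem_of_isEmpty f.2)
  · have hwt : ∀ e, FreeGroup.wt c (φ.letters e) = ϖ * c e := fun e => by
      rw [← GraphMap.transition_mulVec, hPF.2]; rfl
    have h : φ.IsMetricTrainTrack ϖ c :=
      { pathClass_eq := hinj.pathClass_eq_of_inclPath_eq hconn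
        legal := htt.legal_singleton
        pos := hPF.1
        wt_letters := hwt
        one_lt := GraphMap.one_lt_of_wt_letters htt hexp hPF.1 hwt }
    let _ := h.metricSpace (v := v)
    let _ := h.mulAction (v := v)
    refine ⟨h.metricSpace, fun k x y hx hy => ?_, h.continuous_rho, h.isRTree, h.mulAction,
      h.isHomeomorph_smul, fun g x => ?_, fun f hf => h.isometry_smul hf, fun x hx => ?_⟩
    · rw [h.edist_rho]
      exact h.tendsto_flowDist hx hy
    · rw [← GraphMap.rho_ofPt_fst x, h.smul_rho, ← GraphMap.rho_ofPt_fst (g • x)]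
      rfl
    · refine (Subgroup.eq_bot_iff_forall _).2 fun f hf => Subtype.ext ?_
      have hfx : φ.rho ϖ c (φ.ofPt (φ.actPt (f : φ.G v) x)) = φ.rho ϖ c (φ.ofPt x) :=
        (h.smul_rho _ x).symm.trans hf
      exact h.eq_one_of_fixes hhyp hx f.2 (h.rho_eq_iff.1 hfx.symm)
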